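/- Let $CH(X)$ denote the convex hull of a set $X\subset\mathbb{R}^2$, and for finite sets $Q,P\subset\mathbb{R}^2$ let \[ cost(Q,P)=\max_{p\in P}\ \|p-CH(Q)\| , \] where $\|p-CH(Q)\|$ is the Euclidean distance from $p$ to $CH(Q)$ (understood as $+\infty$ if $Q=\emptyset$); for nonempty $Q\subseteq P$ this is the Hausdorff distance between $CH(Q)$ and $CH(P)$. **Theorem.** There is a deterministic real RAM algorithm which, given a nonempty set $P\subset\mathbb{R}^2$ of $n$ points in convex position (no point of $P$ lies in the convex hull of the other points), listed in an arbitrary order, and a value $\varepsilon>0$, computes in $O(n\log^2 n)$ time in the worst case the smallest integer $k$ such that there exists a subset $Q\subseteq P$ with $|Q|\le k$ and $cost(Q,P)\le\varepsilon$, together with $k$ points of $P$ forming such a set $Q$. Here the real RAM performs the operations $+,-,\times,/$ and comparisons on real numbers exactly, and the usual arithmetic, comparison and array indexing on integer words of $O(\log n)$ bits, each at unit cost. -/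

import Mathlib

open Filter Asymptotics
open scoped ENNReal

/-- The Euclidean plane. -/
abbrev Plane : Type := EuclideanSpace ℝ (Fin 2)

/-- A finite point set is in convex position: no point of it lies in the convex hull of
other points of it. -/
def InConvexPosition (P : Finset Plane) : Prop :=
  ConvexIndependent ℝ (fun x : P => (x : Plane))

/-- `cost Q P = max_{p ∈ P} ‖p - CH(Q)‖`, where `‖p - CH(Q)‖` is the Euclidean distance from `p`
to the convex hull of `Q`. The value is taken in `[0, ∞]`, so that the distance to the empty set
is `∞`; for nonempty `Q` it is finite. -/
noncomputable def cost (Q P : Finset Plane) : ℝ≥0∞ :=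
  ⨆ p ∈ P, Metric.infEDist p (convexHull ℝ (Q : Set Plane))

/-! ### The real RAM

A deterministic random access machine with two types of cells: words of `w` bits, and real
numbers. There are word and real variables, and word and real arrays (array names and variable
names are constants of the program, of which a program mentions only finitely many; array indices
are computed at run time and are words). A program is a fixed finite text in a structured
language; the words support the usual integer arithmetic modulo `2 ^ w`, the reals support exact
`+`, `-`, `*`, `/` and comparison. There is no rounding of reals to integers and there are no real
constants other than those obtained from integers. Each operation, variable access, array access,
comparison and assignment costs one step. -/

namespace RealRAM

/-- The four arithmetic operations. -/
inductive Op : Type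
  | add | sub | mul | div

/-- On natural numbers: truncated subtraction and division rounded down. -/
def Op.onNat : Op → ℕ → ℕ → ℕ
  | .add, a, b => a + b
  | .sub, a, b => a - b
  | .mul, a, b => a * b
  | .div, a, b => a / b

/-- On real numbers: exact arithmetic (with `x / 0 = 0`). -/
noncomputable def Op.onReal : Op → ℝ → ℝ → ℝ
  | .add, a, b => a + b
  | .sub, a, b => a - b
  | .mul, a, b => a * b
  | .div, a, b => a / b

/-- The memory. -/
structure State : Type where
  /-- word variables -/
  wordVar : ℕ → ℕ
  /-- real variables -/
  realVar : ℕ → ℝ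
  /-- word arrays: array name, index -/
  wordArr : ℕ → ℕ → ℕ
  /-- real arrays: array name, index -/
  realArr : ℕ → ℕ → ℝ

/-- Set word variable `i` to `v`. -/
def State.setWord (σ : State) (i v : ℕ) : State :=
  { σ with wordVar := Function.update σ.wordVar i v }

/-- Set real variable `i` to `v`. -/
def State.setReal (σ : State) (i : ℕ) (v : ℝ) : State :=
  { σ with realVar := Function.update σ.realVar i v }

/-- Set the entry with index `j` of word array `a` to `v`. -/
def State.storeWord (σ : State) (a j v : ℕ) : State :=
  { σ with wordArr := Function.update σ.wordArr a (Function.update (σ.wordArr a) j v) }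

/-- Set the entry with index `j` of real array `a` to `v`. -/
def State.storeReal (σ : State) (a j : ℕ) (v : ℝ) : State :=
  { σ with realArr := Function.update σ.realArr a (Function.update (σ.realArr a) j v) }

/-- Word expressions. -/
inductive WExp : Type
  | const (c : ℕ)
  | var (i : ℕ)
  | load (a : ℕ) (index : WExp)
  | op (o : Op) (e f : WExp)

/-- Value of a word expression when words have `w` bits. -/
def WExp.eval (w : ℕ) (σ : State) : WExp → ℕ
  | .const c => c % 2 ^ w
  | .var i => σ.wordVar i
  | .load a e => σ.wordArr a (e.eval w σ)
  | .op o e f => o.onNat (e.eval w σ) (f.eval w σ) % 2 ^ w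

/-- Number of steps to evaluate a word expression. -/
def WExp.steps : WExp → ℕ
  | .const _ => 1
  | .var _ => 1
  | .load _ e => e.steps + 1
  | .op _ e f => e.steps + f.steps + 1

/-- Real expressions. -/
inductive RExp : Type
  | ofWord (e : WExp)
  | var (i : ℕ)
  | load (a : ℕ) (index : WExp)
  | op (o : Op) (e f : RExp)

/-- Value of a real expression when words have `w` bits. -/
noncomputable def RExp.eval (w : ℕ) (σ : State) : RExp → ℝ
  | .ofWord e => (e.eval w σ : ℝ)
  | .var i => σ.realVar i
  | .load a e => σ.realArr a (e.eval w σ)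
  | .op o e f => o.onReal (e.eval w σ) (f.eval w σ)

/-- Number of steps to evaluate a real expression. -/
def RExp.steps : RExp → ℕ
  | .ofWord e => e.steps + 1
  | .var _ => 1
  | .load _ e => e.steps + 1
  | .op _ e f => e.steps + f.steps + 1

/-- Tests: comparisons of words or of reals, and their Boolean combinations. -/
inductive Test : Type
  | wordLt (e f : WExp)
  | realLt (e f : RExp)
  | not (b : Test)
  | and (b c : Test)

/-- The test succeeds. -/
def Test.Holds (w : ℕ) (σ : State) : Test → Prop
  | .wordLt e f => e.eval w σ < f.eval w σ
  | .realLt e f => e.eval w σ < f.eval w σ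
  | .not b => ¬ b.Holds w σ
  | .and b c => b.Holds w σ ∧ c.Holds w σ

/-- Number of steps to evaluate a test. -/
def Test.steps : Test → ℕ
  | .wordLt e f => e.steps + f.steps + 1
  | .realLt e f => e.steps + f.steps + 1
  | .not b => b.steps + 1
  | .and b c => b.steps + c.steps + 1

/-- Programs. -/
inductive Program : Type
  | skip
  | setWord (i : ℕ) (e : WExp)
  | setReal (i : ℕ) (e : RExp)
  | storeWord (a : ℕ) (index e : WExp)
  | storeReal (a : ℕ) (index : WExp) (e : RExp)
  | seq (p q : Program)
  | ite (b : Test) (p q : Program)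
  | loop (b : Test) (p : Program)

/-- `Exec w p σ τ t`: on words of `w` bits, the program `p` started in `σ` halts in `τ`
after exactly `t` steps. The program `loop b p` runs `p` again and again while `b` holds. -/
inductive Exec (w : ℕ) : Program → State → State → ℕ → Prop
  | skip (σ : State) : Exec w .skip σ σ 1
  | setWord (i : ℕ) (e : WExp) (σ : State) :
      Exec w (.setWord i e) σ
        (σ.setWord i (e.eval w σ)) (e.steps + 1)
  | setReal (i : ℕ) (e : RExp) (σ : State) :
      Exec w (.setReal i e) σ
        (σ.setReal i (e.eval w σ)) (e.steps + 1)
  | storeWord (a : ℕ) (index e : WExp) (σ : State) :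
      Exec w (.storeWord a index e) σ
        (σ.storeWord a (index.eval w σ) (e.eval w σ))
        (index.steps + e.steps + 1)
  | storeReal (a : ℕ) (index : WExp) (e : RExp) (σ : State) :
      Exec w (.storeReal a index e) σ
        (σ.storeReal a (index.eval w σ) (e.eval w σ))
        (index.steps + e.steps + 1)
  | seq {p q : Program} {σ τ υ : State} {s t : ℕ}
      (hp : Exec w p σ τ s) (hq : Exec w q τ υ t) : Exec w (.seq p q) σ υ (s + t)
  | iteTrue {b : Test} {p q : Program} {σ τ : State} {t : ℕ}
      (hb : b.Holds w σ) (hp : Exec w p σ τ t) : Exec w (.ite b p q) σ τ (b.steps + t)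
  | iteFalse {b : Test} {p q : Program} {σ τ : State} {t : ℕ}
      (hb : ¬ b.Holds w σ) (hq : Exec w q σ τ t) : Exec w (.ite b p q) σ τ (b.steps + t)
  | loopDone {b : Test} {p : Program} {σ : State}
      (hb : ¬ b.Holds w σ) : Exec w (.loop b p) σ σ b.steps
  | loopStep {b : Test} {p : Program} {σ τ υ : State} {s t : ℕ}
      (hb : b.Holds w σ) (hp : Exec w p σ τ s) (hl : Exec w (.loop b p) τ υ t) :
      Exec w (.loop b p) σ υ (b.steps + s + t)

/-- The initial memory on the points `x 0, …, x (n - 1)` and the value `ε`: word variable `0`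
holds `n`, real variable `0` holds `ε`, the real arrays `0` and `1` hold the first and the second
coordinates of the points; everything else is `0`. -/
noncomputable def input {n : ℕ} (x : Fin n → Plane) (ε : ℝ) : State where
  wordVar i := if i = 0 then n else 0
  realVar i := if i = 0 then ε else 0
  wordArr _ _ := 0
  realArr a i :=
    if h : i < n then
      if a = 0 then x ⟨i, h⟩ 0 else if a = 1 then x ⟨i, h⟩ 1 else 0
    else 0

end RealRAM

/-! List the points in counterclockwise order and index the vertices of the polygon periodically by
`ℤ`. If `i` and `j` are cyclically consecutive vertices of a subset `Q`, the hull of `Q` lies beyond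
the chord `i j` as seen from the vertices that this chord cuts off. Hence for these vertices the
distance to the hull is governed by the chord alone (`CcwSeq.segNear_of_hull`), and a nonempty `Q`
has cost at most `ε` iff all its consecutive chords are `Good` (`cost_le_of_good`,
`good_of_cost_le`). The same argument shows that a chord nested in a good chord is good
(`CcwSeq.good_mono`). So the task is to find a shortest closed chain of jumps for a monotone
relation on a circle, and such a relation is described by the longest jump from each vertex
(`JumpSystem`).

Goodness of a chord is tested in constant time. Being near a segment means being near both rays that
start at its ends and contain it (`segNear_iff`). For the rays from `i`, turn a ray along the edge
directions; it is stopped at the first vertex `t` that is far from the ray parallel to `edge q t`,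
or whose edge has turned by at least a half turn from `edge q i`. If any vertex between `i` and `j`
is far from the ray from `i` to `j`, then this first stop is such a vertex (`CcwSeq.firstStop_far`),
so one vertex per end has to be tested. The first stop is monotone in `i` (`CcwSeq.firstStop_mono`),
hence two pointers find all of them in linear time. The other end of the chord is treated by a
reflection with reversed order. The chord that returns to its start after a full period, which
belongs to a one-point `Q`, needs its own argument (`CcwSeq.firstStop_far_period`). By monotonicity
two pointers also find all longest jumps.

Greedy jumps from a vertex of a feasible chain stay ahead of that chain
(`JumpSystem.period_le_iterate`), and every feasible chain visits one of the positions from `s` to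
`s + ℓ s`, as otherwise it would jump over all of them (`JumpSystem.exists_start`). Choose `s` with
the shortest jump `L = ℓ s`. There are `L + 1` starts, and each greedy chain closes after at most
`(n - 1) / L + 1` jumps, so trying all starts takes linear time.

Only the sorting costs more. The other points are seen from an extreme point `p 0` within an angle
below a half turn, so the sign of the cross product is a linear order on them. Blocks are merged in
pairs, and each index finds its rank in the other half by binary search; this takes `O(log n)` per
index and round, and `O(n log² n)` in all. -/

/-! ### Plane vectors -/

/-- Cross product of two vectors of the plane. -/
def cr (a b : ℝ × ℝ) : ℝ := a.1 * b.2 - a.2 * b.1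

/-- Dot product of two vectors of the plane. -/
def dt (a b : ℝ × ℝ) : ℝ := a.1 * b.1 + a.2 * b.2

/-- Rotation by a right angle, counterclockwise. -/
def rot (a : ℝ × ℝ) : ℝ × ℝ := (-a.2, a.1)

/-- The vector `d` has distance more than `ε` from the ray spanned by `u`. -/
def Far (ε : ℝ) (d u : ℝ × ℝ) : Prop :=
  (dt d u ≤ 0 ∧ ε ^ 2 < dt d d) ∨ (0 < dt d u ∧ ε ^ 2 * dt u u < cr d u ^ 2)

/-- Cramer's rule `cr a b • c = cr c b • a + cr a c • b`, multiplied by `z`. The next lemma is the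
same with the dot product. -/
lemma plucker (a b c z : ℝ × ℝ) : cr a b * cr c z = cr c b * cr a z + cr a c * cr b z := by
  simp only [cr]; ring

lemma plucker_dt (a b c z : ℝ × ℝ) : cr a b * dt c z = cr c b * dt a z + cr a c * dt b z := by
  simp only [cr, dt]; ring

lemma lagrange (a b : ℝ × ℝ) : dt a a * dt b b = cr a b ^ 2 + dt a b ^ 2 := by
  simp only [cr, dt]; ring

lemma cr_self (a : ℝ × ℝ) : cr a a = 0 := by simp only [cr]; ring
lemma cr_comm (a b : ℝ × ℝ) : cr a b = -cr b a := by simp only [cr]; ring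
lemma dt_comm (a b : ℝ × ℝ) : dt a b = dt b a := by simp only [dt]; ring
lemma dt_self_nonneg (a : ℝ × ℝ) : 0 ≤ dt a a := by simp only [dt]; nlinarith
lemma cr_add_left (a b c : ℝ × ℝ) : cr (a + b) c = cr a c + cr b c := by
  simp only [cr, Prod.fst_add, Prod.snd_add]; ring
lemma cr_sub_left (a b c : ℝ × ℝ) : cr (a - b) c = cr a c - cr b c := by
  simp only [cr, Prod.fst_sub, Prod.snd_sub]; ring
lemma cr_sub_right (a b c : ℝ × ℝ) : cr c (a - b) = cr c a - cr c b := by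
  simp only [cr, Prod.fst_sub, Prod.snd_sub]; ring
lemma dt_add_left (a b c : ℝ × ℝ) : dt (a + b) c = dt a c + dt b c := by
  simp only [dt, Prod.fst_add, Prod.snd_add]; ring
lemma dt_sub_left (a b c : ℝ × ℝ) : dt (a - b) c = dt a c - dt b c := by
  simp only [dt, Prod.fst_sub, Prod.snd_sub]; ring
lemma cr_rot_right (a b : ℝ × ℝ) : cr a (rot b) = dt a b := by simp only [cr, dt, rot]; ring
lemma cr_rot_left (a b : ℝ × ℝ) : cr (rot a) b = -dt a b := by simp only [cr, dt, rot]; ring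
lemma dt_rot_rot (a b : ℝ × ℝ) : dt (rot a) (rot b) = dt a b := by simp only [dt, rot]; ring

lemma dt_self_pos_of_cr {a b : ℝ × ℝ} (h : cr a b ≠ 0) : 0 < dt a a := by
  rcases (dt_self_nonneg a).lt_or_eq with h' | h'
  · exact h'
  · exfalso
    have := lagrange a b
    rw [← h'] at this
    have h2 : 0 < cr a b ^ 2 := by positivity
    nlinarith [sq_nonneg (dt a b)]

/-- A ray is at least as far away as the line that contains it. -/
lemma Far.of_height {ε : ℝ} {d u : ℝ × ℝ} (h : ε ^ 2 * dt u u < cr d u ^ 2) : Far ε d u := by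
  by_cases hd : dt d u ≤ 0
  · refine Or.inl ⟨hd, ?_⟩
    by_contra hc
    have h1 := lagrange d u
    nlinarith [sq_nonneg (dt d u), dt_self_nonneg u]
  · exact Or.inr ⟨not_le.1 hd, h⟩

/-- The apex of the ray is one of its points. -/
lemma Far.norm {ε : ℝ} {d u : ℝ × ℝ} (h : Far ε d u) : ε ^ 2 < dt d d := by
  rcases h with h | ⟨h0, h⟩
  · exact h.2
  · by_contra hc
    have h1 := lagrange d u
    have h2 : 0 < dt u u := by
      rcases (dt_self_nonneg u).lt_or_eq with h' | h'
      · exact h'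
      · rw [← h'] at h1
        nlinarith
    have h3 : dt d d * dt u u ≤ ε ^ 2 * dt u u := mul_le_mul_of_nonneg_right (not_lt.1 hc) h2.le
    nlinarith [sq_nonneg (dt d u), sq_nonneg (cr d u)]

/-- With direction zero the ray shrinks to its apex. This degenerate case serves the closed chord
from `i` to `i + n`. -/
lemma Far.zero_right {ε : ℝ} {d : ℝ × ℝ} : Far ε d 0 ↔ ε ^ 2 < dt d d := by
  simp [Far, dt]

/-- Turning a ray away from `d` does not bring it closer to `d`. -/
lemma Far.turn {ε : ℝ} {d u v : ℝ × ℝ} (hu : 0 < cr d u) (hv : 0 < cr d v) (huv : 0 ≤ cr u v)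
    (h : Far ε d u) : Far ε d v := by
  -- Divided by `cr d u * cr d v`, this says that the cotangent of the angle from `d` decreases from
  -- `u` to `v`.
  have key : dt d v * cr d u = dt d u * cr d v - dt d d * cr u v := by
    simp only [cr, dt]; ring
  have hd := dt_self_nonneg d
  have hn := h.norm
  by_cases hdv : dt d v ≤ 0
  · exact Or.inl ⟨hdv, hn⟩
  push Not at hdv
  have hle : dt d v * cr d u ≤ dt d u * cr d v := by nlinarith [mul_nonneg hd huv]
  have hdu : 0 < dt d u := by
    by_contra hc
    nlinarith [mul_pos hdv hu, not_lt.1 hc]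
  rcases h with h | ⟨-, h⟩
  · exact absurd h.1 (not_le.2 hdu)
  refine Or.inr ⟨hdv, ?_⟩
  have l1 := lagrange d u
  have l2 := lagrange d v
  have hdd : 0 < dt d d := dt_self_pos_of_cr hu.ne'
  -- The squared sine is `1 / (1 + cot²)`. The comparison of heights is carried out with
  -- denominators cleared by `lagrange`.
  have e1 : (ε ^ 2 * dt v v) * (dt d d * cr d u ^ 2) =
      ε ^ 2 * (cr d v ^ 2 * cr d u ^ 2 + (dt d v * cr d u) ^ 2) := by
    have : (ε ^ 2 * dt v v) * (dt d d * cr d u ^ 2) = ε ^ 2 * (dt d d * dt v v) * cr d u ^ 2 := by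
      ring
    rw [this, l2]; ring
  have e2 : (dt d v * cr d u) ^ 2 ≤ (dt d u * cr d v) ^ 2 :=
    pow_le_pow_left₀ (mul_nonneg hdv.le hu.le) hle 2
  have e3 : ε ^ 2 * (cr d v ^ 2 * cr d u ^ 2 + (dt d u * cr d v) ^ 2) =
      (ε ^ 2 * dt u u) * (dt d d * cr d v ^ 2) := by
    have : (ε ^ 2 * dt u u) * (dt d d * cr d v ^ 2) = ε ^ 2 * (dt d d * dt u u) * cr d v ^ 2 := by
      ring
    rw [this, l1]; ring
  have e4 : (ε ^ 2 * dt u u) * (dt d d * cr d v ^ 2) < cr d u ^ 2 * (dt d d * cr d v ^ 2) :=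
    mul_lt_mul_of_pos_right h (by positivity)
  have e5 : (ε ^ 2 * dt v v) * (dt d d * cr d u ^ 2) < cr d v ^ 2 * (dt d d * cr d u ^ 2) := by
    calc _ ≤ ε ^ 2 * (cr d v ^ 2 * cr d u ^ 2 + (dt d u * cr d v) ^ 2) := by
          rw [e1]; gcongr
      _ < _ := by rw [e3]; linarith
  exact lt_of_mul_lt_mul_right e5 (by positivity)

/-- The next vertex of a chain is far from a later direction if the current one is. -/
lemma Far.next {ε : ℝ} {d e v : ℝ × ℝ} (hdv : 0 < cr d v) (hev : 0 < cr e v)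
    (he : ¬ Far ε d e) (h : Far ε d v) : Far ε (d + e) v := by
  have h1 : 0 < cr (d + e) v := by rw [cr_add_left]; linarith
  rcases h with ⟨hb, hn⟩ | ⟨-, hh⟩
  · have hpos : 0 < dt d e := by
      by_contra hc
      exact he (Or.inl ⟨not_lt.1 hc, hn⟩)
    have hpos' : 0 < dt e d := by rwa [dt_comm]
    have hnn : 0 < dt d d := lt_of_le_of_lt (sq_nonneg ε) hn
    -- As `dt d e > 0`, the point `d + e` has height more than `|d| > ε` over the line along `rot
    -- d`, and `v` lies beyond `rot d`.
    refine Far.turn (u := rot d) ?_ h1 ?_ (Far.of_height ?_)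
    · rw [cr_rot_right, dt_add_left]; linarith
    · rw [cr_rot_left]; linarith
    · rw [cr_rot_right, dt_rot_rot, dt_add_left]
      nlinarith
  · apply Far.of_height
    refine hh.trans_le (pow_le_pow_left₀ hdv.le ?_ 2)
    rw [cr_add_left]; linarith

/-- The previous vertex of a chain is far from an earlier direction if the current one is. -/
lemma Far.prev {ε : ℝ} {d e v : ℝ × ℝ} (hdv : 0 < cr d v) (hve : 0 < cr v e)
    (hew : 0 < cr e (v - d)) (h : Far ε d v) : Far ε (d - e) v := by
  rcases h with ⟨hb, hn⟩ | ⟨-, hh⟩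
  · have hvw : 0 < cr v (v - d) := by rw [cr_sub_right, cr_self, cr_comm v d]; linarith
    have hvv : 0 < dt v v := dt_self_pos_of_cr hve.ne'
    have hvd : dt v d ≤ 0 := by rwa [dt_comm]
    -- The edge `e` is a positive combination of `v` and `v - d`. Hence it points forward along `v`
    -- and not along `d`, so stepping back by `e` stays behind the apex and moves away from it.
    have p1 := plucker_dt v (v - d) e v
    have p2 := plucker_dt v (v - d) e d
    rw [dt_sub_left v d v] at p1
    rw [dt_sub_left v d d] at p2
    have q1 : 0 < dt e v := by
      have : 0 < cr v (v - d) * dt e v := by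
        rw [p1]
        have := mul_pos hew hvv
        have := mul_pos hve (by linarith : 0 < dt v v - dt d v)
        linarith
      exact pos_of_mul_pos_right this hvw.le
    have q2 : dt e d ≤ 0 := by
      have hdd := dt_self_nonneg d
      have : cr v (v - d) * dt e d ≤ 0 := by
        rw [p2]
        nlinarith
      by_contra hc
      nlinarith [mul_pos hvw (not_le.1 hc)]
    refine Or.inl ⟨?_, ?_⟩
    · rw [dt_sub_left]; linarith
    · have := dt_self_nonneg e
      have h3 : dt (d - e) (d - e) = dt d d - 2 * dt e d + dt e e := by
        simp only [dt, Prod.fst_sub, Prod.snd_sub]; ring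
      linarith
  · apply Far.of_height
    refine hh.trans_le (pow_le_pow_left₀ hdv.le ?_ 2)
    rw [cr_sub_left, cr_comm e v]; linarith

lemma not_far_self {ε : ℝ} (v : ℝ × ℝ) (hv : 0 < dt v v) : ¬ Far ε v v := by
  rintro (h | h)
  · linarith [h.1]
  · rw [cr_self] at h
    nlinarith [h.2, sq_nonneg ε]


lemma cr_neg_left (a b : ℝ × ℝ) : cr (-a) b = -cr a b := by
  simp only [cr, Prod.fst_neg, Prod.snd_neg]; ring
lemma cr_neg_right (a b : ℝ × ℝ) : cr a (-b) = -cr a b := by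
  simp only [cr, Prod.fst_neg, Prod.snd_neg]; ring

lemma dt_self_sub (a b : ℝ × ℝ) : dt (a - b) (a - b) = dt a a - 2 * dt b a + dt b b := by
  simp only [dt, Prod.fst_sub, Prod.snd_sub]; ring

/-- The vector `c` is a nonnegative combination of `a` and `b`, so whatever is to the left of both
is to the left of `c`. Most facts about edge directions below follow by contradiction from this. -/
lemma cr_nonneg_of_cone {a b c z : ℝ × ℝ} (hab : 0 < cr a b) (hcb : 0 ≤ cr c b) (hac : 0 ≤ cr a c)
    (haz : 0 ≤ cr a z) (hbz : 0 ≤ cr b z) : 0 ≤ cr c z := by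
  have := plucker a b c z
  have h : 0 ≤ cr a b * cr c z := by rw [this]; positivity
  exact nonneg_of_mul_nonneg_right h hab

/-! ### Convex polygons as periodic sequences -/

/-- The vertices of a strictly convex polygon with `n` vertices in counterclockwise order. -/
structure CcwSeq (n : ℕ) (q : ℤ → ℝ × ℝ) : Prop where
  periodic : ∀ i, q (i + n) = q i
  ccw : ∀ i j k : ℤ, i < j → j < k → k < i + n → 0 < cr (q j - q i) (q k - q i)

/-- The edge vector leaving vertex `t`. -/
def edge (q : ℤ → ℝ × ℝ) (t : ℤ) : ℝ × ℝ := q (t + 1) - q t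

/-- Vertex `t` stops the ray that starts at vertex `i` and turns along the edge directions. -/
def Stop (ε : ℝ) (q : ℤ → ℝ × ℝ) (i t : ℤ) : Prop :=
  Far ε (q t - q i) (edge q t) ∨ cr (edge q i) (edge q t) ≤ 0

/-- `T` is the first vertex after `i` that stops the ray at `i`. -/
structure FirstStop (ε : ℝ) (q : ℤ → ℝ × ℝ) (i T : ℤ) : Prop where
  lt : i < T
  isStop : Stop ε q i T
  not_isStop : ∀ t, i < t → t < T → ¬ Stop ε q i t

/-! ### Edge directions and the first stop of a turning ray. -/

namespace CcwSeq

variable {n : ℕ} {q : ℤ → ℝ × ℝ} {ε : ℝ}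

lemma edge_periodic (hq : CcwSeq n q) (i : ℤ) : edge q (i + n) = edge q i := by
  unfold edge
  rw [show i + n + 1 = i + 1 + n by ring, hq.periodic, hq.periodic]

lemma cr_edge (hq : CcwSeq n q) {i k : ℤ} (h1 : i < k) (h2 : k + 1 < i + n) :
    0 < cr (q k - q i) (edge q k) := by
  have := hq.ccw i k (k + 1) h1 (by omega) h2
  have e : cr (q k - q i) (edge q k) = cr (q k - q i) (q (k + 1) - q i) := by
    simp only [cr, edge, Prod.fst_sub, Prod.snd_sub]; ring
  rwa [e]

lemma cr_edge_nonneg (hq : CcwSeq n q) {i k : ℤ} (h1 : i ≤ k) (h2 : k < i + n) :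
    0 ≤ cr (q k - q i) (edge q k) := by
  rcases h1.eq_or_lt with rfl | h1
  · simp [cr]
  by_cases h : k + 1 < i + n
  · exact (hq.cr_edge h1 h).le
  · have : q (k + 1) = q i := by rw [show k + 1 = i + n by omega, hq.periodic]
    simp only [cr, edge, this, Prod.fst_sub, Prod.snd_sub]
    apply le_of_eq; ring

lemma edge_cr (hq : CcwSeq n q) {i k : ℤ} (h1 : i + 1 < k) (h2 : k < i + n) :
    0 < cr (edge q i) (q k - q i) := hq.ccw i (i + 1) k (by omega) h1 h2

lemma edge_cr_nonneg (hq : CcwSeq n q) {i k : ℤ} (h1 : i < k) (h2 : k ≤ i + n) :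
    0 ≤ cr (edge q i) (q k - q i) := by
  rcases h2.eq_or_lt with rfl | h2
  · rw [hq.periodic]; simp [cr]
  by_cases h : i + 1 < k
  · exact (hq.edge_cr h h2).le
  · rw [show k = i + 1 by omega]
    exact (cr_self _).ge

lemma edge_edge (hq : CcwSeq n q) (hn : 3 ≤ n) (i : ℤ) : 0 < cr (edge q i) (edge q (i + 1)) := by
  have := hq.ccw i (i + 1) (i + 2) (by omega) (by omega) (by omega)
  have e : cr (edge q i) (edge q (i + 1)) = cr (q (i + 1) - q i) (q (i + 2) - q i) := by
    simp only [cr, edge, Prod.fst_sub, Prod.snd_sub, show i + 1 + 1 = i + 2 by ring]; ring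
  rwa [e]

/-- Otherwise `edge q t` lies in the cone of the two consecutive edges. The vector `q t - q (i + 1)`
is to the left of both, hence to the left of `edge q t`, against `cr_edge`. -/
lemma edge_turn_next (hq : CcwSeq n q) {i t : ℤ} (h1 : i + 1 < t) (h2 : t < i + n)
    (h : 0 < cr (edge q i) (edge q t)) : 0 < cr (edge q (i + 1)) (edge q t) := by
  -- The last edge of the period leads back to vertex `i` and has turned by more than a half turn.
  have h3 : t + 1 < i + n := by
    by_contra hc
    have e : q (t + 1) = q i := by rw [show t + 1 = i + n by omega, hq.periodic]
    have := hq.edge_cr h1 h2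
    have e2 : cr (edge q i) (edge q t) = - cr (edge q i) (q t - q i) := by
      simp only [cr, edge, e, Prod.fst_sub, Prod.snd_sub]; ring
    linarith
  by_contra hc
  have k1 : 0 ≤ cr (edge q i) (q t - q (i + 1)) := by
    have := hq.edge_cr h1 h2
    have e : cr (edge q i) (q t - q (i + 1)) = cr (edge q i) (q t - q i) := by
      simp only [cr, edge, Prod.fst_sub, Prod.snd_sub]; ring
    linarith
  have k2 := hq.edge_cr_nonneg (i := i + 1) (k := t) (by omega) (by omega)
  have k3 := hq.cr_edge (i := i + 1) (k := t) (by omega) (by omega)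
  have := cr_nonneg_of_cone (c := edge q t) (hq.edge_edge (by omega) i)
    (by rw [cr_comm]; linarith) h.le k1 k2
  rw [cr_comm] at this
  linarith

/-- Once the boundary descends towards the chord it keeps descending. Otherwise the reversed chord
lies in the cone of two consecutive edges, and vertex `k + 1` is on the wrong side of the chord. -/
lemma edge_cr_chord_succ (hq : CcwSeq n q) {i j k : ℤ} (hi : i < k) (hk : k + 1 < j)
    (hj : j < i + n) (h : cr (edge q k) (q j - q i) < 0) :
    cr (edge q (k + 1)) (q j - q i) < 0 := by
  by_contra hc
  have k1 := hq.cr_edge hi (by omega)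
  have k2 := hq.cr_edge (i := i) (k := k + 1) (by omega) (by omega)
  have k3 := hq.ccw i (k + 1) j (by omega) hk hj
  have e : cr (edge q k) (-(q (k + 1) - q i)) = cr (q k - q i) (edge q k) := by
    simp only [cr, edge, Prod.fst_sub, Prod.snd_sub, Prod.fst_neg, Prod.snd_neg]; ring
  have := cr_nonneg_of_cone (c := -(q j - q i)) (z := -(q (k + 1) - q i))
    (hq.edge_edge (by omega) k)
    (by rw [cr_neg_left, ← cr_comm]; linarith) (by rw [cr_neg_right]; linarith)
    (by rw [e]; exact k1.le) (by rw [cr_neg_right, ← cr_comm]; exact k2.le)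
  rw [cr_neg_right, cr_neg_left, cr_comm] at this
  linarith

lemma edge_cr_chord_mono (hq : CcwSeq n q) {i j k l : ℤ} (hi : i < k) (hkl : k ≤ l) (hl : l < j)
    (hj : j < i + n) (h : cr (edge q k) (q j - q i) < 0) :
    cr (edge q l) (q j - q i) < 0 := by
  induction l, hkl using Int.leInduction with
  | base => exact h
  | succ m hm ih => exact hq.edge_cr_chord_succ (by omega) hl hj (ih (by omega))

/-- After a half turn from `edge q i` the edge direction has passed that of the chord. The signs in
one Plücker relation exclude anything else. -/
lemma edge_cr_chord_of_turn (hq : CcwSeq n q) {i j T : ℤ} (hi : i < T) (hT : T < j)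
    (hj : j < i + n) (h : cr (edge q i) (edge q T) ≤ 0) : cr (edge q T) (q j - q i) < 0 := by
  by_contra hc
  have k1 := hq.cr_edge hi (by omega)
  have k2 := hq.edge_cr_nonneg hi (by omega)
  have k3 := hq.ccw i T j hi hT hj
  have k4 := hq.edge_cr (i := i) (k := j) (by omega) hj
  have p := plucker (edge q i) (q j - q i) (edge q T) (q T - q i)
  rw [cr_comm (edge q T) (q T - q i), cr_comm (q j - q i) (q T - q i)] at p
  nlinarith [mul_pos k4 k1, mul_nonneg (not_lt.1 hc) k2]

/-- Within a period the half turn is not undone. Otherwise `edge q i` lies in the cone of the edges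
at `k` and `k + 1`, and vertex `k + 1` is on the wrong side of `edge q i`. -/
lemma edge_turn_succ (hq : CcwSeq n q) {i k : ℤ} (hi : i < k) (hk : k + 1 < i + n)
    (h : cr (edge q i) (edge q k) ≤ 0) : cr (edge q i) (edge q (k + 1)) ≤ 0 := by
  by_contra hc
  have k1 := hq.cr_edge hi (by omega)
  have k2 := hq.cr_edge_nonneg (i := i) (k := k + 1) (by omega) (by omega)
  have k3 := hq.edge_cr (i := i) (k := k + 1) (by omega) (by omega)
  have e : cr (edge q k) (-(q (k + 1) - q i)) = cr (q k - q i) (edge q k) := by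
    simp only [cr, edge, Prod.fst_sub, Prod.snd_sub, Prod.fst_neg, Prod.snd_neg]; ring
  have := cr_nonneg_of_cone (c := edge q i) (z := -(q (k + 1) - q i))
    (hq.edge_edge (by omega) k)
    (by linarith) (by rw [cr_comm]; linarith)
    (by rw [e]; exact k1.le) (by rw [cr_neg_right, ← cr_comm]; exact k2)
  rw [cr_neg_right] at this
  linarith

lemma edge_turn_mono (hq : CcwSeq n q) {i k l : ℤ} (hi : i < k) (hkl : k ≤ l) (hl : l < i + n)
    (h : cr (edge q i) (edge q k) ≤ 0) : cr (edge q i) (edge q l) ≤ 0 := by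
  induction l, hkl using Int.leInduction with
  | base => exact h
  | succ m hm ih => exact hq.edge_turn_succ (by omega) hl (ih (by omega))

/-- Every ray is stopped within one period, because the turning condition of `Stop` includes
equality. -/
lemma stop_period (hq : CcwSeq n q) (i : ℤ) : Stop ε q i (i + n) :=
  Or.inr (by rw [hq.edge_periodic, cr_self])

lemma firstStop_le (hq : CcwSeq n q) (hn : 0 < n) {i T : ℤ} (hT : FirstStop ε q i T) :
    T ≤ i + n := by
  by_contra hc
  exact hT.not_isStop (i + n) (by omega) (by omega) (hq.stop_period i)

/-- Vertices passed by the ray at `i` are passed by the ray at `i + 1`. -/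
lemma not_stop_succ (hq : CcwSeq n q) {i t : ℤ} (h1 : i + 1 < t) (h2 : t < i + n)
    (hi : ∀ s, i < s → s ≤ t → ¬ Stop ε q i s)
    (hi' : ∀ s, i + 1 < s → s < t → ¬ Stop ε q (i + 1) s) : ¬ Stop ε q (i + 1) t := by
  have hit := hi t (by omega) le_rfl
  simp only [Stop, not_or, not_le] at hit
  obtain ⟨hf, hc⟩ := hit
  have ht1 : t + 1 < i + n := by
    by_contra hcon
    have e : q (t + 1) = q i := by rw [show t + 1 = i + n by omega, hq.periodic]
    have := hq.edge_cr h1 h2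
    have e2 : cr (edge q i) (edge q t) = - cr (edge q i) (q t - q i) := by
      simp only [cr, edge, e, Prod.fst_sub, Prod.snd_sub]; ring
    linarith
  have hc' := hq.edge_turn_next h1 h2 hc
  rintro (h | h)
  swap
  · linarith
  have hd : q t - q i = (q t - q (i + 1)) + edge q i := by simp [edge]
  have k1 : 0 < cr (q t - q (i + 1)) (edge q t) := hq.cr_edge (by omega) (by omega)
  have k1' : 0 < cr (q t - q i) (edge q t) := hq.cr_edge (by omega) (by omega)
  rcases h with ⟨hb, hn⟩ | ⟨-, hh⟩
  -- Otherwise vertex `t - 1` is also behind its edge direction and even farther from `i + 1`, so it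
  -- would have stopped the ray earlier.
  · have hprev : 0 ≤ dt (edge q (t - 1)) (q t - q (i + 1)) := by
      have he : edge q (t - 1) = q t - q (t - 1) := by simp [edge]
      by_cases h' : t = i + 2
      · subst h'
        rw [he, show i + 2 - 1 = i + 1 by ring]
        exact dt_self_nonneg _
      · have hs := hi' (t - 1) (by omega) (by omega)
        simp only [Stop, not_or] at hs
        by_contra hneg
        push Not at hneg
        refine hs.1 (Or.inl ⟨?_, ?_⟩)
        · have : q (t - 1) - q (i + 1) = (q t - q (i + 1)) - edge q (t - 1) := by rw [he]; abel
          rw [this, dt_sub_left, dt_comm]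
          have := dt_self_nonneg (edge q (t - 1))
          linarith
        · have : q (t - 1) - q (i + 1) = (q t - q (i + 1)) - edge q (t - 1) := by rw [he]; abel
          rw [this, dt_self_sub]
          have := dt_self_nonneg (edge q (t - 1))
          linarith
    have hgt := hi (t - 1) (by omega) (by omega)
    simp only [Stop, not_or, not_le] at hgt
    have hee := hq.edge_edge (by omega) (t - 1)
    rw [sub_add_cancel] at hee
    -- The direction `rot (q t - q (i + 1))` lies between the edges at `t - 1` and `t`, both to the
    -- left of `edge q i`. Hence moving the apex back from `i + 1` to `i` does not lower the height
    -- over the line with this direction.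
    have hgu : 0 ≤ cr (edge q i) (rot (q t - q (i + 1))) := by
      rw [cr_comm, ← cr_neg_right]
      refine cr_nonneg_of_cone hee ?_ ?_ ?_ ?_
      · rw [cr_rot_left]; linarith
      · rw [cr_rot_right]; exact hprev
      · rw [cr_neg_right, ← cr_comm]; exact hgt.2.le
      · rw [cr_neg_right, ← cr_comm]; exact hc.le
    have hpos : 0 < dt (q t - q (i + 1)) (q t - q (i + 1)) := lt_of_le_of_lt (sq_nonneg ε) hn
    apply hf
    have k2 : dt (q t - q (i + 1)) (q t - q (i + 1)) ≤ cr (q t - q i) (rot (q t - q (i + 1))) := by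
      rw [hd, cr_add_left, cr_rot_right]; linarith
    refine Far.turn (u := rot (q t - q (i + 1))) (by linarith) k1' ?_ (Far.of_height ?_)
    · rw [cr_rot_left]; linarith
    · rw [dt_rot_rot]
      nlinarith
  · apply hf
    apply Far.of_height
    refine hh.trans_le (pow_le_pow_left₀ k1.le ?_ 2)
    rw [hd, cr_add_left]; linarith

/-- The first stop is monotone. -/
lemma firstStop_mono (hq : CcwSeq n q) {i t : ℤ} (h2 : t ≤ i + n)
    (hi : ∀ s, i < s → s < t → ¬ Stop ε q i s) :
    ∀ s, i + 1 < s → s < t → ¬ Stop ε q (i + 1) s := by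
  -- Strong induction, since `not_stop_succ` needs that the ray at `i + 1` has passed all earlier
  -- vertices.
  have : ∀ k : ℕ, ∀ s, s = i + 1 + k → i + 1 < s → s < t → ¬ Stop ε q (i + 1) s := by
    intro k
    induction k using Nat.strong_induction_on with
    | _ k ih =>
      intro s hs h1 hst
      refine hq.not_stop_succ h1 (by omega) (fun r hr hr' => hi r hr (by omega)) ?_
      intro r hr hr'
      exact ih (r - (i + 1)).toNat (by omega) r (by omega) hr (by omega)
  intro s hs
  exact this (s - (i + 1)).toNat s (by omega) hs

/-- If some vertex between `i` and `j` is far from the ray from `i` to `j`, then the first stop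
is one. -/
lemma firstStop_far (hq : CcwSeq n q) {i j m T : ℤ} (hj : j < i + n) (hT : FirstStop ε q i T)
    (h1 : i < m) (h2 : m < j) (h : Far ε (q m - q i) (q j - q i)) :
    T < j ∧ Far ε (q T - q i) (q j - q i) := by
  have hvv : 0 < dt (q j - q i) (q j - q i) := by
    have := hq.ccw i m j h1 h2 hj
    rw [cr_comm] at this
    exact dt_self_pos_of_cr (b := q m - q i) (by linarith)
  -- A far vertex before the first stop hands its farness on to the next vertex, up to `T`.
  have up : ∀ k : ℕ, ∀ m, T = m + k → i < m → m < j → Far ε (q m - q i) (q j - q i) →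
      T < j ∧ Far ε (q T - q i) (q j - q i) := by
    intro k
    induction k with
    | zero =>
      intro m hm _ h2 h
      rw [show T = m by simpa using hm]
      exact ⟨h2, h⟩
    | succ k ih =>
      intro m hm h1 h2 h
      have hs := hT.not_isStop m h1 (by omega)
      simp only [Stop, not_or] at hs
      have k1 := hq.cr_edge h1 (by omega)
      have k2 := hq.ccw i m j h1 h2 hj
      -- If the edge had turned past the chord, turning the ray from the chord to the edge would
      -- make `m` a stop.
      have k3 : 0 < cr (edge q m) (q j - q i) := by
        by_contra hc
        exact hs.1 (Far.turn k2 k1 (by rw [cr_comm]; linarith) h)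
      have hn : Far ε (q (m + 1) - q i) (q j - q i) := by
        have := Far.next k2 k3 hs.1 h
        rwa [show q m - q i + edge q m = q (m + 1) - q i by simp [edge]] at this
      have hlt : m + 1 < j := by
        by_contra hc
        rw [show m + 1 = j by omega] at hn
        exact not_far_self _ hvv hn
      exact ih (m + 1) (by push_cast at hm; omega) (by omega) hlt hn
  by_cases hmT : m ≤ T
  · exact up (T - m).toNat m (by omega) h1 h2 h
  push Not at hmT
  refine ⟨by omega, ?_⟩
  by_contra hcon
  -- A first stop that is not far from the chord has an edge turned beyond it. From there on the
  -- boundary descends, and farness is handed back from `m` to `T`.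
  have hTv : cr (edge q T) (q j - q i) < 0 := by
    rcases hT.isStop with hs | hs
    · by_contra hc
      exact hcon (Far.turn (hq.cr_edge hT.lt (by omega)) (hq.ccw i T j hT.lt (by omega) hj)
        (not_lt.1 hc) hs)
    · exact hq.edge_cr_chord_of_turn hT.lt (by omega) hj hs
  have down : ∀ k : ℕ, ∀ m, m = T + k → m < j → Far ε (q m - q i) (q j - q i) →
      Far ε (q T - q i) (q j - q i) := by
    intro k
    induction k with
    | zero =>
      intro m hm _ h
      rwa [show m = T by simpa using hm] at h
    | succ k ih =>
      intro m hm h2 h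
      have hTm := hT.lt
      push_cast at hm
      refine ih (m - 1) (by omega) (by omega) ?_
      have k1 := hq.ccw i m j (by omega) h2 hj
      have k2 := hq.edge_cr_chord_mono (l := m - 1) hT.lt (by omega) (by omega) hj hTv
      have k3 := hq.ccw (m - 1) m j (by omega) h2 (by omega)
      have he : edge q (m - 1) = q m - q (m - 1) := by simp [edge]
      have := Far.prev (e := edge q (m - 1)) k1 (by rw [cr_comm]; linarith) (by
        have e : cr (edge q (m - 1)) (q j - q i - (q m - q i)) =
          cr (q m - q (m - 1)) (q j - q (m - 1)) := by
          rw [he]; simp only [cr, Prod.fst_sub, Prod.snd_sub]; ring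
        rwa [e]) h
      rwa [show q m - q i - edge q (m - 1) = q (m - 1) - q i by rw [he]; abel] at this
  exact hcon (down (m - T).toNat m (by omega) h2 h)

end CcwSeq


/-! ### Reflection, distance to segments, and good chords. -/

/-- Reflection in the second coordinate axis. -/
def mirror (a : ℝ × ℝ) : ℝ × ℝ := (-a.1, a.2)

lemma mirror_sub (a b : ℝ × ℝ) : mirror (a - b) = mirror a - mirror b := by
  ext <;> simp [mirror]; ring

lemma cr_mirror (a b : ℝ × ℝ) : cr (mirror a) (mirror b) = -cr a b := by
  simp only [cr, mirror]; ring

lemma dt_mirror (a b : ℝ × ℝ) : dt (mirror a) (mirror b) = dt a b := by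
  simp only [dt, mirror]; ring

lemma far_mirror {ε : ℝ} {d u : ℝ × ℝ} : Far ε (mirror d) (mirror u) ↔ Far ε d u := by
  simp only [Far, dt_mirror, cr_mirror, neg_sq]

/-- The reflected sequence, in reverse order. -/
def mir (q : ℤ → ℝ × ℝ) (k : ℤ) : ℝ × ℝ := mirror (q (-k))

lemma mir_sub (q : ℤ → ℝ × ℝ) (i j : ℤ) : mir q i - mir q j = mirror (q (-i) - q (-j)) := by
  simp only [mir, mirror_sub]

/-- The point `p` has distance at most `ε` from the segment from `a` to `b`. -/
def SegNear (ε : ℝ) (a b p : ℝ × ℝ) : Prop :=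
  ∃ l : ℝ, 0 ≤ l ∧ l ≤ 1 ∧ dt (p - (a + l • (b - a))) (p - (a + l • (b - a))) ≤ ε ^ 2

lemma Far.lt_ray {ε : ℝ} {d u : ℝ × ℝ} (h : Far ε d u) {s : ℝ} (hs : 0 ≤ s) :
    ε ^ 2 < dt (d - s • u) (d - s • u) := by
  rcases h with ⟨h0, h⟩ | ⟨-, h⟩
  · have e : dt (d - s • u) (d - s • u) = dt d d - 2 * s * dt d u + s ^ 2 * dt u u := by
      simp only [dt, Prod.fst_sub, Prod.snd_sub, Prod.smul_fst, Prod.smul_snd, smul_eq_mul]; ring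
    have := dt_self_nonneg u
    rw [e]
    nlinarith [mul_nonneg hs (neg_nonneg.2 h0), mul_nonneg (sq_nonneg s) this]
  · have l := lagrange (d - s • u) u
    have e : cr (d - s • u) u = cr d u := by
      simp only [cr, Prod.fst_sub, Prod.snd_sub, Prod.smul_fst, Prod.smul_snd, smul_eq_mul]; ring
    rw [e] at l
    refine lt_of_mul_lt_mul_right (a := dt u u) ?_ (dt_self_nonneg u)
    nlinarith [sq_nonneg (dt (d - s • u) u)]

/-- The distance to a segment is the larger of the distances to the two rays that start at its ends
and contain it. -/
lemma segNear_iff {ε : ℝ} {a b p : ℝ × ℝ} :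
    SegNear ε a b p ↔ ¬ Far ε (p - a) (b - a) ∧ ¬ Far ε (p - b) (a - b) := by
  constructor
  · rintro ⟨l, h0, h1, h⟩
    constructor
    · intro hf
      have := hf.lt_ray h0
      rw [sub_sub] at this
      linarith
    · intro hf
      have := hf.lt_ray (s := 1 - l) (by linarith)
      have e : p - b - (1 - l) • (a - b) = p - (a + l • (b - a)) := by
        ext <;> simp <;> ring
      rw [e] at this
      linarith
  · rintro ⟨h1, h2⟩
    simp only [Far, not_or, not_and, not_lt] at h1 h2
    rcases le_or_gt (dt (p - a) (b - a)) 0 with hA | hA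
    · exact ⟨0, le_rfl, zero_le_one, by simpa using h1.1 hA⟩
    rcases le_or_gt (dt (p - b) (a - b)) 0 with hB | hB
    · exact ⟨1, zero_le_one, le_rfl, by simpa using h2.1 hB⟩
    have hu : dt (p - b) (a - b) = dt (b - a) (b - a) - dt (p - a) (b - a) := by
      simp only [dt, Prod.fst_sub, Prod.snd_sub]; ring
    have hpos : 0 < dt (b - a) (b - a) := by linarith
    refine ⟨dt (p - a) (b - a) / dt (b - a) (b - a), by positivity,
      (div_le_one hpos).2 (by linarith), ?_⟩
    set l := dt (p - a) (b - a) / dt (b - a) (b - a) with hl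
    have hl' : l * dt (b - a) (b - a) = dt (p - a) (b - a) := by
      rw [hl]; field_simp
    have lg := lagrange (p - a - l • (b - a)) (b - a)
    have e : cr (p - a - l • (b - a)) (b - a) = cr (p - a) (b - a) := by
      simp only [cr, Prod.fst_sub, Prod.snd_sub, Prod.smul_fst, Prod.smul_snd, smul_eq_mul]; ring
    have e2 : dt (p - a - l • (b - a)) (b - a) = dt (p - a) (b - a) - l * dt (b - a) (b - a) := by
      simp only [dt, Prod.fst_sub, Prod.snd_sub, Prod.smul_fst, Prod.smul_snd, smul_eq_mul]; ring
    rw [e, e2, hl', sub_self] at lg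
    have := h1.2 hA
    rw [← sub_sub]
    refine le_of_mul_le_mul_right (a := dt (b - a) (b - a)) ?_ hpos
    nlinarith

/-- If `z` lies beyond the segment from `a` to `b`, as seen from `p`, then the segment is at least
as near to `p`. -/
lemma segment_near_of_beyond {a b p z : ℝ × ℝ} (h1 : 0 ≤ cr (b - p) (z - p))
    (h2 : 0 ≤ cr (z - p) (a - p)) (h3 : 0 ≤ cr (b - a) (z - a)) (h4 : 0 < cr (p - a) (b - a)) :
    ∃ l : ℝ, 0 ≤ l ∧ l ≤ 1 ∧
      dt (p - (a + l • (b - a))) (p - (a + l • (b - a))) ≤ dt (p - z) (p - z) := by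
  set A := cr (p - a) (b - a) with hA
  set B := cr (b - a) (z - a) with hB
  have hsum : cr (z - p) (a - p) + cr (b - p) (z - p) = B + A := by
    simp only [hA, hB, cr, Prod.fst_sub, Prod.snd_sub]; ring
  have hpos : 0 < B + A := by linarith
  -- The parameter of the crossing of `p z` with the chord. The identity `e` below says that the
  -- crossing divides `p z` in the ratio of `A` to `B`.
  refine ⟨cr (z - p) (a - p) / (B + A), by positivity, (div_le_one hpos).2 (by linarith), ?_⟩
  set l := cr (z - p) (a - p) / (B + A) with hl
  have hl' : l * (B + A) = cr (z - p) (a - p) := by rw [hl]; field_simp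
  have e : (B + A) • (p - (a + l • (b - a))) = A • (p - z) := by
    have x1 : (B + A) • (p - (a + l • (b - a))) =
        (B + A) • (p - a) - (l * (B + A)) • (b - a) := by
      ext <;> simp <;> ring
    rw [x1, hl', hA, hB]
    ext <;> simp [cr] <;> ring
  have e2 : (B + A) ^ 2 * dt (p - (a + l • (b - a))) (p - (a + l • (b - a))) =
      A ^ 2 * dt (p - z) (p - z) := by
    have h : ∀ (s : ℝ) (v : ℝ × ℝ), s ^ 2 * dt v v = dt (s • v) (s • v) := by
      intro s v
      simp only [dt, Prod.smul_fst, Prod.smul_snd, smul_eq_mul]; ring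
    rw [h, h, e]
  refine le_of_mul_le_mul_left (a := (B + A) ^ 2) ?_ (by positivity)
  rw [e2]
  exact mul_le_mul_of_nonneg_right (pow_le_pow_left₀ h4.le (by linarith) 2) (dt_self_nonneg _)

/-- All vertices strictly between `i` and `j` are within `ε` of the chord from `i` to `j`. -/
def Good (ε : ℝ) (q : ℤ → ℝ × ℝ) (i j : ℤ) : Prop :=
  ∀ m, i < m → m < j → SegNear ε (q i) (q j) (q m)

lemma convex_cr_le (c p : ℝ × ℝ) : Convex ℝ {z : ℝ × ℝ | 0 ≤ cr c (z - p)} := by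
  intro x hx y hy s t hs ht hst
  simp only [Set.mem_ofPred_eq] at hx hy ⊢
  have e : cr c (s • x + t • y - p) = s * cr c (x - p) + t * cr c (y - p) := by
    rw [show p = (s + t) • p by rw [hst, one_smul]]
    simp only [cr, Prod.fst_sub, Prod.snd_sub, Prod.fst_add, Prod.snd_add, Prod.smul_fst,
      Prod.smul_snd, smul_eq_mul]
    have : s = 1 - t := by linarith
    subst this; ring
  rw [e]; positivity

namespace CcwSeq

variable {n : ℕ} {q : ℤ → ℝ × ℝ} {ε : ℝ}

/-- Reversing the order undoes the change of orientation by the reflection. -/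
lemma mir (hq : CcwSeq n q) : CcwSeq n (mir q) where
  periodic i := by
    simp only [_root_.mir]
    rw [← hq.periodic (-(i + n)), show -(i + (n : ℤ)) + n = -i by ring]
  ccw i j k hij hjk hk := by
    have := hq.ccw (-k) (-j) (-i) (by omega) (by omega) (by omega)
    rw [mir_sub, mir_sub, cr_mirror]
    simp only [cr, Prod.fst_sub, Prod.snd_sub] at this ⊢
    linarith

/-- The next vertex is no farther from `q i`, so the edge leaving a farthest vertex makes an obtuse
angle with its position vector. -/
lemma stop_of_farthest (hq : CcwSeq n q) {i m : ℤ} (h1 : i < m) (h2 : m < i + n)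
    (hmax : ∀ k, i < k → k < i + n → dt (q k - q i) (q k - q i) ≤ dt (q m - q i) (q m - q i))
    (h : ε ^ 2 < dt (q m - q i) (q m - q i)) : Stop ε q i m := by
  refine Or.inl (Or.inl ⟨?_, h⟩)
  have h3 : dt (q (m + 1) - q i) (q (m + 1) - q i) ≤ dt (q m - q i) (q m - q i) := by
    by_cases hm : m + 1 = i + n
    · rw [hm, hq.periodic, sub_self]
      simpa [dt] using dt_self_nonneg (q m - q i)
    · exact hmax _ (by omega) (by omega)
  have e : dt (q (m + 1) - q i) (q (m + 1) - q i) =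
      dt (q m - q i) (q m - q i) + 2 * dt (q m - q i) (edge q m) + dt (edge q m) (edge q m) := by
    simp only [dt, edge, Prod.fst_sub, Prod.snd_sub]; ring
  have := dt_self_nonneg (edge q m)
  linarith

/-- The farthest vertex from `q i` stops the rays in both senses of rotation. A first stop that
comes no later and is caused by farness is itself at distance above `ε`, so only two stops by
turning have to be excluded. -/
lemma firstStop_far_period (hq : CcwSeq n q) {i m S T : ℤ} (hS : FirstStop ε q i S)
    (hT : FirstStop ε (_root_.mir q) (-(i + n)) T)
    (h1 : i < m) (h2 : m < i + n) (h : ε ^ 2 < dt (q m - q i) (q m - q i)) :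
    (S < i + n ∧ ε ^ 2 < dt (q S - q i) (q S - q i)) ∨
    (T < -i ∧ ε ^ 2 < dt (_root_.mir q T - _root_.mir q (-(i + n)))
      (_root_.mir q T - _root_.mir q (-(i + n)))) := by
  obtain ⟨k, hk, hmax⟩ := Finset.exists_max_image (Finset.Ioo i (i + n))
    (fun k => dt (q k - q i) (q k - q i)) ⟨m, by simp [h1, h2]⟩
  simp only [Finset.mem_Ioo] at hk hmax
  have hk' := h.trans_le (hmax m ⟨h1, h2⟩)
  have hmir : ∀ k, dt (_root_.mir q k - _root_.mir q (-(i + n)))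
      (_root_.mir q k - _root_.mir q (-(i + n))) = dt (q (-k) - q i) (q (-k) - q i) := by
    intro k
    rw [mir_sub, dt_mirror, neg_neg, hq.periodic]
  have sA := hq.stop_of_farthest (ε := ε) hk.1 hk.2 (fun l h h' => hmax l ⟨h, h'⟩) hk'
  have sB := hq.mir.stop_of_farthest (ε := ε) (i := -(i + n)) (m := -k) (by omega) (by omega)
    (fun l h h' => by
      rw [hmir, hmir, neg_neg]
      exact hmax _ ⟨by omega, by omega⟩) (by rw [hmir, neg_neg]; exact hk')
  have hSk : S ≤ k := by
    by_contra hc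
    exact hS.not_isStop k hk.1 (by omega) sA
  have hTk : T ≤ -k := by
    by_contra hc
    exact hT.not_isStop (-k) (by omega) (by omega) sB
  have hSi := hS.lt
  have hTi := hT.lt
  rcases hS.isStop with hf | hcS
  · exact Or.inl ⟨by omega, hf.norm⟩
  rcases hT.isStop with hf | hcT
  · exact Or.inr ⟨by omega, hf.norm⟩
  rcases hSk.eq_or_lt with rfl | hSk
  · exact Or.inl ⟨by omega, hk'⟩
  rcases hTk.eq_or_lt with rfl | hTk
  · exact Or.inr ⟨by omega, by rw [hmir, neg_neg]; exact hk'⟩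
  -- Both rays have made a half turn before the farthest vertex. Then the edge at `-T - 1` lies in
  -- the cone of the edges before and after vertex `i`, which puts vertex `i` on the wrong side of
  -- it.
  exfalso
  have em : ∀ l, edge (_root_.mir q) l = -mirror (edge q (-l - 1)) := by
    intro l
    simp only [edge, _root_.mir, mirror_sub, neg_sub, sub_add_cancel,
      show -(l + 1) = -l - 1 by ring]
  rw [em, em, cr_neg_left, cr_neg_right, cr_mirror, neg_neg] at hcT
  rw [show - -(i + (n : ℤ)) - 1 = i - 1 + n by ring, hq.edge_periodic] at hcT
  have c1 := hq.edge_turn_mono (l := -T - 1) hSi (by omega) (by omega) hcS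
  have c2 := hq.edge_edge (by omega) (i - 1)
  have c3 := hq.ccw (i - 1) i (-T - 1) (by omega) (by omega) (by omega)
  rw [sub_add_cancel] at c2
  have c4 := hq.edge_cr_nonneg (i := i) (k := -T - 1) (by omega) (by omega)
  have c5 := hq.cr_edge (i := i) (k := -T - 1) (by omega) (by omega)
  have e : cr (edge q (i - 1)) (q (-T - 1) - q i) =
      cr (q i - q (i - 1)) (q (-T - 1) - q (i - 1)) := by
    simp only [cr, edge, sub_add_cancel, Prod.fst_sub, Prod.snd_sub]; ring
  have := cr_nonneg_of_cone (c := edge q (-T - 1)) (z := q (-T - 1) - q i) c2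
    (by rw [cr_comm]; linarith) (by linarith) (by rw [e]; exact c3.le) c4
  rw [cr_comm] at this
  linarith

/-- A chord is good iff the first stops at its ends are not far from it. -/
theorem good_iff (hq : CcwSeq n q) {i j S T : ℤ} (hij : i < j) (hj : j ≤ i + n)
    (hS : FirstStop ε q i S) (hT : FirstStop ε (_root_.mir q) (-j) T) :
    Good ε q i j ↔ ¬ (S < j ∧ Far ε (q S - q i) (q j - q i)) ∧
      ¬ (T < -i ∧ Far ε (_root_.mir q T - _root_.mir q (-j))
        (_root_.mir q (-i) - _root_.mir q (-j))) := by
  have hSi := hS.lt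
  have hTi := hT.lt
  constructor
  · intro h
    constructor
    · rintro ⟨h1, h2⟩
      exact (segNear_iff.1 (h S hSi h1)).1 h2
    · rintro ⟨h1, h2⟩
      rw [mir_sub, mir_sub, far_mirror, neg_neg, neg_neg] at h2
      exact (segNear_iff.1 (h (-T) (by omega) (by omega))).2 h2
  · rintro ⟨hA, hB⟩ m h1 h2
    -- For `j = i + n` the chord is a point and both rays have direction zero.
    rcases hj.eq_or_lt with rfl | hj
    · by_contra hm
      rw [segNear_iff, hq.periodic, sub_self] at hm
      simp only [Far.zero_right, and_self, not_not] at hm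
      rw [hq.periodic, sub_self] at hA
      rw [mir_sub _ (-i), neg_neg, neg_neg, hq.periodic, sub_self,
        show mirror 0 = 0 by simp [mirror]] at hB
      simp only [Far.zero_right] at hA hB
      exact (hq.firstStop_far_period hS hT h1 h2 hm).elim hA hB
    · rw [segNear_iff]
      refine ⟨fun hf => hA (hq.firstStop_far hj hS h1 h2 hf), fun hf => hB ?_⟩
      refine hq.mir.firstStop_far (i := -j) (j := -i) (m := -m) (by omega) hT (by omega) (by omega)
        ?_
      rwa [mir_sub, mir_sub, far_mirror, neg_neg, neg_neg, neg_neg]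

/-- A point of the hull of the vertices from `j` on, up to `i`, is at least as far from a vertex
between `i` and `j` as the chord from `i` to `j`. -/
lemma segNear_of_hull (hq : CcwSeq n q) {i j m : ℤ} (h1 : i < m) (h2 : m < j) (hj : j ≤ i + n)
    {z : ℝ × ℝ} (hz : z ∈ convexHull ℝ (q '' Set.Icc j (i + n)))
    (h : dt (q m - z) (q m - z) ≤ ε ^ 2) : SegNear ε (q i) (q j) (q m) := by
  rcases hj.eq_or_lt with rfl | hj
  · simp only [Set.Icc_self, Set.image_singleton, convexHull_singleton,
      Set.mem_singleton_iff, hq.periodic] at hz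
    subst hz
    exact ⟨0, le_rfl, zero_le_one, by simpa using h⟩
  -- A half-plane that contains the vertices from `j` to `i + n` contains `z`.
  have key : ∀ c p : ℝ × ℝ, (∀ k, j ≤ k → k ≤ i + n → 0 ≤ cr c (q k - p)) → 0 ≤ cr c (z - p) := by
    intro c p hk
    refine convexHull_min ?_ (convex_cr_le c p) hz
    rintro _ ⟨k, hk', rfl⟩
    exact hk k hk'.1 hk'.2
  obtain ⟨l, hl0, hl1, hl⟩ := segment_near_of_beyond (a := q i) (b := q j) (p := q m) (z := z)
    (key _ _ fun k hk hk' => by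
      rcases hk.eq_or_lt with rfl | hk
      · exact (cr_self _).ge
      · exact (hq.ccw m j k h2 hk (by omega)).le)
    (by
      rw [cr_comm, ← cr_neg_left]
      refine key _ _ fun k hk hk' => ?_
      rw [cr_neg_left, ← cr_comm]
      rcases hk'.eq_or_lt with rfl | hk'
      · rw [hq.periodic]; exact (cr_self _).ge
      · have := hq.ccw m k (i + n) (by omega) hk' (by omega)
        rw [hq.periodic] at this
        exact this.le)
    (key _ _ fun k hk hk' => by
      rcases hk.eq_or_lt with rfl | hk
      · exact (cr_self _).ge
      rcases hk'.eq_or_lt with rfl | hk'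
      · rw [hq.periodic, sub_self]; simp [cr]
      · exact (hq.ccw i j k (by omega) hk (by omega)).le)
    (hq.ccw i m j h1 h2 hj)
  exact ⟨l, hl0, hl1, hl.trans h⟩

/-- The points of the outer chord lie in the hull of the vertices from `j'` to `i' + n`, so
`segNear_of_hull` applies to the inner chord. -/
lemma good_mono (hq : CcwSeq n q) {i j i' j' : ℤ} (hi : i ≤ i') (hj : j' ≤ j) (hij : j ≤ i + n)
    (h : Good ε q i j) : Good ε q i' j' := by
  intro m h1 h2
  obtain ⟨l, h0, h1', h⟩ := h m (by omega) (by omega)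
  refine hq.segNear_of_hull h1 h2 (by omega) ?_ h
  have := convex_convexHull ℝ (q '' Set.Icc j' (i' + n))
  have a1 : q i ∈ convexHull ℝ (q '' Set.Icc j' (i' + n)) :=
    subset_convexHull _ _ ⟨i + n, ⟨by omega, by omega⟩, hq.periodic i⟩
  have a2 : q j ∈ convexHull ℝ (q '' Set.Icc j' (i' + n)) :=
    subset_convexHull _ _ ⟨j, ⟨by omega, by omega⟩, rfl⟩
  exact this.add_smul_sub_mem a1 a2 ⟨h0, h1'⟩

lemma good_succ (i : ℤ) : Good ε q i (i + 1) := fun m h1 h2 => by omega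

lemma good_period (hq : CcwSeq n q) {i j : ℤ} : Good ε q (i + n) (j + n) ↔ Good ε q i j := by
  constructor
  · intro h m h1 h2
    have := h (m + n) (by omega) (by omega)
    simpa only [hq.periodic] using this
  · intro h m h1 h2
    have := h (m - n) (by omega) (by omega)
    rw [hq.periodic, hq.periodic]
    have e := hq.periodic (m - n)
    rw [sub_add_cancel] at e
    rwa [e]

end CcwSeq


/-! ### The angular order -/

/-- No point `p k` with `k < n` is a convex combination of three others. -/
def NoConvComb (n : ℕ) (p : ℕ → ℝ × ℝ) : Prop :=
  ∀ k < n, ∀ a < n, ∀ b < n, ∀ c < n, a ≠ k → b ≠ k → c ≠ k →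
    ∀ α β γ : ℝ, 0 ≤ α → 0 ≤ β → 0 ≤ γ → α + β + γ = 1 → α • p a + β • p b + γ • p c ≠ p k

/-- The counterclockwise order of the points around `p 0`, starting with `p 0` itself. -/
def AngLt (p : ℕ → ℝ × ℝ) (i j : ℕ) : Prop :=
  j ≠ 0 ∧ (i = 0 ∨ 0 < cr (p i - p 0) (p j - p 0))

namespace NoConvComb

variable {n : ℕ} {p : ℕ → ℝ × ℝ}

/-- Nonnegative weights that are not normalized, with the excluded point as origin. -/
lemma false_of_weights (hp : NoConvComb n p) {k a b c : ℕ} (hk : k < n) (ha : a < n) (hb : b < n)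
    (hc : c < n) (hak : a ≠ k) (hbk : b ≠ k) (hck : c ≠ k) {α β γ : ℝ} (h0 : 0 ≤ α) (h1 : 0 ≤ β)
    (h2 : 0 ≤ γ) (hs : 0 < α + β + γ)
    (h : α • (p a - p k) + β • (p b - p k) + γ • (p c - p k) = 0) : False := by
  refine hp k hk a ha b hb c hc hak hbk hck (α / (α + β + γ)) (β / (α + β + γ))
    (γ / (α + β + γ)) (by positivity) (by positivity) (by positivity) (by field_simp) ?_
  have e1 := congrArg Prod.fst h
  have e2 := congrArg Prod.snd h
  simp only [Prod.fst_add, Prod.snd_add, Prod.fst_sub, Prod.snd_sub, Prod.smul_fst, Prod.smul_snd,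
    smul_eq_mul, Prod.fst_zero, Prod.snd_zero] at e1 e2
  ext
  · simp only [Prod.fst_add, Prod.smul_fst, smul_eq_mul]
    field_simp
    linarith
  · simp only [Prod.snd_add, Prod.smul_snd, smul_eq_mul]
    field_simp
    linarith

lemma sub_ne_zero (hp : NoConvComb n p) {i j : ℕ} (hi : i < n) (hj : j < n) (hij : i ≠ j) :
    p i - p j ≠ 0 := by
  intro h
  exact hp.false_of_weights hj hi hi hi hij hij hij zero_le_one le_rfl le_rfl (by norm_num)
    (by simp [h])

/-- Of three collinear points one lies between the others; the size of `B` relative to `0` and `A`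
decides which. -/
lemma cr_ne_zero (hp : NoConvComb n p) {i j : ℕ} (hi : i < n) (hj : j < n) (hij : i ≠ j)
    (hi0 : i ≠ 0) (hj0 : j ≠ 0) : cr (p i - p 0) (p j - p 0) ≠ 0 := by
  intro h
  have hn : 0 < n := by omega
  have hd := hp.sub_ne_zero hi hn hi0
  have hpos : 0 < dt (p i - p 0) (p i - p 0) := by
    rcases (dt_self_nonneg (p i - p 0)).lt_or_eq with h' | h'
    · exact h'
    · exfalso
      apply hd
      simp only [dt] at h'
      ext
      · simp only [Prod.fst_zero]; nlinarith [sq_nonneg (p i - p 0).1, sq_nonneg (p i - p 0).2]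
      · simp only [Prod.snd_zero]; nlinarith [sq_nonneg (p i - p 0).1, sq_nonneg (p i - p 0).2]
  set A := dt (p i - p 0) (p i - p 0)
  set B := dt (p i - p 0) (p j - p 0)
  have e : A • (p j - p 0) = B • (p i - p 0) := by
    have := h
    simp only [cr] at this
    ext
    · simp only [A, B, dt, Prod.smul_fst, smul_eq_mul]
      linear_combination (-(p i - p 0).2) * this
    · simp only [A, B, dt, Prod.smul_snd, smul_eq_mul]
      linear_combination (p i - p 0).1 * this
  rcases lt_or_ge B 0 with hB | hB
  · exact hp.false_of_weights hn hj hi hi hj0 hi0 hi0 hpos.le (neg_nonneg.2 hB.le) le_rfl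
      (by linarith) (by rw [e]; simp)
  rcases le_or_gt B A with hBA | hBA
  · refine hp.false_of_weights hj hn hi hi hj0.symm hij hij (sub_nonneg.2 hBA) hB le_rfl
      (by linarith) ?_
    have : (A - B) • (p 0 - p j) + B • (p i - p j) + (0 : ℝ) • (p i - p j) =
        B • (p i - p 0) - A • (p j - p 0) := by
      ext <;> simp <;> ring
    rw [this, e, sub_self]
  · refine hp.false_of_weights hi hn hj hj hi0.symm hij.symm hij.symm (sub_nonneg.2 hBA.le) hpos.le
      le_rfl (by linarith) ?_
    have : (B - A) • (p 0 - p i) + A • (p j - p i) + (0 : ℝ) • (p j - p i) =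
        A • (p j - p 0) - B • (p i - p 0) := by
      ext <;> simp <;> ring
    rw [this, e, sub_self]

lemma angLt_irrefl (i : ℕ) : ¬ AngLt p i i := by
  rintro ⟨h, h' | h'⟩
  · exact h h'
  · rw [cr_self] at h'
    exact lt_irrefl _ h'

lemma angLt_or (hp : NoConvComb n p) {i j : ℕ} (hi : i < n) (hj : j < n) (hij : i ≠ j) :
    AngLt p i j ∨ AngLt p j i := by
  by_cases hi0 : i = 0
  · exact Or.inl ⟨by omega, Or.inl hi0⟩
  by_cases hj0 : j = 0
  · exact Or.inr ⟨hi0, Or.inl hj0⟩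
  rcases lt_or_gt_of_ne (hp.cr_ne_zero hi hj hij hi0 hj0) with h | h
  · exact Or.inr ⟨hi0, Or.inr (by rw [cr_comm]; linarith)⟩
  · exact Or.inl ⟨hj0, Or.inr h⟩

/-- If transitivity failed, the three cross products would be nonnegative weights that express `p 0`
by the other points. -/
lemma angLt_trans (hp : NoConvComb n p) {i j k : ℕ} (hi : i < n) (hj : j < n) (hk : k < n)
    (hij : AngLt p i j) (hjk : AngLt p j k) : AngLt p i k := by
  refine ⟨hjk.1, ?_⟩
  by_cases hi0 : i = 0
  · exact Or.inl hi0
  right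
  have h1 := hij.2.resolve_left hi0
  have h2 := hjk.2.resolve_left hij.1
  by_contra hc
  refine hp.false_of_weights (k := 0) (by omega) hi hj hk hi0 hij.1 hjk.1 h2.le
    (β := cr (p k - p 0) (p i - p 0)) (by rw [cr_comm]; linarith) h1.le
    (by rw [cr_comm (p k - p 0)]; linarith) ?_
  ext <;> simp [cr] <;> ring

/-- Otherwise `p j` lies in the triangle of `p 0`, `p i` and `p k`. -/
lemma ccw_of_angLt (hp : NoConvComb n p) {i j k : ℕ} (hi : i < n) (hj : j < n) (hk : k < n)
    (hij : AngLt p i j) (hjk : AngLt p j k) : 0 < cr (p j - p i) (p k - p i) := by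
  have h2 := hjk.2.resolve_left hij.1
  by_cases hi0 : i = 0
  · subst hi0; exact h2
  have h1 := hij.2.resolve_left hi0
  have h3 := (hp.angLt_trans hi hj hk hij hjk).2.resolve_left hi0
  by_contra hc
  have hne : ∀ {a b}, AngLt p a b → a ≠ b := fun h e => angLt_irrefl _ (e ▸ h)
  have e : cr (p j - p i) (p k - p i) = cr (p i - p 0) (p j - p 0) + cr (p j - p 0) (p k - p 0) -
      cr (p i - p 0) (p k - p 0) := by
    simp only [cr, Prod.fst_sub, Prod.snd_sub]; ring
  refine hp.false_of_weights hj hi hk (by omega : 0 < n) (hne hij) (hne hjk).symm hij.1.symm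
    h2.le h1.le (γ := -cr (p j - p i) (p k - p i)) (by linarith) (by linarith) ?_
  ext <;> simp [cr] <;> ring

end NoConvComb

/-- `σ` lists the points `p 0, …, p (n - 1)` in angular order. -/
structure Sorts (n : ℕ) (p : ℕ → ℝ × ℝ) (σ : ℕ → ℕ) : Prop where
  lt : ∀ a < n, σ a < n
  angLt : ∀ a b, a < b → b < n → AngLt p (σ a) (σ b)
  surj : ∀ k < n, ∃ a < n, σ a = k

/-- The periodic sequence of the points in angular order. -/
def sortedSeq (n : ℕ) (p : ℕ → ℝ × ℝ) (σ : ℕ → ℕ) (z : ℤ) : ℝ × ℝ := p (σ (z % n).toNat)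

lemma sortedSeq_natCast (n : ℕ) (p : ℕ → ℝ × ℝ) (σ : ℕ → ℕ) (k : ℕ) :
    sortedSeq n p σ k = p (σ (k % n)) := by
  rw [sortedSeq, ← Int.natCast_mod, Int.toNat_natCast]

/-- After a shift that puts `i` into the first period, the triple passes the end of the period at
most once, and a cyclic permutation restores the angular order. -/
lemma CcwSeq.of_sorts {n : ℕ} (hn : 0 < n) {p : ℕ → ℝ × ℝ} (hp : NoConvComb n p) {σ : ℕ → ℕ}
    (hσ : Sorts n p σ) : CcwSeq n (sortedSeq n p σ) where
  periodic i := by simp [sortedSeq]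
  ccw := by
    have hmain : ∀ a b c, a < b → b < c → c < n →
        0 < cr (p (σ b) - p (σ a)) (p (σ c) - p (σ a)) := fun a b c hab hbc hc =>
      hp.ccw_of_angLt (hσ.lt a (by omega)) (hσ.lt b (by omega)) (hσ.lt c hc)
        (hσ.angLt a b hab (by omega)) (hσ.angLt b c hbc hc)
    have hcyc : ∀ u v w : ℝ × ℝ, cr (v - u) (w - u) = cr (w - v) (u - v) := by
      intro u v w
      simp only [cr, Prod.fst_sub, Prod.snd_sub]; ring
    have hlow : ∀ z : ℤ, 0 ≤ z → z < n → sortedSeq n p σ z = p (σ z.toNat) := by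
      intro z h0 h1
      rw [sortedSeq, Int.emod_eq_of_lt h0 h1]
    have hhigh : ∀ z : ℤ, n ≤ z → z < 2 * n → sortedSeq n p σ z = p (σ (z - n).toNat) := by
      intro z h0 h1
      rw [← hlow _ (by omega) (by omega), sortedSeq, sortedSeq, Int.sub_emod_right]
    have hshift : ∀ z t : ℤ, sortedSeq n p σ (z - n * t) = sortedSeq n p σ z := by
      intro z t
      rw [sortedSeq, sortedSeq, Int.sub_mul_emod_self_left]
    intro i j k hij hjk hk
    rw [← hshift i (i / n), ← hshift j (i / n), ← hshift k (i / n)]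
    have hi0 : 0 ≤ i - n * (i / n) := by
      have := Int.emod_nonneg i (b := n) (by omega)
      rw [Int.emod_def] at this; exact this
    have hi1 : i - n * (i / n) < n := by
      have := Int.emod_lt_of_pos i (b := n) (by omega)
      rw [Int.emod_def] at this; exact this
    generalize (n : ℤ) * (i / n) = s at *
    rw [hlow _ hi0 hi1]
    by_cases hj : j - s < n
    · rw [hlow _ (by omega) hj]
      by_cases hk' : k - s < n
      · rw [hlow _ (by omega) hk']
        exact hmain _ _ _ (by omega) (by omega) (by omega)
      · rw [hhigh _ (by omega) (by omega), hcyc, hcyc]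
        exact hmain _ _ _ (by omega) (by omega) (by omega)
    · rw [hhigh (j - s) (by omega) (by omega), hhigh _ (by omega) (by omega), hcyc]
      exact hmain _ _ _ (by omega) (by omega) (by omega)


/-! ### The cost of a subset -/

/-- The coordinates of a point. -/
noncomputable def toPair : Plane →ₗ[ℝ] ℝ × ℝ where
  toFun a := (a 0, a 1)
  map_add' a b := by simp
  map_smul' s a := by simp

lemma toPair_apply (a : Plane) : toPair a = (a 0, a 1) := rfl

lemma dist_le_iff_dt {a b : Plane} {ε : ℝ} (hε : 0 ≤ ε) :
    dist a b ≤ ε ↔ dt (toPair a - toPair b) (toPair a - toPair b) ≤ ε ^ 2 := by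
  rw [EuclideanSpace.dist_eq, Real.sqrt_le_left hε, Fin.sum_univ_two]
  simp only [dt, toPair_apply, Prod.fst_sub, Prod.snd_sub, Real.dist_eq, sq_abs, ← sq]

lemma toPair_injective : Function.Injective toPair := by
  intro a b h
  have := (dist_le_iff_dt (a := a) (b := b) le_rfl).2 (by rw [h, sub_self]; simp [dt])
  exact dist_le_zero.1 this

/-- The coordinates of the points of an enumerated point set. -/
noncomputable def coords {P : Finset Plane} (x : Fin P.card ≃ P) (k : ℕ) : ℝ × ℝ :=
  if h : k < P.card then toPair (x ⟨k, h⟩ : Plane) else 0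

lemma coords_fin {P : Finset Plane} (x : Fin P.card ≃ P) (k : Fin P.card) :
    coords x k = toPair (x k : Plane) := by
  simp [coords]

lemma InConvexPosition.noConvComb {P : Finset Plane} (hP : InConvexPosition P)
    (x : Fin P.card ≃ P) : NoConvComb P.card (coords x) := by
  intro k hk a ha b hb c hc hak hbk hck α β γ h0 h1 h2 hs h
  have e : ∀ i (hi : i < P.card), coords x i = toPair (x ⟨i, hi⟩ : Plane) := fun i hi => by
    simp [coords, hi]
  rw [e k hk, e a ha, e b hb, e c hc, ← map_smul, ← map_smul, ← map_smul, ← map_add,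
    ← map_add] at h
  have h' := toPair_injective h
  have hmem := hP {x ⟨a, ha⟩, x ⟨b, hb⟩, x ⟨c, hc⟩} (x ⟨k, hk⟩) (by
    change ((x ⟨k, hk⟩ : P) : Plane) ∈ _
    rw [← h']
    have hsub : ∀ y ∈ ({x ⟨a, ha⟩, x ⟨b, hb⟩, x ⟨c, hc⟩} : Set P), (y : Plane) ∈ convexHull ℝ
        ((fun x : P => (x : Plane)) '' {x ⟨a, ha⟩, x ⟨b, hb⟩, x ⟨c, hc⟩}) := fun y hy =>
      subset_convexHull _ _ ⟨y, hy, rfl⟩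
    have hcv := convex_convexHull ℝ
      ((fun x : P => (x : Plane)) '' {x ⟨a, ha⟩, x ⟨b, hb⟩, x ⟨c, hc⟩})
    have := hcv.sum_mem (t := Finset.univ) (w := ![α, β, γ])
      (z := ![(x ⟨a, ha⟩ : Plane), x ⟨b, hb⟩, x ⟨c, hc⟩]) (by
        intro i _; fin_cases i <;> simpa) (by simp [Fin.sum_univ_three, hs]) (by
        intro i _; fin_cases i <;> exact hsub _ (by simp))
    simpa [Fin.sum_univ_three] using this)
  simp only [Set.mem_insert_iff, Set.mem_singleton_iff, EmbeddingLike.apply_eq_iff_eq,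
    Fin.mk.injEq] at hmem
  omega

section cost

variable {P : Finset Plane} (x : Fin P.card ≃ P) {σ : ℕ → ℕ} {ε : ℝ}

/-- A closed sequence of good chords gives a subset of cost at most `ε`. -/
lemma cost_le_of_good (hP : P.Nonempty) (hσ : Sorts P.card (coords x) σ) (hε : 0 < ε) {K : ℕ}
    {c : ℕ → ℕ} (hcK : c K = c 0 + P.card)
    (hgood : ∀ t < K, Good ε (sortedSeq P.card (coords x) σ) (c t) (c (t + 1)))
    (idx : Fin K → Fin P.card) (hidx : ∀ j : Fin K, (idx j : ℕ) = σ (c j % P.card)) :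
    cost (Finset.univ.image fun j => (x (idx j) : Plane)) P ≤ ENNReal.ofReal ε := by
  have hn := hP.card_pos
  have hlow : ∀ j : Fin K, toPair (x (idx j) : Plane) =
      sortedSeq P.card (coords x) σ (c j) := by
    intro j
    rw [sortedSeq_natCast, ← hidx, coords_fin]
  have hmem : ∀ t ≤ K, ∃ j : Fin K,
      toPair (x (idx j) : Plane) = sortedSeq P.card (coords x) σ (c t) := by
    intro t ht
    rcases ht.lt_or_eq with ht | rfl
    · exact ⟨⟨t, ht⟩, hlow _⟩
    · refine ⟨⟨0, ?_⟩, ?_⟩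
      · rcases Nat.eq_zero_or_pos t with rfl | h
        · omega
        · exact h
      · rw [hlow, sortedSeq_natCast, sortedSeq_natCast, hcK]
        simp
  refine iSup₂_le fun p hp => ?_
  obtain ⟨k, hk⟩ := x.surjective ⟨p, hp⟩
  obtain ⟨a, ha, hak⟩ := hσ.surj k k.2
  -- The position of `p` within the period that starts at `c 0`; some jump of the sequence covers
  -- it.
  obtain ⟨z, hz0, hz1, hza⟩ : ∃ z, c 0 ≤ z ∧ z < c 0 + P.card ∧ z % P.card = a := by
    refine ⟨c 0 + (a + P.card - c 0 % P.card) % P.card, by omega,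
      by have := Nat.mod_lt (a + P.card - c 0 % P.card) hn; omega, ?_⟩
    have hm := Nat.mod_lt (c 0) hn
    rw [Nat.add_mod_mod, ← Nat.mod_add_mod,
      show c 0 % P.card + (a + P.card - c 0 % P.card) = a + P.card by omega,
      Nat.add_mod_right, Nat.mod_eq_of_lt ha]
  have hpz : toPair p = sortedSeq P.card (coords x) σ z := by
    rw [sortedSeq_natCast, hza, hak, coords_fin, hk]
  obtain ⟨t, ht, hct, hct'⟩ : ∃ t < K, c t ≤ z ∧ z < c (t + 1) := by
    have : ∀ K, z < c K → ∃ t < K, c t ≤ z ∧ z < c (t + 1) := by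
      intro K
      induction K with
      | zero => intro h; omega
      | succ K ih =>
        intro h
        by_cases h' : z < c K
        · obtain ⟨t, ht, h⟩ := ih h'
          exact ⟨t, by omega, h⟩
        · exact ⟨K, by omega, by omega, h⟩
    exact this K (by omega)
  have hnear : SegNear ε (sortedSeq P.card (coords x) σ (c t))
      (sortedSeq P.card (coords x) σ (c (t + 1))) (toPair p) := by
    rw [hpz]
    rcases hct.eq_or_lt with h | h
    · rw [h]
      exact ⟨0, le_rfl, zero_le_one, by simp [dt]; positivity⟩
    · exact hgood t ht z (by omega) (by omega)
  obtain ⟨l, hl0, hl1, hl⟩ := hnear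
  obtain ⟨j, hj⟩ := hmem t ht.le
  obtain ⟨j', hj'⟩ := hmem (t + 1) ht
  rw [← hj, ← hj', ← map_sub, ← map_smul, ← map_add, ← dist_le_iff_dt hε.le] at hl
  have hin : ∀ j, (x (idx j) : Plane) ∈ convexHull ℝ
      ((Finset.univ.image fun j => (x (idx j) : Plane) : Finset Plane) : Set Plane) := fun j =>
    subset_convexHull _ _ (by simp)
  refine (Metric.infEDist_le_edist_of_mem
    ((convex_convexHull ℝ _).add_smul_sub_mem (hin j) (hin j') ⟨hl0, hl1⟩)).trans ?_
  rw [edist_dist]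
  exact ENNReal.ofReal_le_ofReal hl

lemma nonempty_of_cost_le (hP : P.Nonempty) {Q : Finset Plane}
    (hQ : cost Q P ≤ ENNReal.ofReal ε) : Q.Nonempty := by
  by_contra hc
  rw [Finset.not_nonempty_iff_eq_empty] at hc
  subst hc
  obtain ⟨p, hp⟩ := hP
  have := (le_iSup₂ (f := fun p (_ : p ∈ P) => Metric.infEDist p
    (convexHull ℝ ((∅ : Finset Plane) : Set Plane))) p hp).trans hQ
  simp at this

/-- Chords between consecutive points of a subset of cost at most `ε` are good. -/
lemma good_of_cost_le (hP : P.Nonempty) (hcv : InConvexPosition P)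
    (hσ : Sorts P.card (coords x) σ) (hε : 0 < ε)
    {Q : Finset Plane} (hQP : Q ⊆ P) (hQ : cost Q P ≤ ENNReal.ofReal ε) {J : ℕ → Prop}
    (hJ : ∀ k : Fin P.card, ((x k : P) : Plane) ∈ Q → ∃ a < P.card, σ a = k ∧ J a)
    (hJp : ∀ a, J (a + P.card) ↔ J a)
    {i j : ℕ} (hj : j ≤ i + P.card) (hbetween : ∀ k, i < k → k < j → ¬ J k) :
    Good ε (sortedSeq P.card (coords x) σ) i j := by
  have hn := hP.card_pos
  have hseq := CcwSeq.of_sorts hn (hcv.noConvComb x) hσ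
  have hJm : ∀ b t, J (b + t * P.card) ↔ J b := by
    intro b t
    induction t with
    | zero => simp
    | succ t ih => rw [Nat.succ_mul, ← add_assoc, hJp, ih]
  intro m h1 h2
  lift m to ℕ using by omega
  have hq := sortedSeq_natCast P.card (coords x) σ m
  set k : Fin P.card := ⟨σ (m % P.card), hσ.lt _ (Nat.mod_lt _ hn)⟩ with hk
  have hqm : sortedSeq P.card (coords x) σ m = toPair (x k : Plane) := by
    rw [hq, ← coords_fin]
  have hle : Metric.infEDist (x k : Plane) (convexHull ℝ (Q : Set Plane)) ≤ ENNReal.ofReal ε :=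
    (le_iSup₂ (f := fun p (_ : p ∈ P) => Metric.infEDist p (convexHull ℝ (Q : Set Plane)))
      (x k : Plane) (x k).2).trans hQ
  -- The hull is compact, so the distance is attained.
  obtain ⟨z, hz, hze⟩ := (Set.Finite.isCompact_convexHull (𝕜 := ℝ)
    (Finset.finite_toSet Q)).exists_infEDist_eq_edist
    ((nonempty_of_cost_le hP hQ).to_set.convexHull) (x k : Plane)
  rw [hze, edist_dist, ENNReal.ofReal_le_ofReal_iff hε.le, dist_le_iff_dt hε.le, ← hqm] at hle
  refine hseq.segNear_of_hull (by omega) (by omega) (by omega) ?_ hle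
  have him : toPair z ∈ toPair '' convexHull ℝ (Q : Set Plane) := ⟨z, hz, rfl⟩
  rw [LinearMap.image_convexHull] at him
  refine convexHull_mono ?_ him
  rintro _ ⟨y, hy, rfl⟩
  obtain ⟨k', hk'⟩ := x.surjective ⟨y, hQP hy⟩
  obtain ⟨a, ha, hak, hJa⟩ := hJ k' (by rw [hk']; exact hy)
  have hya : ∀ t : ℕ, sortedSeq P.card (coords x) σ ((a + t * P.card : ℕ) : ℤ) = toPair y := by
    intro t
    rw [sortedSeq_natCast, Nat.add_mul_mod_self_right, Nat.mod_eq_of_lt ha, hak, coords_fin, hk']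
  -- The copy of the position of `y` in the period after `i`. As it belongs to `J`, it is not
  -- strictly between `i` and `j`, hence lies in the range from `j` to `i + P.card`.
  obtain ⟨b, hb1, hb2, t, hbt⟩ : ∃ b, i < b ∧ b ≤ i + P.card ∧ ∃ t, b = a + t * P.card := by
    have hd := Nat.div_add_mod i P.card
    have hm := Nat.mod_lt i hn
    rw [mul_comm] at hd
    by_cases h : i % P.card < a
    · exact ⟨a + i / P.card * P.card, by omega, by omega, _, rfl⟩
    · refine ⟨a + (i / P.card + 1) * P.card, ?_, ?_, _, rfl⟩ <;> rw [Nat.succ_mul] <;> omega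
  have hJb : J b := by rw [hbt, hJm]; exact hJa
  refine ⟨b, ⟨?_, by omega⟩, by rw [hbt]; exact hya t⟩
  by_contra hc
  push Not at hc
  exact hbetween b hb1 (by omega) hJb

end cost


/-! ### Greedy circular covers -/

/-- A monotone periodic relation between the positions on a circle of length `n`, and the longest
jump `ℓ i` from each position `i`. -/
structure JumpSystem (n : ℕ) (G : ℕ → ℕ → Prop) (ℓ : ℕ → ℕ) : Prop where
  pos : 0 < n
  mono : ∀ {i j i' j'}, i ≤ i' → j' ≤ j → j ≤ i + n → G i j → G i' j'
  period : ∀ i j, G (i + n) (j + n) ↔ G i j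
  jump_pos : ∀ i < n, 0 < ℓ i
  jump_le : ∀ i < n, ℓ i ≤ n
  jump_iff : ∀ i < n, ∀ j, i < j → j ≤ i + n → (G i j ↔ j ≤ i + ℓ i)

/-- The end of the longest jump from `i`. -/
def jumpTo (n : ℕ) (ℓ : ℕ → ℕ) (i : ℕ) : ℕ := i + ℓ (i % n)

namespace JumpSystem

variable {n : ℕ} {G : ℕ → ℕ → Prop} {ℓ : ℕ → ℕ}

lemma period_mul (h : JumpSystem n G ℓ) (i j t : ℕ) : G (i + n * t) (j + n * t) ↔ G i j := by
  induction t with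
  | zero => simp
  | succ t ih => rw [Nat.mul_succ, ← add_assoc, ← add_assoc, h.period, ih]

lemma good_iff (h : JumpSystem n G ℓ) {i j : ℕ} (hij : i < j) (hj : j ≤ i + n) :
    G i j ↔ j ≤ jumpTo n ℓ i := by
  have hd := Nat.mod_add_div i n
  have hm := Nat.mod_lt i h.pos
  obtain ⟨j', rfl⟩ : ∃ j', j = j' + n * (i / n) := ⟨j - n * (i / n), by omega⟩
  have := h.period_mul (i % n) j' (i / n)
  rw [hd] at this
  rw [this, h.jump_iff _ hm j' (by omega) (by omega), jumpTo]
  omega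

lemma lt_jumpTo (h : JumpSystem n G ℓ) (i : ℕ) : i < jumpTo n ℓ i := by
  have := h.jump_pos _ (Nat.mod_lt i h.pos)
  rw [jumpTo]; omega

lemma jumpTo_le (h : JumpSystem n G ℓ) (i : ℕ) : jumpTo n ℓ i ≤ i + n := by
  have := h.jump_le _ (Nat.mod_lt i h.pos)
  rw [jumpTo]; omega

lemma good_jumpTo (h : JumpSystem n G ℓ) (i : ℕ) : G i (jumpTo n ℓ i) :=
  (h.good_iff (h.lt_jumpTo i) (h.jumpTo_le i)).2 le_rfl

/-- If the jump from `i` passes `j`, its remainder from `j` on is a good jump. -/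
lemma jumpTo_mono (h : JumpSystem n G ℓ) : Monotone (jumpTo n ℓ) := by
  intro i j hij
  rcases le_or_gt (jumpTo n ℓ i) j with hc | hc
  · exact hc.trans (h.lt_jumpTo j).le
  · have := h.jumpTo_le i
    exact (h.good_iff hc (by omega)).1 (h.mono hij le_rfl this (h.good_jumpTo i))

lemma iterate_lt (h : JumpSystem n G ℓ) (c t : ℕ) :
    (jumpTo n ℓ)^[t] c < (jumpTo n ℓ)^[t + 1] c := by
  rw [Function.iterate_succ_apply']
  exact h.lt_jumpTo _

lemma iterate_ge (h : JumpSystem n G ℓ) {L : ℕ} (hL : ∀ i < n, L ≤ ℓ i) (c t : ℕ) :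
    c + t * L ≤ (jumpTo n ℓ)^[t] c := by
  induction t with
  | zero => simp
  | succ t ih =>
    rw [Function.iterate_succ_apply', jumpTo, Nat.succ_mul]
    have := hL _ (Nat.mod_lt ((jumpTo n ℓ)^[t] c) h.pos)
    omega

/-- Any closed sequence of good jumps is at least as long as a greedy one that starts in it. -/
lemma period_le_iterate (h : JumpSystem n G ℓ) {J : ℕ → Prop} [DecidablePred J]
    (hJp : ∀ a, J (a + n) ↔ J a)
    (hJ : ∀ i j, i < j → j ≤ i + n → J i → J j → (∀ k, i < k → k < j → ¬ J k) → G i j)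
    {c : ℕ} (hc : J c) : c + n ≤ (jumpTo n ℓ)^[n.count J] c := by
  have hJt : ∀ t, J (c + n * t) := by
    intro t
    induction t with
    | zero => exact hc
    | succ t ih => rw [Nat.mul_succ, ← add_assoc, hJp]; exact ih
  have hinf : ({a | J a}).Infinite := by
    refine Set.infinite_of_not_bddAbove ?_
    rintro ⟨b, hb⟩
    have : c + n * (b + 1) ≤ b := hb (hJt (b + 1))
    nlinarith [h.pos]
  -- Greedy stays ahead: `t` greedy jumps from `c` reach at least the `t`-th later element of `J`.
  have hstep : ∀ t, Nat.nth J (Nat.count J c + t) ≤ (jumpTo n ℓ)^[t] c := by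
    intro t
    induction t with
    | zero => simp [Nat.nth_count hc]
    | succ t ih =>
      rw [Function.iterate_succ_apply']
      refine le_trans ?_ (h.jumpTo_mono ih)
      have h1 : Nat.nth J (Nat.count J c + t) < Nat.nth J (Nat.count J c + (t + 1)) :=
        Nat.nth_strictMono hinf (by omega)
      have hbet : ∀ k, Nat.nth J (Nat.count J c + t) < k →
          k < Nat.nth J (Nat.count J c + (t + 1)) → ¬ J k := by
        intro k hk hk' hJk
        have := Nat.le_nth_of_lt_nth_succ (p := J) (k := Nat.count J c + t) hk' hJk
        omega
      have h2 : Nat.nth J (Nat.count J c + (t + 1)) ≤ Nat.nth J (Nat.count J c + t) + n := by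
        by_contra hcon
        exact hbet (Nat.nth J (Nat.count J c + t) + n) (by have := h.pos; omega) (by omega)
          ((hJp _).2 (Nat.nth_mem_of_infinite hinf _))
      exact (h.good_iff h1 h2).1 (hJ _ _ h1 h2 (Nat.nth_mem_of_infinite hinf _)
        (Nat.nth_mem_of_infinite hinf _) hbet)
  have hcount : Nat.count J (c + n) = Nat.count J c + n.count J := by
    rw [Nat.count_eq_card_filter_range, Nat.count_eq_card_filter_range J c,
      ← Nat.filter_Ico_card_eq_of_periodic c n J (fun a => propext (hJp a)),
      Finset.range_eq_Ico, Finset.range_eq_Ico,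
      ← Finset.Ico_union_Ico_eq_Ico (Nat.zero_le c) (Nat.le_add_right c n), Finset.filter_union,
      Finset.card_union_of_disjoint]
    exact Finset.disjoint_filter_filter (Finset.Ico_disjoint_Ico_consecutive 0 c (c + n))
  have := hstep (n.count J)
  rwa [← hcount, Nat.nth_count ((hJp c).2 hc)] at this

/-- One of the positions that the longest jump from `s` reaches belongs to a given closed sequence
of good jumps. -/
lemma exists_start (h : JumpSystem n G ℓ) {J : ℕ → Prop}
    (hJp : ∀ a, J (a + n) ↔ J a) (hJe : ∃ a, J a)
    (hJ : ∀ i j, i < j → j ≤ i + n → J i → J j → (∀ k, i < k → k < j → ¬ J k) → G i j)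
    {s : ℕ} (hs : s < n) : ∃ c, s ≤ c ∧ c ≤ s + ℓ s ∧ J c := by
  classical
  have hex : ∀ b, ∃ c, b ≤ c ∧ c < b + n ∧ J c := by
    obtain ⟨a, ha⟩ := hJe
    have hJm : ∀ b t, J (b + n * t) ↔ J b := by
      intro b t
      induction t with
      | zero => simp
      | succ t ih => rw [Nat.mul_succ, ← add_assoc, hJp, ih]
    have ha' : J (a % n) := by
      rw [← hJm _ (a / n), Nat.mod_add_div]; exact ha
    have hm := Nat.mod_lt a h.pos
    intro b
    have hb := Nat.mod_add_div b n
    have hbm := Nat.mod_lt b h.pos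
    by_cases hlt : b % n ≤ a % n
    · exact ⟨a % n + n * (b / n), by omega, by omega, (hJm _ _).2 ha'⟩
    · refine ⟨a % n + n * (b / n + 1), ?_, ?_, (hJm _ _).2 ha'⟩ <;> rw [Nat.mul_succ] <;> omega
  by_contra hcon
  push Not at hcon
  have hE := hex s
  obtain ⟨hj1, hj2, hj3⟩ := Nat.find_spec hE
  set j := Nat.find hE
  have hjL : s + ℓ s < j := by
    by_contra hc
    exact hcon j hj1 (by omega) hj3
  set i := Nat.findGreatest J (s + n - 1) with hi
  obtain ⟨c0, hc1, hc2, hc3⟩ := hex s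
  -- the last element before `s + n`, moved back by one period
  have hi3 : J i := Nat.findGreatest_spec (m := c0) (by omega) hc3
  have hi1 : c0 ≤ i := Nat.le_findGreatest (by omega) hc3
  have hi2 : i ≤ s + n - 1 := Nat.findGreatest_le _
  have hjn : J (j + n) := (hJp j).2 hj3
  have hji : j ≤ i := Nat.le_findGreatest (by omega) hj3
  -- Here `i` and `j + n` are consecutive elements of `J`, with `s + n` and `s + n + ℓ s` between
  -- them. The jump over both contradicts that `ℓ s` is the longest jump from `s`.
  have hG : G i (j + n) := by
    refine hJ i (j + n) (by omega) (by omega) hi3 hjn fun k hk1 hk2 hk => ?_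
    by_cases hks : k ≤ s + n - 1
    · exact Nat.findGreatest_is_greatest hk1 hks hk
    · have hk' : J (k - n) := by rw [← hJp, Nat.sub_add_cancel (by omega)]; exact hk
      exact Nat.find_min hE (m := k - n) (by omega) ⟨by omega, by omega, hk'⟩
  have hG2 := h.mono (i' := s + n) (j' := s + ℓ s + 1 + n) (by omega) (by omega) (by omega) hG
  rw [h.period, h.jump_iff s hs _ (by omega) (by omega)] at hG2
  omega

end JumpSystem

/-! ### Optimal subsets and greedy sequences. -/

section

variable {P : Finset Plane} (x : Fin P.card ≃ P) {σ : ℕ → ℕ} {ε : ℝ} {ℓ : ℕ → ℕ}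

lemma Sorts.injOn {n : ℕ} {p : ℕ → ℝ × ℝ} (hσ : Sorts n p σ) :
    Set.InjOn σ (Set.Iio n) := by
  intro a ha b hb h
  rcases lt_trichotomy a b with hab | hab | hab
  · exact absurd (h ▸ hσ.angLt a b hab hb) (NoConvComb.angLt_irrefl _)
  · exact hab
  · exact absurd (h ▸ hσ.angLt b a hab ha) (NoConvComb.angLt_irrefl _)

/-- Any subset of cost at most `ε` has at least as many points as some greedy closed sequence. -/
lemma exists_greedy_of_cost_le (hP : P.Nonempty) (hcv : InConvexPosition P)
    (hσ : Sorts P.card (coords x) σ) (hε : 0 < ε)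
    (hJS : JumpSystem P.card (fun i j : ℕ => Good ε (sortedSeq P.card (coords x) σ) i j) ℓ)
    {Q : Finset Plane} (hQP : Q ⊆ P) (hQ : cost Q P ≤ ENNReal.ofReal ε) {s : ℕ}
    (hs : s < P.card) :
    ∃ c, s ≤ c ∧ c ≤ s + ℓ s ∧ c + P.card ≤ (jumpTo P.card ℓ)^[Q.card] c := by
  classical
  have hn := hP.card_pos
  set y : ℕ → Plane := fun a => x ⟨σ (a % P.card), hσ.lt _ (Nat.mod_lt _ hn)⟩ with hy
  set J : ℕ → Prop := fun a => y a ∈ Q with hJdef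
  have hJp : ∀ a, J (a + P.card) ↔ J a := by
    intro a
    simp [hJdef, hy]
  have hJQ : ∀ k : Fin P.card, ((x k : P) : Plane) ∈ Q → ∃ a < P.card, σ a = k ∧ J a := by
    intro k hk
    obtain ⟨a, ha, hak⟩ := hσ.surj k k.2
    refine ⟨a, ha, hak, ?_⟩
    simp only [hJdef, hy, Nat.mod_eq_of_lt ha, hak]
    exact hk
  have hJG : ∀ i j, i < j → j ≤ i + P.card → J i → J j → (∀ k, i < k → k < j → ¬ J k) →
      Good ε (sortedSeq P.card (coords x) σ) i j := fun i j _ hj _ _ hb =>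
    good_of_cost_le x hP hcv hσ hε hQP hQ hJQ hJp hj hb
  have hJe : ∃ a, J a := by
    obtain ⟨p, hp⟩ := nonempty_of_cost_le hP hQ
    obtain ⟨k, hk⟩ := x.surjective ⟨p, hQP hp⟩
    obtain ⟨a, -, -, ha⟩ := hJQ k (by rw [hk]; exact hp)
    exact ⟨a, ha⟩
  obtain ⟨c, hc1, hc2, hc⟩ := hJS.exists_start hJp hJe hJG hs
  refine ⟨c, hc1, hc2, (hJS.period_le_iterate hJp hJG hc).trans ?_⟩
  -- Iterates increase, and `J` has at most `Q.card` elements in a period because positions below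
  -- `P.card` give distinct points.
  refine monotone_nat_of_le_succ (fun t => (hJS.iterate_lt c t).le) ?_
  rw [Nat.count_eq_card_filter_range]
  refine Finset.card_le_card_of_injOn y (fun a ha => ?_) ?_
  · simp only [Finset.coe_filter, Set.mem_ofPred_eq] at ha
    exact ha.2
  · intro a ha b hb hab
    simp only [Finset.coe_filter, Finset.mem_range, Set.mem_ofPred_eq] at ha hb
    have := x.injective (Subtype.ext hab)
    simp only [Fin.mk.injEq, Nat.mod_eq_of_lt ha.1, Nat.mod_eq_of_lt hb.1] at this
    exact hσ.injOn ha.1 hb.1 this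

/-- The shortest greedy closed sequence from the positions that the longest jump from `s` reaches
is an optimal subset. -/
lemma isLeast_of_greedy (hP : P.Nonempty) (hcv : InConvexPosition P)
    (hσ : Sorts P.card (coords x) σ) (hε : 0 < ε)
    (hJS : JumpSystem P.card (fun i j : ℕ => Good ε (sortedSeq P.card (coords x) σ) i j) ℓ)
    {s c k : ℕ} (hs : s < P.card) (hk : c + P.card ≤ (jumpTo P.card ℓ)^[k] c)
    (hk' : ∀ t < k, (jumpTo P.card ℓ)^[t] c < c + P.card)
    (hmin : ∀ c', s ≤ c' → c' ≤ s + ℓ s → ∀ t, c' + P.card ≤ (jumpTo P.card ℓ)^[t] c' → k ≤ t)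
    (idx : Fin k → Fin P.card)
    (hidx : ∀ j : Fin k, (idx j : ℕ) = σ ((jumpTo P.card ℓ)^[j] c % P.card)) :
    IsLeast {k : ℕ | ∃ Q : Finset Plane, Q ⊆ P ∧ Q.card ≤ k ∧ cost Q P ≤ ENNReal.ofReal ε} k ∧
    cost (Finset.univ.image fun j => (x (idx j) : Plane)) P ≤ ENNReal.ofReal ε := by
  have hn := hP.card_pos
  have hk0 : 0 < k := by
    rcases Nat.eq_zero_or_pos k with rfl | h
    · have : c + P.card ≤ c := hk
      omega
    · exact h
  have hcost : cost (Finset.univ.image fun j => (x (idx j) : Plane)) P ≤ ENNReal.ofReal ε := by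
    -- The last greedy jump may overshoot, so it is cut back to `c + P.card`; it stays good by
    -- monotonicity.
    refine cost_le_of_good x hP hσ hε
      (c := fun t => if t < k then (jumpTo P.card ℓ)^[t] c else c + P.card)
      (by simp [hk0]) (fun t ht => ?_) idx (fun j => by simp [hidx])
    simp only [ht, if_true]
    have hle := hJS.jumpTo_le ((jumpTo P.card ℓ)^[t] c)
    have hg := hJS.good_jumpTo ((jumpTo P.card ℓ)^[t] c)
    rw [← Function.iterate_succ_apply' (jumpTo P.card ℓ) t c, Nat.succ_eq_add_one] at hle hg
    by_cases ht' : t + 1 < k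
    · simp only [ht', if_true]
      exact hg
    · simp only [ht', if_false]
      have : t + 1 = k := by omega
      rw [this] at hle hg
      exact hJS.mono le_rfl hk hle hg
  refine ⟨⟨⟨_, ?_, ?_, hcost⟩, ?_⟩, hcost⟩
  · intro p hp
    simp only [Finset.mem_image, Finset.mem_univ, true_and] at hp
    obtain ⟨j, rfl⟩ := hp
    exact (x (idx j)).2
  · exact Finset.card_image_le.trans (by simp)
  · rintro k' ⟨Q, hQP, hQk, hQ⟩
    obtain ⟨c', h1, h2, h3⟩ := exists_greedy_of_cost_le x hP hcv hσ hε hJS hQP hQ hs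
    exact (hmin c' h1 h2 _ h3).trans hQk

end


/-! ### Reasoning about programs -/

namespace RealRAM

infixr:60 " ;; " => Program.seq

instance : Add WExp := ⟨WExp.op .add⟩
instance : Sub WExp := ⟨WExp.op .sub⟩
instance : Mul WExp := ⟨WExp.op .mul⟩
instance : Div WExp := ⟨WExp.op .div⟩
instance : Add RExp := ⟨RExp.op .add⟩
instance : Sub RExp := ⟨RExp.op .sub⟩
instance : Mul RExp := ⟨RExp.op .mul⟩

section eval
variable {w : ℕ} {σ : State}

@[simp] lemma WExp.eval_const (c : ℕ) : (WExp.const c).eval w σ = c % 2 ^ w := rfl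
@[simp] lemma WExp.eval_var (i : ℕ) : (WExp.var i).eval w σ = σ.wordVar i := rfl
@[simp] lemma WExp.eval_load (a : ℕ) (e : WExp) :
    (WExp.load a e).eval w σ = σ.wordArr a (e.eval w σ) := rfl
@[simp] lemma WExp.eval_add (e f : WExp) :
    (e + f).eval w σ = (e.eval w σ + f.eval w σ) % 2 ^ w := rfl
@[simp] lemma WExp.eval_sub (e f : WExp) :
    (e - f).eval w σ = (e.eval w σ - f.eval w σ) % 2 ^ w := rfl
@[simp] lemma WExp.eval_mul (e f : WExp) :
    (e * f).eval w σ = (e.eval w σ * f.eval w σ) % 2 ^ w := rfl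
@[simp] lemma WExp.eval_div (e f : WExp) :
    (e / f).eval w σ = (e.eval w σ / f.eval w σ) % 2 ^ w := rfl
@[simp] lemma RExp.eval_ofWord (e : WExp) : (RExp.ofWord e).eval w σ = (e.eval w σ : ℝ) := rfl
@[simp] lemma RExp.eval_var (i : ℕ) : (RExp.var i).eval w σ = σ.realVar i := rfl
@[simp] lemma RExp.eval_load (a : ℕ) (e : WExp) :
    (RExp.load a e).eval w σ = σ.realArr a (e.eval w σ) := rfl
@[simp] lemma RExp.eval_add (e f : RExp) : (e + f).eval w σ = e.eval w σ + f.eval w σ := rfl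
@[simp] lemma RExp.eval_sub (e f : RExp) : (e - f).eval w σ = e.eval w σ - f.eval w σ := rfl
@[simp] lemma RExp.eval_mul (e f : RExp) : (e * f).eval w σ = e.eval w σ * f.eval w σ := rfl
@[simp] lemma Test.holds_wordLt (e f : WExp) :
    (Test.wordLt e f).Holds w σ ↔ e.eval w σ < f.eval w σ := Iff.rfl
@[simp] lemma Test.holds_realLt (e f : RExp) :
    (Test.realLt e f).Holds w σ ↔ e.eval w σ < f.eval w σ := Iff.rfl
@[simp] lemma Test.holds_not (b : Test) : b.not.Holds w σ ↔ ¬ b.Holds w σ := Iff.rfl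
@[simp] lemma Test.holds_and (b c : Test) :
    (b.and c).Holds w σ ↔ b.Holds w σ ∧ c.Holds w σ := Iff.rfl

/-- Disjunction of tests. -/
def Test.or (b c : Test) : Test := (b.not.and c.not).not

@[simp] lemma Test.holds_or (b c : Test) :
    (b.or c).Holds w σ ↔ b.Holds w σ ∨ c.Holds w σ := by
  simp only [Test.or, Test.holds_not, Test.holds_and]
  tauto

@[simp] lemma State.setWord_wordVar (i v j : ℕ) :
    (σ.setWord i v).wordVar j = if j = i then v else σ.wordVar j := by
  simp [State.setWord, Function.update_apply]
@[simp] lemma State.setWord_realVar (i v j : ℕ) : (σ.setWord i v).realVar j = σ.realVar j := rfl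
@[simp] lemma State.setWord_wordArr (i v : ℕ) : (σ.setWord i v).wordArr = σ.wordArr := rfl
@[simp] lemma State.setWord_realArr (i v : ℕ) : (σ.setWord i v).realArr = σ.realArr := rfl
@[simp] lemma State.storeWord_wordVar (a i v j : ℕ) :
    (σ.storeWord a i v).wordVar j = σ.wordVar j := rfl
@[simp] lemma State.storeWord_realVar (a i v j : ℕ) :
    (σ.storeWord a i v).realVar j = σ.realVar j := rfl
@[simp] lemma State.storeWord_wordArr (a i v b j : ℕ) :
    (σ.storeWord a i v).wordArr b j = if b = a ∧ j = i then v else σ.wordArr b j := by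
  simp only [State.storeWord, Function.update_apply]
  split_ifs <;> simp_all
@[simp] lemma State.storeWord_realArr (a i v : ℕ) :
    (σ.storeWord a i v).realArr = σ.realArr := rfl
@[simp] lemma State.storeReal_wordVar (a i : ℕ) (v : ℝ) (j : ℕ) :
    (σ.storeReal a i v).wordVar j = σ.wordVar j := rfl
@[simp] lemma State.storeReal_realVar (a i : ℕ) (v : ℝ) (j : ℕ) :
    (σ.storeReal a i v).realVar j = σ.realVar j := rfl
@[simp] lemma State.storeReal_wordArr (a i : ℕ) (v : ℝ) :
    (σ.storeReal a i v).wordArr = σ.wordArr := rfl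
@[simp] lemma State.storeReal_realArr (a i : ℕ) (v : ℝ) (b j : ℕ) :
    (σ.storeReal a i v).realArr b j = if b = a ∧ j = i then v else σ.realArr b j := by
  simp only [State.storeReal, Function.update_apply]
  split_ifs <;> simp_all

end eval

/-- The effect of a program without loops. -/
noncomputable def Program.eval (w : ℕ) : Program → State → State
  | .skip, σ => σ
  | .setWord i e, σ => σ.setWord i (e.eval w σ)
  | .setReal i e, σ => σ.setReal i (e.eval w σ)
  | .storeWord a j e, σ => σ.storeWord a (j.eval w σ) (e.eval w σ)
  | .storeReal a j e, σ => σ.storeReal a (j.eval w σ) (e.eval w σ)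
  | .seq p q, σ => q.eval w (p.eval w σ)
  | .ite b p q, σ => open Classical in if b.Holds w σ then p.eval w σ else q.eval w σ
  | .loop _ _, σ => σ

@[simp] lemma Program.eval_setWord (w i : ℕ) (e : WExp) (σ : State) :
    (Program.setWord i e).eval w σ = σ.setWord i (e.eval w σ) := rfl
@[simp] lemma Program.eval_storeWord (w a : ℕ) (j e : WExp) (σ : State) :
    (Program.storeWord a j e).eval w σ = σ.storeWord a (j.eval w σ) (e.eval w σ) := rfl
@[simp] lemma Program.eval_storeReal (w a : ℕ) (j : WExp) (e : RExp) (σ : State) :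
    (Program.storeReal a j e).eval w σ = σ.storeReal a (j.eval w σ) (e.eval w σ) := rfl
@[simp] lemma Program.eval_seq (w : ℕ) (p q : Program) (σ : State) :
    (p ;; q).eval w σ = q.eval w (p.eval w σ) := rfl
lemma Program.eval_ite_pos {w : ℕ} {b : Test} {p q : Program} {σ : State} (h : b.Holds w σ) :
    (Program.ite b p q).eval w σ = p.eval w σ := if_pos h
lemma Program.eval_ite_neg {w : ℕ} {b : Test} {p q : Program} {σ : State} (h : ¬ b.Holds w σ) :
    (Program.ite b p q).eval w σ = q.eval w σ := if_neg h

/-- The program has no loops. -/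
def Program.LoopFree : Program → Prop
  | .seq p q => p.LoopFree ∧ q.LoopFree
  | .ite _ p q => p.LoopFree ∧ q.LoopFree
  | .loop _ _ => False
  | _ => True

/-- An upper bound for the number of steps of a program without loops. -/
def Program.time : Program → ℕ
  | .skip => 1
  | .setWord _ e => e.steps + 1
  | .setReal _ e => e.steps + 1
  | .storeWord _ j e => j.steps + e.steps + 1
  | .storeReal _ j e => j.steps + e.steps + 1
  | .seq p q => p.time + q.time
  | .ite b p q => b.steps + max p.time q.time
  | .loop _ _ => 0

/-- The number of steps of one iteration of a loop without inner loops. -/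
def Program.iterTime : Program → ℕ
  | .loop b p => p.time + b.steps
  | _ => 0

/-- The program `p` started in `σ` halts within `N` steps in a state with `Q`. -/
def Run (w : ℕ) (p : Program) (N : ℕ) (σ : State) (Q : State → Prop) : Prop :=
  ∃ τ t, Exec w p σ τ t ∧ t ≤ N ∧ Q τ

variable {w N M : ℕ} {p q : Program} {b : Test} {σ τ : State} {Q R : State → Prop}

lemma exec_eval (hp : p.LoopFree) (σ : State) : ∃ t ≤ p.time, Exec w p σ (p.eval w σ) t := by
  induction p generalizing σ with
  | skip => exact ⟨_, le_rfl, Exec.skip σ⟩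
  | setWord i e => exact ⟨_, le_rfl, Exec.setWord i e σ⟩
  | setReal i e => exact ⟨_, le_rfl, Exec.setReal i e σ⟩
  | storeWord a j e => exact ⟨_, le_rfl, Exec.storeWord a j e σ⟩
  | storeReal a j e => exact ⟨_, le_rfl, Exec.storeReal a j e σ⟩
  | seq p q ihp ihq =>
    obtain ⟨s, hs, hp'⟩ := ihp hp.1 σ
    obtain ⟨t, ht, hq'⟩ := ihq hp.2 (p.eval w σ)
    exact ⟨_, Nat.add_le_add hs ht, Exec.seq hp' hq'⟩
  | ite b p q ihp ihq =>
    by_cases hb : b.Holds w σ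
    · obtain ⟨s, hs, hp'⟩ := ihp hp.1 σ
      refine ⟨b.steps + s, Nat.add_le_add_left (hs.trans (le_max_left _ _)) _, ?_⟩
      simpa [Program.eval, hb] using Exec.iteTrue (q := q) hb hp'
    · obtain ⟨s, hs, hp'⟩ := ihq hp.2 σ
      refine ⟨b.steps + s, Nat.add_le_add_left (hs.trans (le_max_right _ _)) _, ?_⟩
      simpa [Program.eval, hb] using Exec.iteFalse (p := p) hb hp'
  | loop b p => exact hp.elim

lemma Run.of_eval (hp : p.LoopFree) (hN : p.time ≤ N) (h : Q (p.eval w σ)) : Run w p N σ Q := by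
  obtain ⟨t, ht, he⟩ := exec_eval hp σ
  exact ⟨_, t, he, ht.trans hN, h⟩

lemma Run.mono (h : Run w p N σ Q) (hN : N ≤ M) (hQ : ∀ τ, Q τ → R τ) : Run w p M σ R := by
  obtain ⟨τ, t, he, ht, hq⟩ := h
  exact ⟨τ, t, he, ht.trans hN, hQ τ hq⟩

lemma Run.seq (hp : Run w p N σ R) (hq : ∀ τ, R τ → Run w q M τ Q) :
    Run w (p ;; q) (N + M) σ Q := by
  obtain ⟨τ, t, he, ht, hr⟩ := hp
  obtain ⟨υ, s, he', hs, hQ⟩ := hq τ hr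
  exact ⟨υ, t + s, Exec.seq he he', Nat.add_le_add ht hs, hQ⟩

lemma Test.steps_pos (b : Test) : 0 < b.steps := by
  cases b <;> simp [Test.steps]

/-- Loops with an invariant and a potential that pays for the steps. -/
lemma Run.loop {α : Type*} (I : α → State → Prop) (Φ : α → ℕ)
    (hdone : ∀ a σ, I a σ → ¬ b.Holds w σ → Q σ)
    (hstep : ∀ a σ, I a σ → b.Holds w σ →
      ∃ N, Run w p N σ fun τ => ∃ a', I a' τ ∧ N + b.steps + Φ a' ≤ Φ a)
    {a : α} (ha : I a σ) : Run w (.loop b p) (Φ a + b.steps) σ Q := by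
  induction hΦ : Φ a using Nat.strong_induction_on generalizing a σ with
  | _ k ih =>
    subst hΦ
    by_cases hb : b.Holds w σ
    · obtain ⟨N, τ, t, he, ht, a', ha', hle⟩ := hstep a σ ha hb
      have := b.steps_pos
      obtain ⟨υ, s, he', hs, hQ⟩ := ih (Φ a') (by omega) ha' rfl
      exact ⟨υ, _, Exec.loopStep hb he he', by omega, hQ⟩
    · exact ⟨σ, _, Exec.loopDone hb, by omega, hdone a σ ha hb⟩

/-- Loops with a bounded number of steps in each iteration: `Φ` counts the iterations. -/
lemma Run.for {α : Type*} (I : α → State → Prop) (Φ : α → ℕ) (B : ℕ) (a : α) (ha : I a σ)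
    (hN : (B + b.steps) * (Φ a + 1) ≤ N)
    (hdone : ∀ a σ, I a σ → ¬ b.Holds w σ → Q σ)
    (hstep : ∀ a σ, I a σ → b.Holds w σ → Run w p B σ fun τ => ∃ a', I a' τ ∧ Φ a' < Φ a) :
    Run w (.loop b p) N σ Q := by
  rw [Nat.mul_add, Nat.mul_one] at hN
  refine (Run.loop I (fun a => (B + b.steps) * Φ a) hdone (fun a σ ha hb => ?_) ha).mono
    (by omega) fun _ h => h
  refine ⟨B, (hstep a σ ha hb).mono le_rfl ?_⟩
  rintro τ ⟨a', ha', hlt⟩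
  refine ⟨a', ha', ?_⟩
  calc B + b.steps + (B + b.steps) * Φ a' = (B + b.steps) * (Φ a' + 1) := by ring
    _ ≤ _ := Nat.mul_le_mul_left _ hlt

/-- Loops with a loop-free body: `Φ` counts the iterations. -/
lemma Run.while {α : Type*} (I : α → State → Prop) (Φ : α → ℕ) (a : α) (ha : I a σ)
    (hN : (Program.loop b p).iterTime * (Φ a + 1) ≤ N) (hp : p.LoopFree)
    (hdone : ∀ a σ, I a σ → ¬ b.Holds w σ → Q σ)
    (hstep : ∀ a σ, I a σ → b.Holds w σ → ∃ a', I a' (p.eval w σ) ∧ Φ a' < Φ a) :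
    Run w (.loop b p) N σ Q :=
  Run.for I Φ p.time a ha hN hdone fun a σ ha hb => Run.of_eval hp le_rfl (hstep a σ ha hb)

/-- The program assigns to word variable `i`. -/
def Program.SetsWord (i : ℕ) : Program → Prop
  | .setWord j _ => i = j
  | .seq p q => p.SetsWord i ∨ q.SetsWord i
  | .ite _ p q => p.SetsWord i ∨ q.SetsWord i
  | .loop _ p => p.SetsWord i
  | _ => False

/-- The program assigns to real variable `i`. -/
def Program.SetsReal (i : ℕ) : Program → Prop
  | .setReal j _ => i = j
  | .seq p q => p.SetsReal i ∨ q.SetsReal i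
  | .ite _ p q => p.SetsReal i ∨ q.SetsReal i
  | .loop _ p => p.SetsReal i
  | _ => False

/-- The program assigns to word array `a`. -/
def Program.StoresWord (a : ℕ) : Program → Prop
  | .storeWord c _ _ => a = c
  | .seq p q => p.StoresWord a ∨ q.StoresWord a
  | .ite _ p q => p.StoresWord a ∨ q.StoresWord a
  | .loop _ p => p.StoresWord a
  | _ => False

/-- The program assigns to real array `a`. -/
def Program.StoresReal (a : ℕ) : Program → Prop
  | .storeReal c _ _ => a = c
  | .seq p q => p.StoresReal a ∨ q.StoresReal a
  | .ite _ p q => p.StoresReal a ∨ q.StoresReal a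
  | .loop _ p => p.StoresReal a
  | _ => False

/-- The state `τ` differs from `σ` only where `p` assigns. -/
structure Frame (p : Program) (σ τ : State) : Prop where
  wordVar : ∀ i, ¬ p.SetsWord i → τ.wordVar i = σ.wordVar i
  realVar : ∀ i, ¬ p.SetsReal i → τ.realVar i = σ.realVar i
  wordArr : ∀ a, ¬ p.StoresWord a → τ.wordArr a = σ.wordArr a
  realArr : ∀ a, ¬ p.StoresReal a → τ.realArr a = σ.realArr a

/-- This lets the specifications of programs mention only what changes; everything else is carried
over by a syntactic check. -/
lemma Exec.frame {t : ℕ} (h : Exec w p σ τ t) : Frame p σ τ := by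
  induction h with
  | skip σ => exact ⟨fun _ _ => rfl, fun _ _ => rfl, fun _ _ => rfl, fun _ _ => rfl⟩
  | setWord i e σ =>
    refine ⟨fun j hj => ?_, fun _ _ => rfl, fun _ _ => rfl, fun _ _ => rfl⟩
    exact Function.update_of_ne hj _ _
  | setReal i e σ =>
    refine ⟨fun _ _ => rfl, fun j hj => ?_, fun _ _ => rfl, fun _ _ => rfl⟩
    exact Function.update_of_ne hj _ _
  | storeWord a j e σ =>
    refine ⟨fun _ _ => rfl, fun _ _ => rfl, fun c hc => ?_, fun _ _ => rfl⟩
    exact Function.update_of_ne hc _ _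
  | storeReal a j e σ =>
    refine ⟨fun _ _ => rfl, fun _ _ => rfl, fun _ _ => rfl, fun c hc => ?_⟩
    exact Function.update_of_ne hc _ _
  | seq _ _ ih ih' =>
    exact ⟨fun i hi => (ih'.1 i (not_or.1 hi).2).trans (ih.1 i (not_or.1 hi).1),
      fun i hi => (ih'.2 i (not_or.1 hi).2).trans (ih.2 i (not_or.1 hi).1),
      fun i hi => (ih'.3 i (not_or.1 hi).2).trans (ih.3 i (not_or.1 hi).1),
      fun i hi => (ih'.4 i (not_or.1 hi).2).trans (ih.4 i (not_or.1 hi).1)⟩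
  | iteTrue _ _ ih =>
    exact ⟨fun i hi => ih.1 i (not_or.1 hi).1, fun i hi => ih.2 i (not_or.1 hi).1,
      fun i hi => ih.3 i (not_or.1 hi).1, fun i hi => ih.4 i (not_or.1 hi).1⟩
  | iteFalse _ _ ih =>
    exact ⟨fun i hi => ih.1 i (not_or.1 hi).2, fun i hi => ih.2 i (not_or.1 hi).2,
      fun i hi => ih.3 i (not_or.1 hi).2, fun i hi => ih.4 i (not_or.1 hi).2⟩
  | loopDone _ => exact ⟨fun _ _ => rfl, fun _ _ => rfl, fun _ _ => rfl, fun _ _ => rfl⟩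
  | loopStep _ _ _ ih ih' =>
    exact ⟨fun i hi => (ih'.1 i hi).trans (ih.1 i hi), fun i hi => (ih'.2 i hi).trans (ih.2 i hi),
      fun i hi => (ih'.3 i hi).trans (ih.3 i hi), fun i hi => (ih'.4 i hi).trans (ih.4 i hi)⟩

lemma Run.frame (h : Run w p N σ Q) : Run w p N σ fun τ => Q τ ∧ Frame p σ τ := by
  obtain ⟨τ, t, he, ht, hQ⟩ := h
  exact ⟨τ, t, he, ht, hQ, he.frame⟩

end RealRAM


/-! ### Ranks in blocks -/

/-- `r` is a strict linear order on the numbers below `n`. -/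
structure StrictOrderBelow (n : ℕ) (r : ℕ → ℕ → Prop) : Prop where
  irrefl : ∀ i, ¬ r i i
  trans : ∀ i < n, ∀ j < n, ∀ k < n, r i j → r j k → r i k
  trichotomy : ∀ i < n, ∀ j < n, i ≠ j → r i j ∨ r j i

open Classical in
/-- The number of `k' < n` in block `g` (of size `h`) that precede `k`. -/
noncomputable def countBefore (n : ℕ) (r : ℕ → ℕ → Prop) (h g k : ℕ) : ℕ :=
  ((Finset.range n).filter fun k' => k' / h = g ∧ r k' k).card

/-- The rank of `k` in its block. -/
noncomputable def blockRank (n : ℕ) (r : ℕ → ℕ → Prop) (h k : ℕ) : ℕ :=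
  countBefore n r h (k / h) k

namespace StrictOrderBelow

variable {n h : ℕ} {r : ℕ → ℕ → Prop}

/-- With `countBefore_le`, this is the correctness of binary search: comparing `k` with the element
of a given rank in block `g` bounds the count from one side. -/
lemma countBefore_lt (hr : StrictOrderBelow n r) {g k k' : ℕ} (hk : k < n) (hk' : k' < n)
    (hg : k' / h = g) (hlt : r k' k) : blockRank n r h k' < countBefore n r h g k := by
  classical
  unfold blockRank countBefore
  refine Finset.card_lt_card (Finset.ssubset_iff_of_subset ?_ |>.2 ⟨k', ?_, ?_⟩)
  · intro a
    simp only [Finset.mem_filter, Finset.mem_range]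
    rintro ⟨h1, h2, h3⟩
    exact ⟨h1, h2.trans hg, hr.trans a h1 k' hk' k hk h3 hlt⟩
  · simp [hk', hg, hlt]
  · simp [hr.irrefl]

lemma countBefore_le (hr : StrictOrderBelow n r) {g k k' : ℕ} (hk : k < n) (hk' : k' < n)
    (hg : k' / h = g) (hlt : r k k') : countBefore n r h g k ≤ blockRank n r h k' := by
  classical
  unfold blockRank countBefore
  refine Finset.card_le_card ?_
  intro a
  simp only [Finset.mem_filter, Finset.mem_range]
  rintro ⟨h1, h2, h3⟩
  exact ⟨h1, h2.trans hg.symm, hr.trans a h1 k hk k' hk' h3 hlt⟩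

lemma blockRank_injOn (hr : StrictOrderBelow n r) {k k' : ℕ} (hk : k < n) (hk' : k' < n)
    (hg : k / h = k' / h) (he : blockRank n r h k = blockRank n r h k') : k = k' := by
  by_contra hne
  rcases hr.trichotomy k hk k' hk' hne with hlt | hlt
  · have := hr.countBefore_lt (h := h) hk' hk hg hlt
    exact absurd he this.ne
  · have := hr.countBefore_lt (h := h) hk hk' hg.symm hlt
    exact absurd he this.ne'

lemma card_block (hh : 0 < h) (g : ℕ) :
    ((Finset.range n).filter fun k' => k' / h = g).card = min (g * h + h) n - g * h := by
  rw [← Nat.card_Ico]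
  congr 1
  ext a
  simp only [Finset.mem_filter, Finset.mem_range, Finset.mem_Ico, lt_min_iff]
  rw [Nat.div_eq_iff hh]
  constructor
  · rintro ⟨h1, h2, h3⟩
    exact ⟨h2, by omega, h1⟩
  · rintro ⟨h1, h2, h3⟩
    exact ⟨h3, h1, by omega⟩

lemma countBefore_le_card (hh : 0 < h) (g k : ℕ) :
    countBefore n r h g k ≤ min (g * h + h) n - g * h := by
  classical
  rw [← card_block hh]
  unfold countBefore
  exact Finset.card_le_card fun a => by
    simp only [Finset.mem_filter]
    tauto

lemma blockRank_lt_card (hr : StrictOrderBelow n r) (hh : 0 < h) {k : ℕ} (hk : k < n) :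
    blockRank n r h k < min (k / h * h + h) n - k / h * h := by
  classical
  rw [← card_block hh]
  unfold blockRank countBefore
  refine Finset.card_lt_card (Finset.ssubset_iff_of_subset ?_ |>.2 ⟨k, ?_, ?_⟩)
  · intro a
    simp only [Finset.mem_filter]
    tauto
  · simp [hk]
  · simp [hr.irrefl]

/-- Ranks are injective on a block and range over as many values as the block has elements. -/
lemma exists_blockRank_eq (hr : StrictOrderBelow n r) (hh : 0 < h) {g m : ℕ}
    (hm : m < min (g * h + h) n - g * h) : ∃ k < n, k / h = g ∧ blockRank n r h k = m := by
  classical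
  have hsurj := Finset.surj_on_of_inj_on_of_card_le
    (s := (Finset.range n).filter fun k' => k' / h = g)
    (t := Finset.range (min (g * h + h) n - g * h)) (fun k _ => blockRank n r h k)
    (fun k hk => by
      simp only [Finset.mem_filter, Finset.mem_range] at hk ⊢
      have := hr.blockRank_lt_card hh hk.1
      rwa [hk.2] at this)
    (fun k k' hk hk' he => by
      simp only [Finset.mem_filter, Finset.mem_range] at hk hk'
      exact hr.blockRank_injOn hk.1 hk'.1 (hk.2.trans hk'.2.symm) he)
    (by rw [card_block hh, Finset.card_range]) m (by simpa using hm)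
  obtain ⟨k, hk, he⟩ := hsurj
  simp only [Finset.mem_filter, Finset.mem_range] at hk
  exact ⟨k, hk.1, hk.2, he.symm⟩

/-- The other half of the block of double size. -/
def sibling (g : ℕ) : ℕ := if g % 2 = 0 then g + 1 else g - 1

/-- The principle of the merge: the new rank is the rank in the own half plus the number of
predecessors in the other half. -/
lemma blockRank_double (k : ℕ) : blockRank n r (h + h) k =
    blockRank n r h k + countBefore n r h (sibling (k / h)) k := by
  classical
  have hd : ∀ a, a / (h + h) = a / h / 2 := fun a => by rw [Nat.div_div_eq_div_mul, mul_two]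
  unfold blockRank countBefore
  rw [← Finset.card_union_of_disjoint]
  · congr 1
    ext a
    simp only [Finset.mem_filter, Finset.mem_range, Finset.mem_union, hd]
    unfold sibling
    rw [← and_or_left, ← or_and_right]
    have : a / h / 2 = k / h / 2 ↔
        (a / h = k / h ∨ a / h = if k / h % 2 = 0 then k / h + 1 else k / h - 1) := by
      generalize a / h = u
      generalize k / h = v
      split_ifs <;> omega
    rw [this]
  · rw [Finset.disjoint_left]
    intro a
    simp only [Finset.mem_filter]
    rintro ⟨-, h1, -⟩ ⟨-, h2, -⟩
    unfold sibling at h2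
    rw [h1] at h2
    generalize k / h = v at h2
    split_ifs at h2 <;> omega

/-- The starts of the two halves add up to twice the start of the double block plus `h`, so the
other start is found without a case distinction. -/
lemma sibling_mul (k : ℕ) : sibling (k / h) * h =
    k / (h + h) * (h + h) + k / (h + h) * (h + h) + h - k / h * h := by
  have hd : k / (h + h) = k / h / 2 := by rw [Nat.div_div_eq_div_mul, mul_two]
  rw [hd]
  unfold sibling
  generalize k / h = g
  obtain ⟨G, hG | hG⟩ : ∃ G, g = 2 * G ∨ g = 2 * G + 1 := ⟨g / 2, by omega⟩
  · have h1 : g / 2 = G := by omega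
    rw [if_pos (by omega), h1, hG]
    apply Nat.eq_sub_of_add_eq
    ring
  · have h1 : g / 2 = G := by omega
    rw [if_neg (by omega), h1, hG]
    apply Nat.eq_sub_of_add_eq
    simp only [Nat.add_sub_cancel]
    ring

/-- Different indices get different places, so placing one never overwrites another. -/
lemma pos_injOn (hr : StrictOrderBelow n r) (hh : 0 < h) {k k' : ℕ} (hk : k < n) (hk' : k' < n)
    (he : k / h * h + blockRank n r h k = k' / h * h + blockRank n r h k') : k = k' := by
  have h1 := hr.blockRank_lt_card hh hk
  have h2 := hr.blockRank_lt_card hh hk'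
  have hg : k / h = k' / h := by
    have e1 : (k / h * h + blockRank n r h k) / h = k / h := by
      rw [Nat.div_eq_iff hh]; omega
    have e2 : (k' / h * h + blockRank n r h k') / h = k' / h := by
      rw [Nat.div_eq_iff hh]; omega
    rw [← e1, he, e2]
  rw [hg] at he
  exact hr.blockRank_injOn hk hk' hg (by omega)

lemma blockRank_one (hr : StrictOrderBelow n r) (k : ℕ) : blockRank n r 1 k = 0 := by
  classical
  unfold blockRank countBefore
  rw [Finset.card_eq_zero, Finset.filter_eq_empty_iff]
  intro a _
  simp only [Nat.div_one, not_and]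
  rintro rfl
  exact hr.irrefl _

end StrictOrderBelow

lemma NoConvComb.strictOrderBelow {n : ℕ} {p : ℕ → ℝ × ℝ} (hp : NoConvComb n p) :
    StrictOrderBelow n (AngLt p) where
  irrefl := NoConvComb.angLt_irrefl
  trans _ hi _ hj _ hk := hp.angLt_trans hi hj hk
  trichotomy _ hi _ hj hij := hp.angLt_or hi hj hij

/-- The inverse of the ranks sorts. -/
lemma Sorts.of_blockRank {n h : ℕ} {p : ℕ → ℝ × ℝ} (hp : NoConvComb n p) (hn : n ≤ h) {σ : ℕ → ℕ}
    (hσ : ∀ k < n, σ (k / h * h + blockRank n (AngLt p) h k) = k) : Sorts n p σ := by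
  have hr := hp.strictOrderBelow
  have h0 : ∀ k < n, k / h = 0 := fun k hk => Nat.div_eq_of_lt (by omega)
  have hσ' : ∀ k < n, σ (blockRank n (AngLt p) h k) = k := fun k hk => by
    have := hσ k hk
    rwa [h0 k hk, zero_mul, zero_add] at this
  have hex : ∀ a < n, ∃ k < n, blockRank n (AngLt p) h k = a := fun a ha => by
    obtain ⟨k, hk, -, h⟩ := hr.exists_blockRank_eq (h := h) (by omega) (g := 0) (m := a)
      (by simp; omega)
    exact ⟨k, hk, h⟩
  refine ⟨fun a ha => ?_, fun a b hab hb => ?_, fun k hk => ?_⟩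
  · obtain ⟨k, hk, rfl⟩ := hex a ha
    rw [hσ' k hk]; exact hk
  · obtain ⟨k, hk, rfl⟩ := hex a (by omega)
    obtain ⟨l, hl, rfl⟩ := hex b hb
    rw [hσ' k hk, hσ' l hl]
    by_contra hc
    have hne : k ≠ l := by rintro rfl; exact lt_irrefl _ hab
    have := (hr.trichotomy k hk l hl hne).resolve_left hc
    have := hr.countBefore_lt (h := h) hk hl ((h0 l hl).trans (h0 k hk).symm) this
    exact absurd hab (not_lt.2 this.le)
  · refine ⟨blockRank n (AngLt p) h k, ?_, hσ' k hk⟩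
    have := hr.blockRank_lt_card (h := h) (by omega) hk
    rw [h0 k hk] at this
    omega


/-! ### Sorting -/

namespace RealRAM

notation "𝕧" => WExp.var
notation "𝕔" => WExp.const

/-- The real arrays `0` and `1` hold the points `p 0, …, p (n - 1)`. -/
def HasCoords (n : ℕ) (p : ℕ → ℝ × ℝ) (σ : State) : Prop :=
  ∀ k < n, σ.realArr 0 k = (p k).1 ∧ σ.realArr 1 k = (p k).2

/-- The test `AngLt` for the points with indices `i` and `j`. -/
def angTest (i j : WExp) : Test :=
  (Test.wordLt (𝕔 0) j).and ((Test.wordLt i (𝕔 1)).or (.realLt (.ofWord (𝕔 0))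
    ((.load 0 i - .load 0 (𝕔 0)) * (.load 1 j - .load 1 (𝕔 0)) -
      (.load 1 i - .load 1 (𝕔 0)) * (.load 0 j - .load 0 (𝕔 0)))))

/-- Binary search in a sorted block. -/
def searchLoop : Program :=
  .loop (.wordLt (𝕧 5) (𝕧 6)) (
    .setWord 7 ((𝕧 5 + 𝕧 6) / 𝕔 2) ;;
    .ite (angTest (.load 2 (𝕧 4 + 𝕧 7)) (𝕧 2)) (.setWord 5 (𝕧 7 + 𝕔 1)) (.setWord 6 (𝕧 7)))

/-- Locating the other half of the block of double size. -/
def siblingProgram : Program :=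
  .setWord 3 (𝕧 2 / (𝕧 1 + 𝕧 1) * (𝕧 1 + 𝕧 1)) ;;
  .setWord 4 (𝕧 3 + 𝕧 3 + 𝕧 1 - 𝕧 2 / 𝕧 1 * 𝕧 1) ;;
  .setWord 5 (𝕔 0) ;;
  .ite (.wordLt (𝕧 4 + 𝕧 1) (𝕧 0)) (.setWord 6 (𝕧 1)) (.setWord 6 (𝕧 0 - 𝕧 4))

/-- Updating the rank. -/
def addRankProgram : Program :=
  .storeWord 1 (𝕧 2) (.load 1 (𝕧 2) + 𝕧 5) ;;
  .setWord 2 (𝕧 2 + 𝕔 1)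

/-- The ranks in the blocks of double size. -/
def rankLoop : Program :=
  .loop (.wordLt (𝕧 2) (𝕧 0)) (siblingProgram ;; searchLoop ;; addRankProgram)

/-- Moving the indices to their ranks. -/
def placeLoop : Program :=
  .loop (.wordLt (𝕧 2) (𝕧 0)) (
    .storeWord 2 (𝕧 2 / 𝕧 1 * 𝕧 1 + .load 1 (𝕧 2)) (𝕧 2) ;;
    .setWord 2 (𝕧 2 + 𝕔 1))

/-- Doubling the size of the blocks. -/
def doubleProgram : Program := .setWord 1 (𝕧 1 + 𝕧 1) ;; .setWord 2 (𝕔 0)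

/-- Merging pairs of blocks until there is one block. -/
def mergeLoop : Program :=
  .loop (.wordLt (𝕧 1) (𝕧 0)) (.setWord 2 (𝕔 0) ;; rankLoop ;; doubleProgram ;; placeLoop)

/-- Blocks of size one. -/
def initProgram : Program := .setWord 1 (𝕔 1) ;; .setWord 2 (𝕔 0)

/-- Sorting the indices of the points in angular order, into word array `2`. -/
def sortProgram : Program := initProgram ;; placeLoop ;; mergeLoop

variable {n w : ℕ} {p : ℕ → ℝ × ℝ}

lemma angTest_holds (hM : 16 * n + 16 ≤ 2 ^ w) {σ : State} (hc : HasCoords n p σ) {i j : WExp}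
    (hi : i.eval w σ < n) (hj : j.eval w σ < n) :
    (angTest i j).Holds w σ ↔ AngLt p (i.eval w σ) (j.eval w σ) := by
  have h0 : 0 % 2 ^ w = 0 := Nat.zero_mod _
  have h1 : 1 % 2 ^ w = 1 := Nat.mod_eq_of_lt (by omega)
  simp only [angTest, Test.holds_and, Test.holds_wordLt, WExp.eval_const, h0, Test.holds_or, h1,
    Test.holds_realLt, RExp.eval_ofWord, RExp.eval_sub, RExp.eval_mul, RExp.eval_load,
    (hc _ hi).1, (hc _ hi).2, (hc _ hj).1, (hc _ hj).2, (hc 0 (by omega)).1,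
    (hc 0 (by omega)).2, AngLt, cr, Prod.fst_sub, Prod.snd_sub, Nat.cast_zero, Nat.lt_one_iff,
    Nat.pos_iff_ne_zero]

lemma searchLoop_run (hM : 16 * n + 16 ≤ 2 ^ w) (hp : NoConvComb n p)
    {σ : State} {h g k : ℕ} (hc : HasCoords n p σ) (hh : 0 < h) (hk : k < n) (hkg : k / h ≠ g)
    (h2 : σ.wordVar 2 = k) (h4 : σ.wordVar 4 = g * h) (h5 : σ.wordVar 5 = 0)
    (h6 : σ.wordVar 6 = min (g * h + h) n - g * h)
    (hW : ∀ k' < n, σ.wordArr 2 (k' / h * h + blockRank n (AngLt p) h k') = k') :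
    Run w searchLoop (searchLoop.iterTime * (Nat.size n + 1)) σ
      (fun τ => τ.wordVar 5 = countBefore n (AngLt p) h g k) := by
  have hr := hp.strictOrderBelow
  set cnt := countBefore n (AngLt p) h g k
  set len := min (g * h + h) n - g * h with hlen
  refine Run.while (fun (a : ℕ × ℕ) τ => τ.wordVar 2 = k ∧ τ.wordVar 4 = g * h ∧
      τ.wordVar 5 = a.1 ∧ τ.wordVar 6 = a.2 ∧ τ.wordArr = σ.wordArr ∧ τ.realArr = σ.realArr ∧
      a.1 ≤ cnt ∧ cnt ≤ a.2 ∧ a.2 ≤ len)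
    (fun a => Nat.size (a.2 - a.1)) (0, len) ?_ ?_ ?_ ?_ ?_
  · exact ⟨h2, h4, h5, h6, rfl, rfl, Nat.zero_le _, StrictOrderBelow.countBefore_le_card hh g k,
      le_rfl⟩
  · refine Nat.mul_le_mul_left _ (Nat.succ_le_succ (Nat.size_le_size ?_))
    simp only
    omega
  · simp [Program.LoopFree]
  · rintro ⟨lo, hi⟩ τ ⟨e2, e4, e5, e6, e7, e8, i1, i2, i3⟩ hb
    simp only [Test.holds_wordLt, WExp.eval_var, e5, e6] at hb
    simp only at i1 i2
    omega
  · rintro ⟨lo, hi⟩ τ ⟨e2, e4, e5, e6, e7, e8, i1, i2, i3⟩ hb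
    simp only [Test.holds_wordLt, WExp.eval_var, e5, e6] at hb
    simp only at i1 i2 i3
    -- Halving the interval shortens the binary length of its size, which counts the iterations.
    have hsize : ∀ m, m ≤ (hi - lo) / 2 → Nat.size m < Nat.size (hi - lo) := by
      intro m hm
      have hs : hi - lo < 2 ^ Nat.size (hi - lo) := Nat.lt_size_self _
      have hs0 : 0 < Nat.size (hi - lo) := Nat.size_pos.2 (by omega)
      obtain ⟨s, hs'⟩ : ∃ s, Nat.size (hi - lo) = s + 1 := ⟨_, (Nat.sub_add_cancel hs0).symm⟩
      rw [hs'] at hs ⊢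
      rw [pow_succ] at hs
      exact Nat.lt_succ_of_le (Nat.size_le.2 (by omega))
    have hmid : (lo + hi) / 2 < len := by omega
    have hbd : g * h + len ≤ n := by omega
    have c2 : 2 % 2 ^ w = 2 := Nat.mod_eq_of_lt (by omega)
    have c1 : 1 % 2 ^ w = 1 := Nat.mod_eq_of_lt (by omega)
    have m1 : (lo + hi) % 2 ^ w = lo + hi := Nat.mod_eq_of_lt (by omega)
    have m2 : (lo + hi) / 2 % 2 ^ w = (lo + hi) / 2 := Nat.mod_eq_of_lt (by omega)
    have m3 : (g * h + (lo + hi) / 2) % 2 ^ w = g * h + (lo + hi) / 2 :=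
      Nat.mod_eq_of_lt (by omega)
    have m4 : ((lo + hi) / 2 + 1) % 2 ^ w = (lo + hi) / 2 + 1 := Nat.mod_eq_of_lt (by omega)
    obtain ⟨k', hk', hg', hrk⟩ := hr.exists_blockRank_eq hh hmid
    have hWk := hW k' hk'
    rw [hg', hrk] at hWk
    set τ' := τ.setWord 7 ((lo + hi) / 2) with hτ'
    have hev : (Program.setWord 7 ((𝕧 5 + 𝕧 6) / 𝕔 2)).eval w τ = τ' := by
      simp [e5, e6, c2, m1, m2, hτ']
    have ev1 : (WExp.load 2 (𝕧 4 + 𝕧 7)).eval w τ' = k' := by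
      simp [hτ', e4, m3, e7, hWk]
    have ev2 : (𝕧 2).eval w τ' = k := by simp [hτ', e2]
    have hT := angTest_holds (p := p) hM (σ := τ') (i := .load 2 (𝕧 4 + 𝕧 7)) (j := 𝕧 2)
      (by intro a ha; simpa [hτ', e8] using hc a ha) (by rw [ev1]; exact hk') (by rw [ev2]; exact hk)
    rw [ev1, ev2] at hT
    have hne : k' ≠ k := by rintro rfl; exact hkg hg'
    rw [Program.eval_seq, hev]
    by_cases hlt : AngLt p k' k
    · refine ⟨((lo + hi) / 2 + 1, hi), ?_, hsize _ (by simp only; omega)⟩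
      have := hr.countBefore_lt hk hk' hg' hlt
      rw [Program.eval_ite_pos (hT.2 hlt)]
      exact ⟨by simp [hτ', e2], by simp [hτ', e4], by simp [hτ', c1, m4], by simp [hτ', e6],
        by simp [hτ', e7], by simp [hτ', e8], by simp only; omega, i2, i3⟩
    · refine ⟨(lo, (lo + hi) / 2), ?_, hsize _ (by simp only; omega)⟩
      have := hr.countBefore_le hk hk' hg' ((hr.trichotomy k hk k' hk' hne.symm).resolve_right hlt)
      rw [Program.eval_ite_neg (mt hT.1 hlt)]
      exact ⟨by simp [hτ', e2], by simp [hτ', e4], by simp [hτ', e5], by simp [hτ'],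
        by simp [hτ', e7], by simp [hτ', e8], i1, by simp only; omega, by simp only; omega⟩

lemma siblingProgram_run (hM : 16 * n + 16 ≤ 2 ^ w) {σ : State} {h k : ℕ} (hh : h < n)
    (hk : k < n) (h0 : σ.wordVar 0 = n) (h1 : σ.wordVar 1 = h) (h2 : σ.wordVar 2 = k) :
    Run w siblingProgram siblingProgram.time σ fun τ =>
      τ.wordVar 4 = StrictOrderBelow.sibling (k / h) * h ∧ τ.wordVar 5 = 0 ∧
      τ.wordVar 6 = min (StrictOrderBelow.sibling (k / h) * h + h) n -
        StrictOrderBelow.sibling (k / h) * h := by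
  refine Run.of_eval (by simp [siblingProgram, Program.LoopFree]) le_rfl ?_
  rw [StrictOrderBelow.sibling_mul]
  have b1 : k / (h + h) * (h + h) ≤ k := Nat.div_mul_le_self _ _
  have b2 : k / h * h ≤ k := Nat.div_mul_le_self _ _
  have b3 : k / (h + h) ≤ k := Nat.div_le_self _ _
  have b4 : k / h ≤ k := Nat.div_le_self _ _
  have e3 : ((𝕧 2 / (𝕧 1 + 𝕧 1) * (𝕧 1 + 𝕧 1)) : WExp).eval w σ = k / (h + h) * (h + h) := by
    simp only [WExp.eval_mul, WExp.eval_div, WExp.eval_var, WExp.eval_add, h1, h2]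
    rw [Nat.mod_eq_of_lt (a := h + h) (by omega), Nat.mod_eq_of_lt (a := k / (h + h)) (by omega),
      Nat.mod_eq_of_lt (by omega)]
  set base := k / (h + h) * (h + h)
  have e4 : ((𝕧 3 + 𝕧 3 + 𝕧 1 - 𝕧 2 / 𝕧 1 * 𝕧 1) : WExp).eval w (σ.setWord 3 base) =
      base + base + h - k / h * h := by
    have v1 : (σ.setWord 3 base).wordVar 1 = h := by simp [h1]
    have v2 : (σ.setWord 3 base).wordVar 2 = k := by simp [h2]
    have v3 : (σ.setWord 3 base).wordVar 3 = base := by simp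
    simp only [WExp.eval_mul, WExp.eval_div, WExp.eval_var, WExp.eval_add, WExp.eval_sub,
      v1, v2, v3]
    rw [Nat.mod_eq_of_lt (a := base + base) (by omega), Nat.mod_eq_of_lt (a := k / h) (by omega),
      Nat.mod_eq_of_lt (a := k / h * h) (by omega),
      Nat.mod_eq_of_lt (a := base + base + h) (by omega), Nat.mod_eq_of_lt (by omega)]
  set s := base + base + h - k / h * h with hs
  -- The other half may start beyond `n`. The bound excludes overflow, and truncated subtraction
  -- then makes its length zero.
  have hsn : s ≤ 3 * n := by omega
  have c0 : 0 % 2 ^ w = 0 := Nat.zero_mod _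
  have c1 : (s + h) % 2 ^ w = s + h := Nat.mod_eq_of_lt (by omega)
  have c2 : (n - s) % 2 ^ w = n - s := Nat.mod_eq_of_lt (by omega)
  unfold siblingProgram
  rw [Program.eval_seq, Program.eval_setWord, e3, Program.eval_seq, Program.eval_setWord, e4,
    Program.eval_seq]
  by_cases hlt : s + h < n
  · rw [Program.eval_ite_pos (by simp [h0, h1, c1, hlt])]
    simp [h1, c0]
    omega
  · rw [Program.eval_ite_neg (by simpa [h0, h1, c1] using hlt)]
    simp [h0, c0, c2]
    omega

/-- The ranks in word array `1` are updated in place; this is harmless because the searches read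
only the old order in word array `2`. -/
lemma rankLoop_run (hM : 16 * n + 16 ≤ 2 ^ w) (hp : NoConvComb n p) {σ : State} {h : ℕ}
    (hc : HasCoords n p σ) (hh : 0 < h) (hhn : h < n)
    (h0 : σ.wordVar 0 = n) (h1 : σ.wordVar 1 = h) (h2 : σ.wordVar 2 = 0)
    (hR : ∀ k < n, σ.wordArr 1 k = blockRank n (AngLt p) h k)
    (hW : ∀ k < n, σ.wordArr 2 (k / h * h + blockRank n (AngLt p) h k) = k) :
    Run w rankLoop ((siblingProgram.time + searchLoop.iterTime * (Nat.size n + 1) +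
      addRankProgram.time + (Test.wordLt (𝕧 2) (𝕧 0)).steps) * (n + 1)) σ fun τ =>
      ∀ k < n, τ.wordArr 1 k = blockRank n (AngLt p) (h + h) k := by
  have hr := hp.strictOrderBelow
  refine Run.for (fun k τ => τ.wordVar 0 = n ∧ τ.wordVar 1 = h ∧ τ.wordVar 2 = k ∧ k ≤ n ∧
    τ.wordArr 2 = σ.wordArr 2 ∧ τ.realArr = σ.realArr ∧
    ∀ k' < n, τ.wordArr 1 k' = blockRank n (AngLt p) (if k' < k then h + h else h) k')
    (fun k => n - k) (siblingProgram.time + searchLoop.iterTime * (Nat.size n + 1) +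
      addRankProgram.time) 0 ?_ ?_ ?_ ?_
  · exact ⟨h0, h1, h2, Nat.zero_le _, rfl, rfl, by simpa using hR⟩
  · exact le_rfl
  · rintro k τ ⟨e0, e1, e2, i1, e3, e4, hA⟩ hb
    simp only [Test.holds_wordLt, WExp.eval_var, e0, e2] at hb
    intro k' hk'
    rw [hA k' hk', if_pos (by omega)]
  · rintro k τ ⟨e0, e1, e2, i1, e3, e4, hA⟩ hb
    simp only [Test.holds_wordLt, WExp.eval_var, e0, e2] at hb
    rw [add_assoc]
    refine (siblingProgram_run hM hhn hb e0 e1 e2).frame.seq (M := _) ?_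
    rintro τ1 ⟨⟨f4, f5, f6⟩, fr⟩
    have w2 : τ1.wordVar 2 = k := (fr.wordVar 2 (by simp [siblingProgram, Program.SetsWord])).trans e2
    have w0 : τ1.wordVar 0 = n := (fr.wordVar 0 (by simp [siblingProgram, Program.SetsWord])).trans e0
    have w1 : τ1.wordVar 1 = h := (fr.wordVar 1 (by simp [siblingProgram, Program.SetsWord])).trans e1
    have wA : ∀ a, τ1.wordArr a = τ.wordArr a := fun a =>
      fr.wordArr a (by simp [siblingProgram, Program.StoresWord])
    have rA : τ1.realArr = σ.realArr := by
      rw [← e4]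
      ext1 a
      exact fr.realArr a (by simp [siblingProgram, Program.StoresReal])
    refine (searchLoop_run hM hp (σ := τ1) (g := StrictOrderBelow.sibling (k / h)) (k := k)
      (by intro a ha; rw [rA]; exact hc a ha) hh hb ?_ w2 f4 f5 f6 ?_).frame.seq ?_
    · unfold StrictOrderBelow.sibling
      generalize k / h = g
      split_ifs <;> omega
    · rw [wA, e3]; exact hW
    rintro τ2 ⟨g5, fr2⟩
    have v2 : τ2.wordVar 2 = k :=
      (fr2.wordVar 2 (by simp [searchLoop, Program.SetsWord])).trans w2
    have v0 : τ2.wordVar 0 = n :=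
      (fr2.wordVar 0 (by simp [searchLoop, Program.SetsWord])).trans w0
    have v1 : τ2.wordVar 1 = h :=
      (fr2.wordVar 1 (by simp [searchLoop, Program.SetsWord])).trans w1
    have vA : ∀ a, τ2.wordArr a = τ.wordArr a := fun a =>
      (fr2.wordArr a (by simp [searchLoop, Program.StoresWord])).trans (wA a)
    have vR : τ2.realArr = σ.realArr := by
      rw [← rA]
      ext1 a
      exact fr2.realArr a (by simp [searchLoop, Program.StoresReal])
    refine Run.of_eval (by simp [addRankProgram, Program.LoopFree]) le_rfl ⟨k + 1, ?_, by omega⟩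
    have hd := StrictOrderBelow.blockRank_double (n := n) (h := h) (r := AngLt p) k
    have hlt := hr.blockRank_lt_card (h := h + h) (by omega) hb
    have m1 : 1 % 2 ^ w = 1 := Nat.mod_eq_of_lt (by omega)
    have m2 : (k + 1) % 2 ^ w = k + 1 := Nat.mod_eq_of_lt (by omega)
    have hAk := hA k hb
    rw [if_neg (lt_irrefl _)] at hAk
    have m3 : (blockRank n (AngLt p) h k + countBefore n (AngLt p) h
        (StrictOrderBelow.sibling (k / h)) k) % 2 ^ w = blockRank n (AngLt p) (h + h) k := by
      rw [← hd]
      exact Nat.mod_eq_of_lt (by omega)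
    simp only [addRankProgram, Program.eval_seq, Program.eval_storeWord, Program.eval_setWord,
      WExp.eval_var, WExp.eval_add, WExp.eval_load, WExp.eval_const, v2, g5, vA, hAk, m1, m3]
    refine ⟨by simp [v0], by simp [v1], by simp [v2, m2], hb, ?_, by simp [vR], ?_⟩
    · ext1 j
      simp [vA, e3]
    · intro k' hk'
      by_cases hkk : k' = k
      · subst hkk; simp
      · have : k' < k + 1 ↔ k' < k := by omega
        simp [hkk, vA, hA k' hk', this]

lemma placeLoop_run (hM : 16 * n + 16 ≤ 2 ^ w) (hp : NoConvComb n p) {σ : State} {h : ℕ}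
    (hh : 0 < h) (h0 : σ.wordVar 0 = n) (h1 : σ.wordVar 1 = h) (h2 : σ.wordVar 2 = 0)
    (hR : ∀ k < n, σ.wordArr 1 k = blockRank n (AngLt p) h k) :
    Run w placeLoop (placeLoop.iterTime * (n + 1)) σ fun τ =>
      ∀ k < n, τ.wordArr 2 (k / h * h + blockRank n (AngLt p) h k) = k := by
  have hr := hp.strictOrderBelow
  refine Run.while (fun k τ => τ.wordVar 0 = n ∧ τ.wordVar 1 = h ∧ τ.wordVar 2 = k ∧ k ≤ n ∧
    τ.wordArr 1 = σ.wordArr 1 ∧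
    ∀ k' < k, τ.wordArr 2 (k' / h * h + blockRank n (AngLt p) h k') = k')
    (fun k => n - k) 0 ?_ ?_ ?_ ?_ ?_
  · exact ⟨h0, h1, h2, Nat.zero_le _, rfl, by simp⟩
  · exact le_rfl
  · simp [Program.LoopFree]
  · rintro k τ ⟨e0, e1, e2, i1, e3, hA⟩ hb
    simp only [Test.holds_wordLt, WExp.eval_var, e0, e2] at hb
    exact fun k' hk' => hA k' (by omega)
  · rintro k τ ⟨e0, e1, e2, i1, e3, hA⟩ hb
    simp only [Test.holds_wordLt, WExp.eval_var, e0, e2] at hb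
    refine ⟨k + 1, ?_, by omega⟩
    have hlt := hr.blockRank_lt_card hh hb
    have b2 : k / h * h ≤ k := Nat.div_mul_le_self _ _
    have b4 : k / h ≤ k := Nat.div_le_self _ _
    have m1 : 1 % 2 ^ w = 1 := Nat.mod_eq_of_lt (by omega)
    have m2 : (k + 1) % 2 ^ w = k + 1 := Nat.mod_eq_of_lt (by omega)
    have m3 : k / h % 2 ^ w = k / h := Nat.mod_eq_of_lt (by omega)
    have m4 : k / h * h % 2 ^ w = k / h * h := Nat.mod_eq_of_lt (by omega)
    have m5 : (k / h * h + blockRank n (AngLt p) h k) % 2 ^ w =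
      k / h * h + blockRank n (AngLt p) h k := Nat.mod_eq_of_lt (by omega)
    simp only [Program.eval_seq, Program.eval_storeWord, Program.eval_setWord,
      WExp.eval_var, WExp.eval_add, WExp.eval_load, WExp.eval_const, WExp.eval_mul, WExp.eval_div,
      State.storeWord_wordVar, e1, e2, e3, hR k hb, m1, m2, m3, m4, m5]
    refine ⟨by simp [e0], by simp [e1], by simp, hb, ?_, ?_⟩
    · ext1 j
      simp [e3]
    · intro k' hk'
      by_cases hkk : k' = k
      · subst hkk; simp
      · have : ¬ (k' / h * h + blockRank n (AngLt p) h k' =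
            k / h * h + blockRank n (AngLt p) h k) := fun he =>
          hkk (hr.pos_injOn hh (by omega) hb he)
        simp [this, hA k' (by omega)]

/-- A bound for the steps of one merge, divided by `(n + 1) * (Nat.size n + 1)`. -/
def mergeTime : ℕ :=
  (Program.setWord 2 (𝕔 0)).time + (siblingProgram.time + searchLoop.iterTime +
    addRankProgram.time + (Test.wordLt (𝕧 2) (𝕧 0)).steps) + doubleProgram.time +
    placeLoop.iterTime + (Test.wordLt (𝕧 1) (𝕧 0)).steps

/-- After `a` rounds the blocks have size `2 ^ a`, and `n < 2 ^ Nat.size n` bounds the number of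
rounds. -/
lemma mergeLoop_run (hM : 16 * n + 16 ≤ 2 ^ w) (hp : NoConvComb n p) {σ : State}
    (hn : 0 < n) (hc : HasCoords n p σ) (h0 : σ.wordVar 0 = n) (h1 : σ.wordVar 1 = 1)
    (hR : ∀ k < n, σ.wordArr 1 k = blockRank n (AngLt p) 1 k)
    (hW : ∀ k < n, σ.wordArr 2 (k / 1 * 1 + blockRank n (AngLt p) 1 k) = k) :
    Run w mergeLoop (mergeTime * ((n + 1) * (Nat.size n + 1)) * (Nat.size n + 1)) σ fun τ =>
      Sorts n p (τ.wordArr 2) := by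
  set S := Nat.size n with hS
  have hnS : n < 2 ^ S := Nat.lt_size_self n
  refine Run.for (fun a τ => τ.wordVar 0 = n ∧ τ.wordVar 1 = 2 ^ a ∧ HasCoords n p τ ∧
    (∀ k < n, τ.wordArr 1 k = blockRank n (AngLt p) (2 ^ a) k) ∧
    (∀ k < n, τ.wordArr 2 (k / 2 ^ a * 2 ^ a + blockRank n (AngLt p) (2 ^ a) k) = k))
    (fun a => S - a) ((Program.setWord 2 (𝕔 0)).time + ((siblingProgram.time +
      searchLoop.iterTime * (S + 1) + addRankProgram.time +
      (Test.wordLt (𝕧 2) (𝕧 0)).steps) * (n + 1) + (doubleProgram.time +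
      placeLoop.iterTime * (n + 1)))) 0 ?_ ?_ ?_ ?_
  · exact ⟨h0, by simpa using h1, hc, by simpa using hR, by simpa using hW⟩
  · refine Nat.mul_le_mul_right _ ?_
    have hA : 1 ≤ n + 1 := by omega
    have hB : 1 ≤ S + 1 := by omega
    unfold mergeTime
    generalize (Program.setWord 2 (𝕔 0)).time = c1
    generalize siblingProgram.time = c2
    generalize searchLoop.iterTime = c3
    generalize addRankProgram.time = c4
    generalize (Test.wordLt (𝕧 2) (𝕧 0)).steps = c5
    generalize doubleProgram.time = c6
    generalize placeLoop.iterTime = c7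
    generalize (Test.wordLt (𝕧 1) (𝕧 0)).steps = c8
    generalize n + 1 = A at *
    generalize S + 1 = B at *
    have hAB : 1 ≤ A * B := Nat.mul_pos hA hB
    have hAAB : A ≤ A * B := Nat.le_mul_of_pos_right _ hB
    calc c1 + ((c2 + c3 * B + c4 + c5) * A + (c6 + c7 * A)) + c8
        = (c1 + c6 + c8) * 1 + (c2 + c4 + c5 + c7) * A + c3 * (A * B) := by ring
      _ ≤ (c1 + c6 + c8) * (A * B) + (c2 + c4 + c5 + c7) * (A * B) + c3 * (A * B) := by gcongr
      _ = _ := by ring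
  · rintro a τ ⟨e0, e1, hcτ, hA, hB⟩ hb
    simp only [Test.holds_wordLt, WExp.eval_var, e0, e1, not_lt] at hb
    exact Sorts.of_blockRank hp hb hB
  · rintro a τ ⟨e0, e1, hcτ, hA, hB⟩ hb
    simp only [Test.holds_wordLt, WExp.eval_var, e0, e1] at hb
    have haS : a < S := by
      by_contra hcon
      exact absurd (Nat.pow_le_pow_right (n := 2) (by norm_num) (not_lt.1 hcon)) (by omega)
    have c0 : 0 % 2 ^ w = 0 := Nat.zero_mod _
    have hpos : 0 < 2 ^ a := by positivity
    refine Run.seq (R := fun τ' => τ' = τ.setWord 2 0)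
      (Run.of_eval trivial le_rfl (by simp [c0])) ?_
    rintro _ rfl
    refine (rankLoop_run hM hp (σ := τ.setWord 2 0) (h := 2 ^ a) (fun k hk => by
      simpa using hcτ k hk) hpos hb (by simp [e0]) (by simp [e1]) (by simp)
      (by simpa using hA) (by simpa using hB)).frame.seq ?_
    rintro τ1 ⟨hA1, fr⟩
    have w0 : τ1.wordVar 0 = n := by
      rw [fr.wordVar 0 (by simp [rankLoop, siblingProgram, searchLoop, addRankProgram,
        Program.SetsWord])]
      simp [e0]
    have w1 : τ1.wordVar 1 = 2 ^ a := by
      rw [fr.wordVar 1 (by simp [rankLoop, siblingProgram, searchLoop, addRankProgram,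
        Program.SetsWord])]
      simp [e1]
    have wR : τ1.realArr = τ.realArr := by
      ext1 c
      rw [fr.realArr c (by simp [rankLoop, siblingProgram, searchLoop, addRankProgram,
        Program.StoresReal])]
      simp
    have m1 : (2 ^ a + 2 ^ a) % 2 ^ w = 2 ^ (a + 1) := by
      rw [Nat.mod_eq_of_lt (by omega), pow_succ]
      omega
    refine Run.seq (R := fun τ' => τ' = (τ1.setWord 1 (2 ^ (a + 1))).setWord 2 0)
      (Run.of_eval (by simp [doubleProgram, Program.LoopFree]) le_rfl (by
        simp [doubleProgram, w1, m1, c0])) ?_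
    rintro _ rfl
    have hdbl : 2 ^ (a + 1) = 2 ^ a + 2 ^ a := by rw [pow_succ]; omega
    have hA2 : ∀ k < n, ((τ1.setWord 1 (2 ^ (a + 1))).setWord 2 0).wordArr 1 k =
        blockRank n (AngLt p) (2 ^ (a + 1)) k := by
      intro k hk
      rw [hdbl]
      simpa using hA1 k hk
    refine (placeLoop_run hM hp (h := 2 ^ (a + 1)) (by positivity) (by simp [w0]) (by simp)
      (by simp) hA2).frame.mono le_rfl ?_
    rintro τ2 ⟨hB2, fr2⟩
    refine ⟨a + 1, ⟨?_, ?_, ?_, ?_, hB2⟩, by omega⟩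
    · rw [fr2.wordVar 0 (by simp [placeLoop, Program.SetsWord])]
      simp [w0]
    · rw [fr2.wordVar 1 (by simp [placeLoop, Program.SetsWord])]
      simp
    · intro k hk
      rw [fr2.realArr 0 (by simp [placeLoop, Program.StoresReal]),
        fr2.realArr 1 (by simp [placeLoop, Program.StoresReal])]
      simpa [wR] using hcτ k hk
    · rw [fr2.wordArr 1 (by simp [placeLoop, Program.StoresWord])]
      exact hA2

/-- A bound for the steps of sorting. -/
def sortTime (n : ℕ) : ℕ :=
  initProgram.time + (placeLoop.iterTime * (n + 1) +
    mergeTime * ((n + 1) * (Nat.size n + 1)) * (Nat.size n + 1))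

/-- The zeros of the initial memory are the correct ranks in blocks of size one. -/
lemma sortProgram_run (hM : 16 * n + 16 ≤ 2 ^ w) (hp : NoConvComb n p) {σ : State}
    (hn : 0 < n) (hc : HasCoords n p σ) (h0 : σ.wordVar 0 = n) (h1 : ∀ k, σ.wordArr 1 k = 0) :
    Run w sortProgram (sortTime n) σ fun τ => Sorts n p (τ.wordArr 2) := by
  have c0 : 0 % 2 ^ w = 0 := Nat.zero_mod _
  have c1 : 1 % 2 ^ w = 1 := Nat.mod_eq_of_lt (by omega)
  refine Run.seq (R := fun τ' => τ' = (σ.setWord 1 1).setWord 2 0)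
    (Run.of_eval (by simp [initProgram, Program.LoopFree]) le_rfl (by
      simp [initProgram, c0, c1])) ?_
  rintro _ rfl
  have hA : ∀ k < n, ((σ.setWord 1 1).setWord 2 0).wordArr 1 k =
      blockRank n (AngLt p) 1 k := by
    intro k hk
    rw [hp.strictOrderBelow.blockRank_one]
    simpa using h1 k
  refine (placeLoop_run hM hp (h := 1) one_pos (by simp [h0]) (by simp) (by simp)
    hA).frame.seq ?_
  rintro τ ⟨hB, fr⟩
  refine mergeLoop_run hM hp hn ?_ ?_ ?_ ?_ hB
  · intro k hk
    rw [fr.realArr 0 (by simp [placeLoop, Program.StoresReal]),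
      fr.realArr 1 (by simp [placeLoop, Program.StoresReal])]
    simpa using hc k hk
  · rw [fr.wordVar 0 (by simp [placeLoop, Program.SetsWord])]
    simp [h0]
  · rw [fr.wordVar 1 (by simp [placeLoop, Program.SetsWord])]
    simp
  · rw [fr.wordArr 1 (by simp [placeLoop, Program.StoresWord])]
    exact hA

end RealRAM


/-! ### Stops and jumps -/

lemma sortedSeq_neg (n : ℕ) (p : ℕ → ℝ × ℝ) (σ : ℕ → ℕ) {k : ℕ} (hk : k ≤ 4 * n) :
    sortedSeq n p σ (-(k : ℤ)) = p (σ ((4 * n - k) % n)) := by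
  rw [← sortedSeq_natCast n p σ (4 * n - k), sortedSeq, sortedSeq]
  congr 3
  rw [Nat.cast_sub hk, Nat.cast_mul, show ((4 : ℕ) : ℤ) * (n : ℤ) - k = -k + n * 4 by
    push_cast; ring, Int.add_mul_emod_self_left]

namespace CcwSeq

variable {n : ℕ} {q : ℤ → ℝ × ℝ} {ε : ℝ}

lemma periodic_two (hq : CcwSeq n q) (i : ℤ) : q (i - 2 * n) = q i := by
  rw [← hq.periodic i, ← hq.periodic (i - 2 * n), ← hq.periodic (i - 2 * n + n),
    ← hq.periodic (i - 2 * n + n + n)]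
  congr 1; ring

lemma firstStop_shift (hq : CcwSeq n q) {i T : ℤ} (h : FirstStop ε q i T) :
    FirstStop ε q (i - 2 * n) (T - 2 * n) := by
  have he : ∀ t, edge q (t - 2 * n) = edge q t := fun t => by
    unfold edge
    rw [show t - 2 * (n : ℤ) + 1 = t + 1 - 2 * n by ring, hq.periodic_two, hq.periodic_two]
  have hs : ∀ t, Stop ε q (i - 2 * n) (t - 2 * n) ↔ Stop ε q i t := fun t => by
    unfold Stop
    rw [he, he, hq.periodic_two, hq.periodic_two]
  refine ⟨by have := h.lt; omega, (hs T).2 h.isStop, fun t h1 h2 => ?_⟩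
  have := h.not_isStop (t + 2 * n) (by omega) (by omega)
  rw [← hs, add_sub_cancel_right] at this
  exact this

/-- Array indices are natural numbers, so the reflected positions `-j` and `-i` are moved up by two
periods. -/
lemma good_iff_shift (hq : CcwSeq n q) {i j S T : ℤ} (hij : i < j) (hj : j ≤ i + n)
    (hS : FirstStop ε q i S) (hT : FirstStop ε (_root_.mir q) (2 * n - j) T) :
    Good ε q i j ↔ ¬ (S < j ∧ Far ε (q S - q i) (q j - q i)) ∧
      ¬ (T < 2 * n - i ∧ Far ε (_root_.mir q T - _root_.mir q (2 * n - j))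
        (_root_.mir q (2 * n - i) - _root_.mir q (2 * n - j))) := by
  have hG : Good ε q (i - 2 * n) (j - 2 * n) ↔ Good ε q i j := by
    rw [← hq.good_period, ← hq.good_period]
    congr! 1 <;> ring
  have := hq.good_iff (i := i - 2 * n) (j := j - 2 * n) (by omega) (by omega)
    (hq.firstStop_shift hS) (T := T) (by rwa [neg_sub])
  rw [hG, hq.periodic_two, hq.periodic_two, hq.periodic_two, neg_sub, neg_sub] at this
  rw [this]
  congr! 3
  omega

end CcwSeq

/-! ### Programs for the first stops and the longest jumps. -/

namespace RealRAM

/-- The real arrays `X` and `Y` hold the first `m` points of the sequence `q`. -/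
def HasSeq (X Y m : ℕ) (q : ℤ → ℝ × ℝ) (σ : State) : Prop :=
  ∀ k < m, σ.realArr X k = (q k).1 ∧ σ.realArr Y k = (q k).2

/-- Four periods of the sorted sequence in arrays `2`, `3`, and of the reflected sequence in
arrays `4`, `5`. -/
def fillLoop : Program :=
  .loop (.wordLt (𝕧 2) (𝕔 4 * 𝕧 0)) (
    .setWord 3 (𝕧 2 - 𝕧 2 / 𝕧 0 * 𝕧 0) ;;
    .setWord 4 (𝕔 4 * 𝕧 0 - 𝕧 2) ;;
    .setWord 4 (𝕧 4 - 𝕧 4 / 𝕧 0 * 𝕧 0) ;;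
    .storeReal 2 (𝕧 2) (.load 0 (.load 2 (𝕧 3))) ;;
    .storeReal 3 (𝕧 2) (.load 1 (.load 2 (𝕧 3))) ;;
    .storeReal 4 (𝕧 2) (.ofWord (𝕔 0) - .load 0 (.load 2 (𝕧 4))) ;;
    .storeReal 5 (𝕧 2) (.load 1 (.load 2 (𝕧 4))) ;;
    .setWord 2 (𝕧 2 + 𝕔 1))

/-- The test `Far` for the vectors `(d1, d2)` and `(u1, u2)`. -/
def farTest (d1 d2 u1 u2 : RExp) : Test :=
  ((Test.realLt (.ofWord (𝕔 0)) (d1 * u1 + d2 * u2)).not.and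
    (.realLt (.var 0 * .var 0) (d1 * d1 + d2 * d2))).or
  ((Test.realLt (.ofWord (𝕔 0)) (d1 * u1 + d2 * u2)).and
    (.realLt (.var 0 * .var 0 * (u1 * u1 + u2 * u2))
      ((d1 * u2 - d2 * u1) * (d1 * u2 - d2 * u1))))

/-- The test `Stop` for the sequence in the real arrays `X` and `Y`. -/
def stopTest (X Y : ℕ) (i t : WExp) : Test :=
  (farTest (.load X t - .load X i) (.load Y t - .load Y i)
    (.load X (t + 𝕔 1) - .load X t) (.load Y (t + 𝕔 1) - .load Y t)).or
  (Test.realLt (.ofWord (𝕔 0))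
    ((.load X (i + 𝕔 1) - .load X i) * (.load Y (t + 𝕔 1) - .load Y t) -
      (.load Y (i + 𝕔 1) - .load Y i) * (.load X (t + 𝕔 1) - .load X t))).not

/-- The first stops for the sequence in the real arrays `X` and `Y`, into word array `O`. -/
def stopLoop (X Y O : ℕ) : Program :=
  .loop (.wordLt (𝕧 2) (𝕧 0 + 𝕧 0)) (
    .ite (.wordLt (𝕧 2) (𝕧 3))
      (.ite (stopTest X Y (𝕧 2) (𝕧 3))
        (.storeWord O (𝕧 2) (𝕧 3) ;; .setWord 2 (𝕧 2 + 𝕔 1))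
        (.setWord 3 (𝕧 3 + 𝕔 1)))
      (.setWord 3 (𝕧 2 + 𝕔 1)))

/-- The test whether the first stop at `i` is far from the chord from `i` to `j`. -/
def chordTest (X Y O : ℕ) (i j : WExp) : Test :=
  (Test.wordLt (.load O i) j).and (farTest
    (.load X (.load O i) - .load X i) (.load Y (.load O i) - .load Y i)
    (.load X j - .load X i) (.load Y j - .load Y i))

/-- The test `Good` for the chord from `i` to `j`. -/
def goodTest (i j : WExp) : Test :=
  (chordTest 2 3 4 i j).not.and (chordTest 4 5 5 (𝕧 0 + 𝕧 0 - j) (𝕧 0 + 𝕧 0 - i)).not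

/-- The longest jumps, into word array `6`. -/
def jumpLoop : Program :=
  .loop (.wordLt (𝕧 2) (𝕧 0)) (
    .ite (.wordLt (𝕧 2) (𝕧 3))
      (.ite ((Test.wordLt (𝕧 3) (𝕧 2 + 𝕧 0)).and (goodTest (𝕧 2) (𝕧 3 + 𝕔 1)))
        (.setWord 3 (𝕧 3 + 𝕔 1))
        (.storeWord 6 (𝕧 2) (𝕧 3 - 𝕧 2) ;; .setWord 2 (𝕧 2 + 𝕔 1)))
      (.setWord 3 (𝕧 2 + 𝕔 1)))

variable {n w : ℕ} {q : ℤ → ℝ × ℝ} {ε : ℝ}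

lemma fillLoop_run (hM : 16 * n + 16 ≤ 2 ^ w) {p : ℕ → ℝ × ℝ} {σ : State} (hn : 0 < n)
    (hc : HasCoords n p σ) (h0 : σ.wordVar 0 = n) (h2 : σ.wordVar 2 = 0)
    (hσ : ∀ a < n, σ.wordArr 2 a < n) :
    Run w fillLoop (fillLoop.iterTime * (4 * n + 1)) σ fun τ =>
      HasSeq 2 3 (4 * n) (sortedSeq n p (σ.wordArr 2)) τ ∧
      HasSeq 4 5 (4 * n) (mir (sortedSeq n p (σ.wordArr 2))) τ := by
  refine Run.while (fun k τ => τ.wordVar 0 = n ∧ τ.wordVar 2 = k ∧ k ≤ 4 * n ∧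
    τ.wordArr = σ.wordArr ∧ τ.realArr 0 = σ.realArr 0 ∧ τ.realArr 1 = σ.realArr 1 ∧
    HasSeq 2 3 k (sortedSeq n p (σ.wordArr 2)) τ ∧
    HasSeq 4 5 k (mir (sortedSeq n p (σ.wordArr 2))) τ)
    (fun k => 4 * n - k) 0 ?_ ?_ ?_ ?_ ?_
  · exact ⟨h0, h2, Nat.zero_le _, rfl, rfl, rfl, fun k hk => by omega, fun k hk => by omega⟩
  · exact le_rfl
  · simp [Program.LoopFree]
  · rintro k τ ⟨e0, e2, i1, -, -, -, hA, hB⟩ hb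
    have m1 : 4 % 2 ^ w = 4 := Nat.mod_eq_of_lt (by omega)
    have m2 : 4 * n % 2 ^ w = 4 * n := Nat.mod_eq_of_lt (by omega)
    simp only [Test.holds_wordLt, WExp.eval_var, WExp.eval_mul, WExp.eval_const, e0, e2, m1,
      m2] at hb
    rw [show 4 * n = k by omega]
    exact ⟨hA, hB⟩
  · rintro k τ ⟨e0, e2, i1, eW, eR0, eR1, hA, hB⟩ hb
    have m1 : 4 % 2 ^ w = 4 := Nat.mod_eq_of_lt (by omega)
    have m2 : 4 * n % 2 ^ w = 4 * n := Nat.mod_eq_of_lt (by omega)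
    simp only [Test.holds_wordLt, WExp.eval_var, WExp.eval_mul, WExp.eval_const, e0, e2, m1,
      m2] at hb
    have hmod : ∀ k ≤ 4 * n, (k - k / n * n % 2 ^ w) % 2 ^ w = k % n := by
      intro k hk
      have b1 : k / n * n ≤ k := Nat.div_mul_le_self _ _
      rw [Nat.mod_eq_of_lt (a := k / n * n) (by omega), Nat.mod_eq_of_lt (by omega)]
      have := Nat.div_add_mod' k n
      omega
    have m3 := hmod k hb.le
    have m4 := hmod (4 * n - k) (by omega)
    have m5 : (4 * n - k) % 2 ^ w = 4 * n - k := Nat.mod_eq_of_lt (by omega)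
    have m6 : 1 % 2 ^ w = 1 := Nat.mod_eq_of_lt (by omega)
    have m7 : (k + 1) % 2 ^ w = k + 1 := Nat.mod_eq_of_lt (by omega)
    have r1 := hc _ (hσ _ (Nat.mod_lt k hn))
    have r2 := hc _ (hσ _ (Nat.mod_lt (4 * n - k) hn))
    refine ⟨k + 1, ?_, by omega⟩
    have s1 := sortedSeq_natCast n p (σ.wordArr 2) k
    have s2 := sortedSeq_neg n p (σ.wordArr 2) hb.le
    refine ⟨?_, ?_, hb, ?_, ?_, ?_, ?_, ?_⟩
    · simp [e0]
    · simp [e2, m6, m7]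
    · simp [eW]
    · ext1 j; simp [eR0]
    · ext1 j; simp [eR1]
    · intro k' hk'
      rcases Nat.lt_succ_iff_lt_or_eq.1 hk' with hlt | rfl
      · have := hA k' hlt
        simp [e2, hlt.ne, this]
      · simp [e0, e2, m3, eW, eR0, eR1, s1, r1]
    · intro k' hk'
      rcases Nat.lt_succ_iff_lt_or_eq.1 hk' with hlt | rfl
      · have := hB k' hlt
        simp [e2, hlt.ne, this]
      · simp [e0, e2, m1, m2, m4, m5, eW, eR0, eR1, mir, mirror, s2, r2]

lemma farTest_holds {σ : State} {d1 d2 u1 u2 : RExp} :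
    (farTest d1 d2 u1 u2).Holds w σ ↔
      Far (σ.realVar 0) (d1.eval w σ, d2.eval w σ) (u1.eval w σ, u2.eval w σ) := by
  simp only [farTest, Test.holds_or, Test.holds_and, Test.holds_not, Test.holds_realLt,
    RExp.eval_ofWord, WExp.eval_const, Nat.zero_mod, Nat.cast_zero, RExp.eval_add, RExp.eval_mul,
    RExp.eval_sub, RExp.eval_var, Far, dt, cr, not_lt, sq]

lemma stopTest_holds {σ : State} {X Y m i t : ℕ} {ei et : WExp} (hq : HasSeq X Y m q σ)
    (hε : σ.realVar 0 = ε) (hi : ei.eval w σ = i) (ht : et.eval w σ = t)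
    (him : i + 1 < m) (htm : t + 1 < m) (hM : m < 2 ^ w) :
    (stopTest X Y ei et).Holds w σ ↔ Stop ε q i t := by
  have m1 : 1 % 2 ^ w = 1 := Nat.mod_eq_of_lt (by omega)
  have m2 : (i + 1) % 2 ^ w = i + 1 := Nat.mod_eq_of_lt (by omega)
  have m3 : (t + 1) % 2 ^ w = t + 1 := Nat.mod_eq_of_lt (by omega)
  have q1 := hq i (by omega)
  have q2 := hq (i + 1) him
  have q3 := hq t (by omega)
  have q4 := hq (t + 1) htm
  push_cast at q2 q4
  simp only [stopTest, Test.holds_or, farTest_holds, Test.holds_not, Test.holds_realLt,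
    RExp.eval_ofWord, WExp.eval_const, Nat.zero_mod, Nat.cast_zero, RExp.eval_sub, RExp.eval_mul,
    RExp.eval_load, WExp.eval_add, hi, ht, m1, m2, m3, q1, q2, q3, q4, hε, not_lt]
  rfl

lemma chordTest_holds {σ : State} {X Y O m i j : ℕ} {ei ej : WExp} (hq : HasSeq X Y m q σ)
    (hε : σ.realVar 0 = ε) (hi : ei.eval w σ = i) (hj : ej.eval w σ = j)
    (him : i < m) (hjm : j < m) (hS : σ.wordArr O i < m) :
    (chordTest X Y O ei ej).Holds w σ ↔ ((σ.wordArr O i : ℤ) < j ∧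
      Far ε (q (σ.wordArr O i : ℕ) - q i) (q j - q i)) := by
  simp only [chordTest, Test.holds_and, farTest_holds, Test.holds_wordLt, WExp.eval_load,
    RExp.eval_sub, RExp.eval_load, hi, hj, hq _ him, hq _ hjm, hq _ hS, hε, Nat.cast_lt]
  rfl

/-- Two pointers `i` and `t`: each iteration advances one of them, and `t ≤ i + n` bounds their
total advance by `5 * n`. Two periods of starts are covered because the reflected ends `2 * n - j`
range over them. -/
lemma stopLoop_run (hM : 16 * n + 16 ≤ 2 ^ w) (hq : CcwSeq n q) {X Y O : ℕ} {σ : State}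
    (hn : 0 < n) (hs : HasSeq X Y (4 * n) q σ) (hε : σ.realVar 0 = ε)
    (h0 : σ.wordVar 0 = n) (h2 : σ.wordVar 2 = 0) (h3 : σ.wordVar 3 = 0) :
    Run w (stopLoop X Y O) ((stopLoop X Y O).iterTime * (5 * n + 1)) σ fun τ =>
      ∀ i < 2 * n, FirstStop ε q i (τ.wordArr O i) := by
  refine Run.while (fun (a : ℕ × ℕ) τ => τ.wordVar 0 = n ∧ τ.wordVar 2 = a.1 ∧
    τ.wordVar 3 = a.2 ∧ a.1 ≤ 2 * n ∧ a.2 ≤ a.1 + n ∧ τ.realArr = σ.realArr ∧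
    τ.realVar 0 = ε ∧ (∀ s : ℤ, a.1 < s → s < a.2 → ¬ Stop ε q a.1 s) ∧
    ∀ i < a.1, FirstStop ε q i (τ.wordArr O i))
    (fun a => (2 * n - a.1) + (3 * n - a.2)) (0, 0) ?_ ?_ ?_ ?_ ?_
  · exact ⟨h0, h2, h3, Nat.zero_le _, Nat.zero_le _, rfl, hε, fun s h h' => by simp at h h'; omega,
      fun i hi => by simp at hi⟩
  · refine Nat.mul_le_mul_left _ ?_
    simp only
    omega
  · simp [Program.LoopFree]
  · rintro ⟨i, t⟩ τ ⟨e0, e2, e3, i1, i2, eR, eε, hA, hB⟩ hb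
    have m1 : (n + n) % 2 ^ w = n + n := Nat.mod_eq_of_lt (by omega)
    simp only [Test.holds_wordLt, WExp.eval_var, WExp.eval_add, e0, e2, m1] at hb
    exact fun i hi => hB i (by simp only; omega)
  · rintro ⟨i, t⟩ τ ⟨e0, e2, e3, i1, i2, eR, eε, hA, hB⟩ hb
    have m1 : (n + n) % 2 ^ w = n + n := Nat.mod_eq_of_lt (by omega)
    simp only [Test.holds_wordLt, WExp.eval_var, WExp.eval_add, e0, e2, m1] at hb
    simp only at i1 i2 hA hB e2 e3
    have c1 : 1 % 2 ^ w = 1 := Nat.mod_eq_of_lt (by omega)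
    have c2 : (i + 1) % 2 ^ w = i + 1 := Nat.mod_eq_of_lt (by omega)
    have c3 : (t + 1) % 2 ^ w = t + 1 := Nat.mod_eq_of_lt (by omega)
    by_cases hit : i < t
    · rw [Program.eval_ite_pos (by simpa [e2, e3] using hit)]
      have hT := stopTest_holds (w := w) (σ := τ) (X := X) (Y := Y) (m := 4 * n) (q := q) (i := i)
        (t := t) (ei := 𝕧 2) (et := 𝕧 3) (fun k hk => by rw [eR]; exact hs k hk) eε e2 e3 (by omega)
        (by omega) (by omega)
      by_cases hst : Stop ε q i t
      · rw [Program.eval_ite_pos (hT.2 hst)]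
        refine ⟨(i + 1, t), ⟨by simp [e0], by simp [e2, c1, c2], by simp [e3], by simp only; omega,
          by simp only; omega, by simp [eR], by simp [eε], ?_, ?_⟩, by simp only; omega⟩
        · intro s hs1 hs2
          push_cast at hs1 hs2 ⊢
          -- Monotonicity of the first stop allows `t` to stay in place when `i` advances.
          exact hq.firstStop_mono (i := i) (t := t) (by omega) hA s hs1 hs2
        · intro i' hi'
          simp only [Program.eval_seq, Program.eval_storeWord, Program.eval_setWord, WExp.eval_var,
            State.setWord_wordArr, State.storeWord_wordArr, e2, e3, true_and]
          rcases Nat.lt_succ_iff_lt_or_eq.1 hi' with hlt | rfl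
          · rw [if_neg hlt.ne]
            exact hB i' hlt
          · rw [if_pos rfl]
            exact ⟨by omega, hst, hA⟩
      · rw [Program.eval_ite_neg (mt hT.1 hst)]
        have htn : t ≠ i + n := by
          rintro rfl
          apply hst
          push_cast
          exact hq.stop_period i
        refine ⟨(i, t + 1), ⟨by simp [e0], by simp [e2], by simp [e3, c1, c3], i1,
          by simp only; omega, by simp [eR], by simp [eε], ?_, by simpa using hB⟩,
          by simp only; omega⟩
        intro s hs1 hs2
        push_cast at hs1 hs2 ⊢
        rcases (Int.lt_add_one_iff.1 hs2).lt_or_eq with h | rfl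
        · exact hA s hs1 h
        · exact hst
    · rw [Program.eval_ite_neg (by simpa [e2, e3] using hit)]
      refine ⟨(i, i + 1), ⟨by simp [e0], by simp [e2], by simp [e2, c1, c2], i1,
        by simp only; omega, by simp [eR], by simp [eε], ?_, by simpa using hB⟩,
        by simp only; omega⟩
      intro s hs1 hs2
      push_cast at hs1 hs2
      omega

/-- First stops come at most one period after their starts, so all indices stay within the four
stored periods. -/
lemma goodTest_holds (hM : 16 * n + 16 ≤ 2 ^ w) (hq : CcwSeq n q) {σ : State} (hn : 0 < n)
    (hA : HasSeq 2 3 (4 * n) q σ) (hB : HasSeq 4 5 (4 * n) (mir q) σ)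
    (hSA : ∀ i < 2 * n, FirstStop ε q i (σ.wordArr 4 i))
    (hSB : ∀ i < 2 * n, FirstStop ε (mir q) i (σ.wordArr 5 i))
    (h0 : σ.wordVar 0 = n) (hε : σ.realVar 0 = ε)
    {ei ej : WExp} {i j : ℕ} (hi : ei.eval w σ = i) (hj : ej.eval w σ = j) (hin : i < n)
    (hij : i < j) (hjn : j ≤ i + n) :
    (goodTest ei ej).Holds w σ ↔ Good ε q i j := by
  have m1 : (n + n) % 2 ^ w = n + n := Nat.mod_eq_of_lt (by omega)
  have m2 : (n + n - j) % 2 ^ w = 2 * n - j := by rw [Nat.mod_eq_of_lt (by omega)]; omega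
  have m3 : (n + n - i) % 2 ^ w = 2 * n - i := by rw [Nat.mod_eq_of_lt (by omega)]; omega
  have hS := hSA i (by omega)
  have hT := hSB (2 * n - j) (by omega)
  have b1 := hq.firstStop_le hn hS
  have b2 := hq.mir.firstStop_le hn hT
  have n1 : ((2 * n - j : ℕ) : ℤ) = 2 * n - j := by omega
  have n2 : ((2 * n - i : ℕ) : ℤ) = 2 * n - i := by omega
  have t1 := chordTest_holds (w := w) (O := 4) hA hε hi hj (by omega) (by omega) (by omega)
  have t2 := chordTest_holds (w := w) (O := 5) (ei := 𝕧 0 + 𝕧 0 - ej) (ej := 𝕧 0 + 𝕧 0 - ei)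
    (i := 2 * n - j) (j := 2 * n - i) hB hε (by simp [h0, hj, m1, m2]) (by simp [h0, hi, m1, m3])
    (by omega) (by omega) (by omega)
  rw [n1] at hT
  rw [n1, n2] at t2
  rw [hq.good_iff_shift (by omega) (by omega) hS hT]
  simp only [goodTest, Test.holds_and, Test.holds_not, t1, t2]

lemma jumpLoop_run (hM : 16 * n + 16 ≤ 2 ^ w) (hq : CcwSeq n q) {σ : State} (hn : 0 < n)
    (hA : HasSeq 2 3 (4 * n) q σ) (hB : HasSeq 4 5 (4 * n) (mir q) σ)
    (hSA : ∀ i < 2 * n, FirstStop ε q i (σ.wordArr 4 i))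
    (hSB : ∀ i < 2 * n, FirstStop ε (mir q) i (σ.wordArr 5 i))
    (h0 : σ.wordVar 0 = n) (hε : σ.realVar 0 = ε)
    (h2 : σ.wordVar 2 = 0) (h3 : σ.wordVar 3 = 0) :
    Run w jumpLoop (jumpLoop.iterTime * (3 * n + 1)) σ fun τ =>
      JumpSystem n (fun i j : ℕ => Good ε q i j) (τ.wordArr 6) := by
  refine Run.while (fun (a : ℕ × ℕ) τ => τ.wordVar 0 = n ∧ τ.wordVar 2 = a.1 ∧
    τ.wordVar 3 = a.2 ∧ a.1 ≤ n ∧ a.2 ≤ a.1 + n ∧ τ.realArr = σ.realArr ∧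
    τ.wordArr 4 = σ.wordArr 4 ∧ τ.wordArr 5 = σ.wordArr 5 ∧
    τ.realVar 0 = ε ∧ (a.1 < a.2 → Good ε q a.1 a.2) ∧
    ∀ i < a.1, 0 < τ.wordArr 6 i ∧ τ.wordArr 6 i ≤ n ∧ Good ε q i (i + τ.wordArr 6 i) ∧
      (τ.wordArr 6 i < n → ¬ Good ε q i (i + τ.wordArr 6 i + 1)))
    (fun a => (n - a.1) + (2 * n - a.2)) (0, 0) ?_ ?_ ?_ ?_ ?_
  · exact ⟨h0, h2, h3, Nat.zero_le _, Nat.zero_le _, rfl, rfl, rfl, hε, fun h => by simp at h,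
      fun i hi => by simp at hi⟩
  · refine Nat.mul_le_mul_left _ ?_
    simp only
    omega
  · simp [Program.LoopFree]
  · rintro ⟨i, j⟩ τ ⟨e0, e2, e3, i1, i2, eR, e4, e5, eε, hG, hL⟩ hb
    simp only [Test.holds_wordLt, WExp.eval_var, e0, e2] at hb
    have hin : i = n := le_antisymm i1 (not_lt.1 hb)
    subst hin
    refine ⟨hn, ?_, ?_, fun k hk => (hL k hk).1, fun k hk => (hL k hk).2.1, ?_⟩
    · intro i j i' j' h1 h2 h3 h4
      exact hq.good_mono (by exact_mod_cast h1) (by exact_mod_cast h2) (by exact_mod_cast h3) h4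
    · intro i j
      push_cast
      exact hq.good_period
    · intro k hk j hkj hj
      obtain ⟨-, l2, l3, l4⟩ := hL k hk
      constructor
      · intro hg
        by_contra hc
        exact l4 (by omega) (hq.good_mono (i := k) (j := j) le_rfl (by omega) (by omega) hg)
      · intro hle
        exact hq.good_mono (i := k) (j := k + τ.wordArr 6 k) le_rfl (by omega) (by omega) l3
  · rintro ⟨i, j⟩ τ ⟨e0, e2, e3, i1, i2, eR, e4, e5, eε, hG, hL⟩ hb
    simp only [Test.holds_wordLt, WExp.eval_var, e0, e2] at hb
    simp only at i1 i2 hG hL e2 e3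
    have c1 : 1 % 2 ^ w = 1 := Nat.mod_eq_of_lt (by omega)
    have c2 : (i + 1) % 2 ^ w = i + 1 := Nat.mod_eq_of_lt (by omega)
    have c3 : (j + 1) % 2 ^ w = j + 1 := Nat.mod_eq_of_lt (by omega)
    have c4 : (i + n) % 2 ^ w = i + n := Nat.mod_eq_of_lt (by omega)
    have c5 : (j - i) % 2 ^ w = j - i := Nat.mod_eq_of_lt (by omega)
    by_cases hij : i < j
    · rw [Program.eval_ite_pos (by simpa [e2, e3] using hij)]
      have hT : j < i + n → ((goodTest (𝕧 2) (𝕧 3 + 𝕔 1)).Holds w τ ↔ Good ε q i (j + 1 : ℕ)) :=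
        fun hlt => goodTest_holds hM hq hn (σ := τ) (fun k hk => by rw [eR]; exact hA k hk)
          (fun k hk => by rw [eR]; exact hB k hk) (by rwa [e4]) (by rwa [e5]) e0 eε (by simp [e2])
          (by simp [e3, c1, c3]) hb (by omega) (by omega)
      by_cases hst : j < i + n ∧ Good ε q i (j + 1 : ℕ)
      · rw [Program.eval_ite_pos ((Test.holds_and _ _).2
          ⟨by simpa [e0, e2, e3, c4] using hst.1, (hT hst.1).2 hst.2⟩)]
        exact ⟨(i, j + 1), ⟨by simp [e0], by simp [e2], by simp [e3, c1, c3], i1,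
          by simp only; omega, by simp [eR], by simp [e4], by simp [e5], by simp [eε],
          fun _ => hst.2, by simpa using hL⟩, by simp only; omega⟩
      · rw [Program.eval_ite_neg (by
          rintro ⟨t1, t2⟩
          have t1' : j < i + n := by simpa [e0, e2, e3, c4] using t1
          exact hst ⟨t1', (hT t1').1 t2⟩)]
        refine ⟨(i + 1, j), ⟨by simp [e0], by simp [e2, c1, c2], by simp [e3], hb,
          by simp only; omega, by simp [eR], ?_, ?_, by simp [eε], ?_, ?_⟩, by simp only; omega⟩
        · ext1 k; simp [e4]
        · ext1 k; simp [e5]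
        · intro hlt
          push_cast
          -- The rest of a good chord is good, so `j` need not move back when `i` advances.
          exact hq.good_mono (i := i) (j := j) (by omega) le_rfl (by omega) (hG hij)
        · intro i' hi'
          simp only [Program.eval_seq, Program.eval_storeWord, Program.eval_setWord, WExp.eval_var,
            WExp.eval_sub, State.setWord_wordArr, State.storeWord_wordArr, e2, e3, true_and, c5]
          rcases Nat.lt_succ_iff_lt_or_eq.1 hi' with hlt | rfl
          · rw [if_neg hlt.ne]
            exact hL i' hlt
          · rw [if_pos rfl]
            have hc : ((i' : ℤ) + (j - i' : ℕ)) = j := by omega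
            rw [hc]
            refine ⟨by omega, by omega, hG hij, fun hlt hg => hst ⟨by omega, by push_cast; exact hg⟩⟩
    · rw [Program.eval_ite_neg (by simpa [e2, e3] using hij)]
      refine ⟨(i, i + 1), ⟨by simp [e0], by simp [e2], by simp [e2, c1, c2], i1,
        by simp only; omega, by simp [eR], by simp [e4], by simp [e5], by simp [eε],
        fun _ => by push_cast; exact CcwSeq.good_succ _, by simpa using hL⟩, by simp only; omega⟩

end RealRAM


/-! ### Greedy sequences of jumps -/

namespace JumpSystem

variable {n : ℕ} {G : ℕ → ℕ → Prop} {ℓ : ℕ → ℕ}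

/-- The greedy sequence of jumps from `c` closes after exactly `k` jumps. -/
def Closes (n : ℕ) (ℓ : ℕ → ℕ) (c k : ℕ) : Prop :=
  c + n ≤ (jumpTo n ℓ)^[k] c ∧ ∀ t < k, (jumpTo n ℓ)^[t] c < c + n

lemma Closes.le {c k t : ℕ} (h : Closes n ℓ c k) (ht : c + n ≤ (jumpTo n ℓ)^[t] c) : k ≤ t := by
  by_contra hc
  exact absurd (h.2 t (by omega)) (by omega)

lemma le_div_of_iterate_lt (h : JumpSystem n G ℓ) {L : ℕ} (hL : ∀ i < n, L ≤ ℓ i) (hL0 : 0 < L)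
    {c t : ℕ} (ht : (jumpTo n ℓ)^[t] c < c + n) : t ≤ (n - 1) / L := by
  have := h.iterate_ge hL c t
  rw [Nat.le_div_iff_mul_le hL0]
  omega

lemma Closes.le_card (h : JumpSystem n G ℓ) {c k : ℕ} (hk : Closes n ℓ c k) : k ≤ n := by
  rcases k with _ | k
  · exact Nat.zero_le _
  · have := h.le_div_of_iterate_lt (L := 1) h.jump_pos one_pos (hk.2 k k.lt_succ_self)
    have := h.pos
    omega

end JumpSystem

namespace RealRAM

/-- The remainder of `e` divided by `f`. -/
def WExp.mod (e f : WExp) : WExp := e - e / f * f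

lemma WExp.eval_mod {w : ℕ} {σ : State} {e f : WExp} (h : e.eval w σ < 2 ^ w) :
    (e.mod f).eval w σ = e.eval w σ % f.eval w σ := by
  simp only [WExp.mod, WExp.eval_sub, WExp.eval_mul, WExp.eval_div]
  have b1 : e.eval w σ / f.eval w σ * f.eval w σ ≤ e.eval w σ := Nat.div_mul_le_self _ _
  have b2 : e.eval w σ / f.eval w σ ≤ e.eval w σ := Nat.div_le_self _ _
  rw [Nat.mod_eq_of_lt (b2.trans_lt h), Nat.mod_eq_of_lt (b1.trans_lt h),
    Nat.mod_eq_of_lt ((Nat.sub_le _ _).trans_lt h)]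
  have := Nat.div_add_mod' (e.eval w σ) (f.eval w σ)
  omega

/-- The place of the shortest jump, into word variable `3`. -/
def minLoop : Program :=
  .loop (.wordLt (𝕧 2) (𝕧 0)) (
    .ite (.wordLt (.load 6 (𝕧 2)) (.load 6 (𝕧 3)))
      (.setWord 3 (𝕧 2) ;; .setWord 2 (𝕧 2 + 𝕔 1))
      (.setWord 2 (𝕧 2 + 𝕔 1)))

/-- The shortest closed greedy sequence among those that start within the shortest jump: the
number of its jumps into word variable `6`, its start into word variable `7`. -/
def greedyLoop : Program :=
  .loop (Test.wordLt (𝕧 3 + .load 6 (𝕧 3)) (𝕧 2)).not (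
    .ite (.wordLt (𝕧 4) (𝕧 2 + 𝕧 0))
      (.setWord 4 (𝕧 4 + .load 6 ((𝕧 4).mod (𝕧 0))) ;; .setWord 5 (𝕧 5 + 𝕔 1))
      (.ite (.wordLt (𝕧 5) (𝕧 6))
        (.setWord 6 (𝕧 5) ;; .setWord 7 (𝕧 2) ;;
          .setWord 2 (𝕧 2 + 𝕔 1) ;; .setWord 4 (𝕧 2) ;; .setWord 5 (𝕔 0))
        (.setWord 2 (𝕧 2 + 𝕔 1) ;; .setWord 4 (𝕧 2) ;; .setWord 5 (𝕔 0))))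

/-- The greedy sequence of `𝕧 6` points from position `𝕧 4`, into word array `0`. -/
def outputLoop : Program :=
  .loop (.wordLt (𝕧 2) (𝕧 6)) (
    .storeWord 0 (𝕧 2) (.load 2 ((𝕧 4).mod (𝕧 0))) ;;
    .setWord 4 (𝕧 4 + .load 6 ((𝕧 4).mod (𝕧 0))) ;;
    .setWord 2 (𝕧 2 + 𝕔 1))

variable {n w : ℕ} {σ : State}

lemma minLoop_run (hM : 16 * n + 16 ≤ 2 ^ w) (hn : 0 < n) (h0 : σ.wordVar 0 = n)
    (h2 : σ.wordVar 2 = 0) (h3 : σ.wordVar 3 = 0) :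
    Run w minLoop (minLoop.iterTime * (n + 1)) σ fun τ =>
      τ.wordVar 3 < n ∧ ∀ i < n, τ.wordArr 6 (τ.wordVar 3) ≤ τ.wordArr 6 i := by
  refine Run.while (fun k τ => τ.wordVar 0 = n ∧ τ.wordVar 2 = k ∧ k ≤ n ∧ τ.wordVar 3 < n ∧
    ∀ i < k, τ.wordArr 6 (τ.wordVar 3) ≤ τ.wordArr 6 i) (fun k => n - k) 0 ?_ le_rfl ?_ ?_ ?_
  · exact ⟨h0, h2, Nat.zero_le _, by omega, fun i hi => by omega⟩
  · simp [Program.LoopFree]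
  · rintro k τ ⟨e0, e2, i1, i2, hmin⟩ hb
    simp only [Test.holds_wordLt, WExp.eval_var, e0, e2] at hb
    rw [show n = k by omega]
    exact ⟨by omega, hmin⟩
  · rintro k τ ⟨e0, e2, i1, i2, hmin⟩ hb
    simp only [Test.holds_wordLt, WExp.eval_var, e0, e2] at hb
    have c1 : 1 % 2 ^ w = 1 := Nat.mod_eq_of_lt (by omega)
    have c2 : (k + 1) % 2 ^ w = k + 1 := Nat.mod_eq_of_lt (by omega)
    refine ⟨k + 1, ?_, by omega⟩
    by_cases hlt : τ.wordArr 6 k < τ.wordArr 6 (τ.wordVar 3)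
    · rw [Program.eval_ite_pos (by simpa [e2] using hlt)]
      refine ⟨by simp [e0], by simp [e2, c1, c2], hb, by simpa [e2] using hb, fun i hi => ?_⟩
      simp only [Program.eval_seq, Program.eval_setWord, WExp.eval_var, State.setWord_wordArr,
        State.setWord_wordVar, e2]
      rcases Nat.lt_succ_iff_lt_or_eq.1 hi with h | rfl
      · exact hlt.le.trans (hmin i h)
      · exact le_rfl
    · rw [Program.eval_ite_neg (by simpa [e2] using hlt)]
      refine ⟨by simp [e0], by simp [e2, c1, c2], hb, by simpa using i2, fun i hi => ?_⟩
      simp only [Program.eval_setWord, State.setWord_wordArr, State.setWord_wordVar]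
      rcases Nat.lt_succ_iff_lt_or_eq.1 hi with h | rfl
      · exact hmin i h
      · exact not_lt.1 hlt

/-- Each of the `ℓ s + 1` starts takes at most `(n - 1) / ℓ s + 1` jumps and one iteration for the
bookkeeping. The initial value `n + 1` of the minimum exceeds the length of any closed greedy
sequence. -/
lemma greedyLoop_run (hM : 16 * n + 16 ≤ 2 ^ w) {G : ℕ → ℕ → Prop} {ℓ : ℕ → ℕ} {s : ℕ}
    (h : JumpSystem n G ℓ) (hs : s < n) (hmin : ∀ i < n, ℓ s ≤ ℓ i) (h0 : σ.wordVar 0 = n)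
    (h2 : σ.wordVar 2 = s) (h3 : σ.wordVar 3 = s) (h4 : σ.wordVar 4 = s) (h5 : σ.wordVar 5 = 0)
    (h6 : σ.wordVar 6 = n + 1) (hℓ : σ.wordArr 6 = ℓ) :
    Run w greedyLoop (greedyLoop.iterTime * (4 * n + 1)) σ fun τ =>
      τ.wordVar 7 < 2 * n ∧ JumpSystem.Closes n ℓ (τ.wordVar 7) (τ.wordVar 6) ∧
      ∀ c, s ≤ c → c ≤ s + ℓ s → ∀ t, c + n ≤ (jumpTo n ℓ)^[t] c → τ.wordVar 6 ≤ t := by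
  have hL0 := h.jump_pos s hs
  have hLn := h.jump_le s hs
  refine Run.while (fun (a : ℕ × ℕ) τ => τ.wordVar 0 = n ∧ τ.wordVar 2 = a.1 ∧
    τ.wordVar 3 = s ∧ τ.wordVar 4 = (jumpTo n ℓ)^[a.2] a.1 ∧ τ.wordVar 5 = a.2 ∧
    τ.wordArr 6 = ℓ ∧ s ≤ a.1 ∧ a.1 ≤ s + ℓ s + 1 ∧
    (a.1 = s + ℓ s + 1 → a.2 = 0) ∧
    (∀ t < a.2, (jumpTo n ℓ)^[t] a.1 < a.1 + n) ∧
    (a.1 = s ∧ τ.wordVar 6 = n + 1 ∨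
      τ.wordVar 7 < 2 * n ∧ JumpSystem.Closes n ℓ (τ.wordVar 7) (τ.wordVar 6)) ∧
    ∀ c, s ≤ c → c < a.1 → ∀ t, c + n ≤ (jumpTo n ℓ)^[t] c → τ.wordVar 6 ≤ t)
    (fun a => (s + ℓ s + 1 - a.1) * ((n - 1) / ℓ s + 2) - a.2) (s, 0) ?_ ?_ ?_ ?_ ?_
  · exact ⟨h0, h2, h3, h4, h5, hℓ, le_rfl, by simp only; omega, fun _ => rfl,
      fun t ht => by simp at ht, Or.inl ⟨rfl, h6⟩, fun c hc hc' => by simp only at hc'; omega⟩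
  · refine Nat.mul_le_mul_left _ (Nat.succ_le_succ ?_)
    have e1 : s + ℓ s + 1 - s = ℓ s + 1 := by omega
    have e2 : ℓ s * ((n - 1) / ℓ s) ≤ n - 1 := Nat.mul_div_le _ _
    have e3 : (n - 1) / ℓ s ≤ n - 1 := Nat.div_le_self _ _
    simp only [e1]
    generalize (n - 1) / ℓ s = g at *
    -- Each of the first two terms is at most `n - 1`, and `ℓ s ≤ n`; this gives the total `4 * n`.
    have : (ℓ s + 1) * (g + 2) = ℓ s * g + g + 2 * ℓ s + 2 := by ring
    omega
  · simp [Program.LoopFree]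
  · rintro ⟨c, k⟩ τ ⟨e0, e2, e3, e4, e5, e6, i1, i2, i3, hk, hB, hm⟩ hb
    simp only at i1 i2 i3 hk hB hm e2 e4 e5
    have c1 : (s + ℓ s) % 2 ^ w = s + ℓ s := Nat.mod_eq_of_lt (by omega)
    simp only [Test.holds_not, Test.holds_wordLt, WExp.eval_var, WExp.eval_add, WExp.eval_load,
      e2, e3, e6, c1, not_not] at hb
    obtain ⟨hB1, -⟩ | hB := hB
    · omega
    · exact ⟨hB.1, hB.2, fun c' hc hc' => hm c' hc (by omega)⟩
  · rintro ⟨c, k⟩ τ ⟨e0, e2, e3, e4, e5, e6, i1, i2, i3, hk, hB, hm⟩ hb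
    simp only at i1 i2 i3 hk hB hm e2 e4 e5
    have c1 : (s + ℓ s) % 2 ^ w = s + ℓ s := Nat.mod_eq_of_lt (by omega)
    simp only [Test.holds_not, Test.holds_wordLt, WExp.eval_var, WExp.eval_add, WExp.eval_load,
      e2, e3, e6, c1, not_lt] at hb
    have c2 : 1 % 2 ^ w = 1 := Nat.mod_eq_of_lt (by omega)
    have c3 : (c + n) % 2 ^ w = c + n := Nat.mod_eq_of_lt (by omega)
    have c4 : (c + 1) % 2 ^ w = c + 1 := Nat.mod_eq_of_lt (by omega)
    obtain ⟨X, hX⟩ : ∃ X, s + ℓ s + 1 - c = X + 1 := ⟨s + ℓ s - c, by omega⟩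
    have hX' : s + ℓ s + 1 - (c + 1) = X := by omega
    obtain ⟨D, hD⟩ : ∃ D, (n - 1) / ℓ s = D := ⟨_, rfl⟩
    have hXm : (X + 1) * (D + 2) = X * (D + 2) + (D + 2) := Nat.succ_mul _ _
    have hkg : k ≤ D + 1 := by
      rw [← hD]
      rcases k with _ | k
      · exact Nat.zero_le _
      · exact Nat.succ_le_succ (h.le_div_of_iterate_lt hmin hL0 (hk k k.lt_succ_self))
    by_cases hlt : (jumpTo n ℓ)^[k] c < c + n
    · rw [Program.eval_ite_pos (by simpa [e0, e2, e4, c3] using hlt)]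
      have hkg' := h.le_div_of_iterate_lt hmin hL0 hlt
      have hkn : k ≤ n - 1 := hkg'.trans (Nat.div_le_self _ _)
      rw [hD] at hkg'
      have c5 : (k + 1) % 2 ^ w = k + 1 := Nat.mod_eq_of_lt (by omega)
      have hle := h.jumpTo_le ((jumpTo n ℓ)^[k] c)
      have c6 : jumpTo n ℓ ((jumpTo n ℓ)^[k] c) % 2 ^ w = jumpTo n ℓ ((jumpTo n ℓ)^[k] c) :=
        Nat.mod_eq_of_lt (by omega)
      have c7 : ((𝕧 4).mod (𝕧 0)).eval w τ = (jumpTo n ℓ)^[k] c % n := by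
        rw [WExp.eval_mod (by simp only [WExp.eval_var, e4]; omega)]
        simp only [WExp.eval_var, e4, e0]
      refine ⟨(c, k + 1), ⟨by simp [e0], by simp [e2], by simp [e3], ?_, by simp [e5, c2, c5],
        by simp [e6], i1, i2, fun hc => by simp only at hc; omega, ?_, by simpa using hB,
        by simpa using hm⟩, ?_⟩
      · rw [Function.iterate_succ_apply', ← c6]
        simp [c7, e4, e6, jumpTo]
      · intro t ht
        rcases Nat.lt_succ_iff_lt_or_eq.1 ht with h' | rfl
        · exact hk t h'
        · exact hlt
      · simp only [hX, hD]
        omega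
    · rw [Program.eval_ite_neg (by simpa [e0, e2, e4, c3] using hlt)]
      have hcl : JumpSystem.Closes n ℓ c k := ⟨not_lt.1 hlt, hk⟩
      have hc2 : c < 2 * n ∨ c = 2 * n := by omega
      have hkn := hcl.le_card h
      by_cases hbest : k < τ.wordVar 6
      · rw [Program.eval_ite_pos (by simpa [e5] using hbest)]
        refine ⟨(c + 1, 0), ⟨by simp [e0], by simp [e2, c2, c4], by simp [e3], by simp [e2, c2, c4],
          by simp, by simp [e6], by simp only; omega, by simp only; omega, fun _ => rfl,
          fun t ht => by simp at ht, Or.inr ?_, ?_⟩, ?_⟩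
        · simp only [Program.eval_seq, Program.eval_setWord, WExp.eval_var, State.setWord_wordVar,
            e2, e5]
          norm_num
          exact ⟨by omega, hcl⟩
        · intro c' hc' hc'' t ht
          simp only [Program.eval_seq, Program.eval_setWord, WExp.eval_var, State.setWord_wordVar,
            e5]
          norm_num
          rcases Nat.lt_succ_iff_lt_or_eq.1 hc'' with h' | rfl
          · exact hbest.le.trans (hm c' hc' h' t ht)
          · exact hcl.le ht
        · simp only [hX, hX', hD]
          omega
      · rw [Program.eval_ite_neg (by simpa [e5] using hbest)]
        refine ⟨(c + 1, 0), ⟨by simp [e0], by simp [e2, c2, c4], by simp [e3], by simp [e2, c2, c4],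
          by simp, by simp [e6], by simp only; omega, by simp only; omega, fun _ => rfl,
          fun t ht => by simp at ht, Or.inr ?_, ?_⟩, ?_⟩
        · obtain ⟨-, hB2⟩ | hB := hB
          · omega
          · simpa using hB
        · intro c' hc' hc'' t ht
          simp only [Program.eval_seq, Program.eval_setWord, WExp.eval_var, State.setWord_wordVar]
          norm_num
          rcases Nat.lt_succ_iff_lt_or_eq.1 hc'' with h' | rfl
          · exact hm c' hc' h' t ht
          · exact (not_lt.1 hbest).trans (hcl.le ht)
        · simp only [hX, hX', hD]
          omega

lemma outputLoop_run (hM : 16 * n + 16 ≤ 2 ^ w) {G : ℕ → ℕ → Prop} {ℓ : ℕ → ℕ} {c k : ℕ}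
    (h : JumpSystem n G ℓ) (hc : c ≤ 2 * n) (hk : JumpSystem.Closes n ℓ c k)
    (h0 : σ.wordVar 0 = n) (h2 : σ.wordVar 2 = 0) (h4 : σ.wordVar 4 = c) (h6 : σ.wordVar 6 = k)
    (hℓ : σ.wordArr 6 = ℓ) :
    Run w outputLoop (outputLoop.iterTime * (n + 1)) σ fun τ =>
      ∀ j < k, τ.wordArr 0 j = σ.wordArr 2 ((jumpTo n ℓ)^[j] c % n) := by
  have hkn := hk.le_card h
  refine Run.while (fun j τ => τ.wordVar 0 = n ∧ τ.wordVar 2 = j ∧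
    τ.wordVar 4 = (jumpTo n ℓ)^[j] c ∧ τ.wordVar 6 = k ∧ τ.wordArr 6 = ℓ ∧
    τ.wordArr 2 = σ.wordArr 2 ∧ j ≤ k ∧
    ∀ i < j, τ.wordArr 0 i = σ.wordArr 2 ((jumpTo n ℓ)^[i] c % n)) (fun j => k - j) 0
    ?_ ?_ ?_ ?_ ?_
  · exact ⟨h0, h2, h4, h6, hℓ, rfl, Nat.zero_le _, fun i hi => by omega⟩
  · exact Nat.mul_le_mul_left _ (by omega)
  · simp [Program.LoopFree]
  · rintro j τ ⟨e0, e2, e4, e6, eℓ, eW, i1, hA⟩ hb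
    simp only [Test.holds_wordLt, WExp.eval_var, e6, e2] at hb
    rw [show k = j by omega]
    exact hA
  · rintro j τ ⟨e0, e2, e4, e6, eℓ, eW, i1, hA⟩ hb
    simp only [Test.holds_wordLt, WExp.eval_var, e6, e2] at hb
    have hlt := hk.2 j hb
    have hle := h.jumpTo_le ((jumpTo n ℓ)^[j] c)
    have c1 : 1 % 2 ^ w = 1 := Nat.mod_eq_of_lt (by omega)
    have c5 : (j + 1) % 2 ^ w = j + 1 := Nat.mod_eq_of_lt (by omega)
    have c6 : jumpTo n ℓ ((jumpTo n ℓ)^[j] c) % 2 ^ w = jumpTo n ℓ ((jumpTo n ℓ)^[j] c) :=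
      Nat.mod_eq_of_lt (by omega)
    have c7 : ∀ υ : State, υ.wordVar 0 = n → υ.wordVar 4 = (jumpTo n ℓ)^[j] c →
        ((𝕧 4).mod (𝕧 0)).eval w υ = (jumpTo n ℓ)^[j] c % n := by
      intro υ f0 f4
      rw [WExp.eval_mod (by simp only [WExp.eval_var, f4]; omega)]
      simp only [WExp.eval_var, f4, f0]
    refine ⟨j + 1, ⟨by simp [e0], by simp [e2, c1, c5], ?_, by simp [e6], ?_, ?_, hb, ?_⟩, by omega⟩
    · rw [Function.iterate_succ_apply', ← c6]
      simp [c7, e0, e4, eℓ, jumpTo]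
    · ext1 i; simp [eℓ]
    · ext1 i; simp [eW]
    · intro i hi
      rcases Nat.lt_succ_iff_lt_or_eq.1 hi with h' | rfl
      · simpa [e2, h'.ne] using hA i h'
      · simp [e2, c7, e0, e4, eW]

end RealRAM


/-! ### The whole program and its running time. -/

namespace RealRAM

/-- Setting word variables `2` and `3` to zero. -/
def resetProgram : Program := .setWord 2 (𝕔 0) ;; .setWord 3 (𝕔 0)

/-- From the sorted indices to the longest jumps. -/
def prepareProgram : Program :=
  resetProgram ;; fillLoop ;; resetProgram ;; stopLoop 2 3 4 ;;
  resetProgram ;; stopLoop 4 5 5 ;; resetProgram ;; jumpLoop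

/-- The initialization of `greedyLoop`. -/
def seedProgram : Program :=
  .setWord 2 (𝕧 3) ;; .setWord 4 (𝕧 3) ;; .setWord 5 (𝕔 0) ;; .setWord 6 (𝕧 0 + 𝕔 1)

/-- The initialization of `outputLoop`. -/
def startProgram : Program := .setWord 2 (𝕔 0) ;; .setWord 4 (𝕧 7)

/-- From the longest jumps to the output. -/
def selectProgram : Program :=
  resetProgram ;; minLoop ;; seedProgram ;; greedyLoop ;; startProgram ;; outputLoop ;;
  .setWord 0 (𝕧 6)

/-- The steps of `prepareProgram` per point. -/
def prepareTime : ℕ :=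
  4 * resetProgram.time + 4 * fillLoop.iterTime + 5 * (stopLoop 2 3 4).iterTime +
    5 * (stopLoop 4 5 5).iterTime + 3 * jumpLoop.iterTime

/-- The steps of `selectProgram` per point. -/
def selectTime : ℕ :=
  resetProgram.time + minLoop.iterTime + seedProgram.time + 4 * greedyLoop.iterTime +
    startProgram.time + outputLoop.iterTime + (Program.setWord 0 (𝕧 6)).time

variable {n w N M : ℕ} {p q : Program} {σ : State} {Q : State → Prop}

lemma Run.eval_seq (hp : p.LoopFree) (hq : Run w q M (p.eval w σ) Q) :
    Run w (p ;; q) (p.time + M) σ Q :=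
  Run.seq (R := fun τ => τ = p.eval w σ) (Run.of_eval hp le_rfl rfl) fun _ h => h ▸ hq

lemma resetProgram_eval : resetProgram.eval w σ = (σ.setWord 2 0).setWord 3 0 := by
  simp [resetProgram]

lemma Frame.hasSeq {p : Program} {σ τ : State} (h : Frame p σ τ) {X Y m : ℕ} {f : ℤ → ℝ × ℝ}
    (hX : ¬ p.StoresReal X) (hY : ¬ p.StoresReal Y) (hs : HasSeq X Y m f σ) :
    HasSeq X Y m f τ := by
  intro k hk
  rw [h.realArr X hX, h.realArr Y hY]
  exact hs k hk

lemma prepareProgram_run (hM : 16 * n + 16 ≤ 2 ^ w) {x : ℕ → ℝ × ℝ} {ε : ℝ} (hn : 0 < n)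
    (hx : NoConvComb n x) (hc : HasCoords n x σ) (h0 : σ.wordVar 0 = n)
    (hε : σ.realVar 0 = ε) (hσ : Sorts n x (σ.wordArr 2)) :
    Run w prepareProgram (prepareTime * (n + 1)) σ fun τ =>
      JumpSystem n (fun i j : ℕ => Good ε (sortedSeq n x (σ.wordArr 2)) i j) (τ.wordArr 6) := by
  have hq := CcwSeq.of_sorts hn hx hσ
  have hr : resetProgram.LoopFree := by simp [resetProgram, Program.LoopFree]
  have frun := (fillLoop_run (w := w) (σ := (σ.setWord 2 0).setWord 3 0) hM hn hc (by simp [h0])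
    (by simp) hσ.lt).frame
  refine Run.mono (Run.eval_seq hr ?_) (?_ : resetProgram.time + (fillLoop.iterTime * (4 * n + 1) +
    (resetProgram.time + ((stopLoop 2 3 4).iterTime * (5 * n + 1) + (resetProgram.time +
    ((stopLoop 4 5 5).iterTime * (5 * n + 1) + (resetProgram.time +
    jumpLoop.iterTime * (3 * n + 1))))))) ≤ _) fun _ h => h
  · rw [resetProgram_eval]
    refine Run.seq frun ?_
    rintro τ ⟨⟨hA, hB⟩, fr⟩
    simp only [State.setWord_wordArr] at hA hB
    have f0 := fr.wordVar 0 (by simp [fillLoop, Program.SetsWord])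
    have fε := fr.realVar 0 (by simp [fillLoop, Program.SetsReal])
    simp [h0, hε] at f0 fε
    refine Run.eval_seq hr ?_
    rw [resetProgram_eval]
    refine Run.seq (stopLoop_run (ε := ε) (σ := (τ.setWord 2 0).setWord 3 0) hM hq hn hA
      (by simp [fε]) (by simp [f0]) (by simp) (by simp)).frame ?_
    rintro τ₁ ⟨hSA, fr₁⟩
    have g0 := fr₁.wordVar 0 (by simp [stopLoop, Program.SetsWord])
    have gε := fr₁.realVar 0 (by simp [stopLoop, Program.SetsReal])
    simp [f0, fε] at g0 gε
    replace hA := fr₁.hasSeq (by simp [stopLoop, Program.StoresReal])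
      (by simp [stopLoop, Program.StoresReal]) hA
    replace hB := fr₁.hasSeq (by simp [stopLoop, Program.StoresReal])
      (by simp [stopLoop, Program.StoresReal]) hB
    refine Run.eval_seq hr ?_
    rw [resetProgram_eval]
    refine Run.seq (stopLoop_run (ε := ε) (σ := (τ₁.setWord 2 0).setWord 3 0) hM hq.mir hn hB
      (by simp [gε]) (by simp [g0]) (by simp) (by simp)).frame ?_
    rintro τ₂ ⟨hSB, fr₂⟩
    have k0 := fr₂.wordVar 0 (by simp [stopLoop, Program.SetsWord])
    have kε := fr₂.realVar 0 (by simp [stopLoop, Program.SetsReal])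
    have k4 := fr₂.wordArr 4 (by simp [stopLoop, Program.StoresWord])
    simp [g0, gε] at k0 kε k4
    replace hA := fr₂.hasSeq (by simp [stopLoop, Program.StoresReal])
      (by simp [stopLoop, Program.StoresReal]) hA
    replace hB := fr₂.hasSeq (by simp [stopLoop, Program.StoresReal])
      (by simp [stopLoop, Program.StoresReal]) hB
    refine Run.eval_seq hr ?_
    rw [resetProgram_eval]
    exact jumpLoop_run (σ := (τ₂.setWord 2 0).setWord 3 0) hM hq hn hA hB
      (by simpa [k4] using hSA) (by simpa using hSB) (by simp [k0]) (by simp [kε]) (by simp)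
      (by simp)
  · unfold prepareTime
    generalize resetProgram.time = a
    generalize fillLoop.iterTime = b
    generalize (stopLoop 2 3 4).iterTime = c
    generalize (stopLoop 4 5 5).iterTime = d
    generalize jumpLoop.iterTime = e
    nlinarith [Nat.zero_le (a * n), Nat.zero_le (b * n), Nat.zero_le (c * n), Nat.zero_le (d * n),
      Nat.zero_le (e * n)]

lemma selectProgram_run (hM : 16 * n + 16 ≤ 2 ^ w) {G : ℕ → ℕ → Prop} {ℓ : ℕ → ℕ}
    (h : JumpSystem n G ℓ) (h0 : σ.wordVar 0 = n) (hℓ : σ.wordArr 6 = ℓ) :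
    Run w selectProgram (selectTime * (n + 1)) σ fun τ => ∃ s < n, ∃ c,
      JumpSystem.Closes n ℓ c (τ.wordVar 0) ∧
      (∀ c', s ≤ c' → c' ≤ s + ℓ s → ∀ t, c' + n ≤ (jumpTo n ℓ)^[t] c' → τ.wordVar 0 ≤ t) ∧
      ∀ j < τ.wordVar 0, τ.wordArr 0 j = σ.wordArr 2 ((jumpTo n ℓ)^[j] c % n) := by
  have hr : resetProgram.LoopFree := by simp [resetProgram, Program.LoopFree]
  refine Run.mono (Run.eval_seq hr ?_) (?_ : resetProgram.time + (minLoop.iterTime * (n + 1) +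
    (seedProgram.time + (greedyLoop.iterTime * (4 * n + 1) + (startProgram.time +
    (outputLoop.iterTime * (n + 1) + (Program.setWord 0 (𝕧 6)).time))))) ≤ _) fun _ h => h
  · rw [resetProgram_eval]
    refine Run.seq (minLoop_run (σ := (σ.setWord 2 0).setWord 3 0) hM h.pos (by simp [h0])
      (by simp) (by simp)).frame ?_
    rintro τ ⟨⟨hs, hmin⟩, fr⟩
    have f0 := fr.wordVar 0 (by simp [minLoop, Program.SetsWord])
    have f2 := fr.wordArr 2 (by simp [minLoop, Program.StoresWord])
    have f6 := fr.wordArr 6 (by simp [minLoop, Program.StoresWord])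
    simp [h0, hℓ] at f0 f2 f6
    rw [f6] at hmin
    generalize hsτ : τ.wordVar 3 = s at hs hmin
    have c1 : 1 % 2 ^ w = 1 := Nat.mod_eq_of_lt (by omega)
    have c2 : (n + 1) % 2 ^ w = n + 1 := Nat.mod_eq_of_lt (by omega)
    refine Run.eval_seq (by simp [seedProgram, Program.LoopFree]) ?_
    refine Run.seq (greedyLoop_run hM h hs hmin (by simp [seedProgram, f0])
      (by simp [seedProgram, hsτ]) (by simp [seedProgram, hsτ]) (by simp [seedProgram, hsτ])
      (by simp [seedProgram]) (by simp [seedProgram, f0, c1, c2])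
      (by simp [seedProgram, f6])).frame ?_
    rintro τ₁ ⟨⟨hc, hcl, hle⟩, fr₁⟩
    have g0 := fr₁.wordVar 0 (by simp [greedyLoop, Program.SetsWord])
    have g2 := fr₁.wordArr 2 (by simp [greedyLoop, Program.StoresWord])
    have g6 := fr₁.wordArr 6 (by simp [greedyLoop, Program.StoresWord])
    simp [seedProgram, f0, f2, f6] at g0 g2 g6
    generalize hkτ : τ₁.wordVar 6 = k at hcl hle
    generalize hcτ : τ₁.wordVar 7 = c at hc hcl
    refine Run.eval_seq (by simp [startProgram, Program.LoopFree]) ?_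
    refine Run.seq (outputLoop_run hM h hc.le hcl (by simp [startProgram, g0])
      (by simp [startProgram]) (by simp [startProgram, hcτ]) (by simp [startProgram, hkτ])
      (by simp [startProgram, g6])).frame ?_
    rintro τ₂ ⟨hout, fr₂⟩
    have k6 := fr₂.wordVar 6 (by simp [outputLoop, Program.SetsWord])
    simp [startProgram, hkτ] at k6
    refine Run.of_eval (by simp [Program.LoopFree]) le_rfl ⟨s, hs, c, ?_⟩
    simp only [Program.eval_setWord, State.setWord_wordVar, if_true, WExp.eval_var, k6,
      State.setWord_wordArr]
    refine ⟨hcl, hle, fun j hj => ?_⟩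
    rw [hout j hj]
    simp [startProgram, g2]
  · unfold selectTime
    generalize resetProgram.time = a
    generalize minLoop.iterTime = b
    generalize seedProgram.time = c
    generalize greedyLoop.iterTime = d
    generalize startProgram.time = e
    generalize outputLoop.iterTime = f
    generalize (Program.setWord 0 (𝕧 6)).time = g
    nlinarith [Nat.zero_le (a * n), Nat.zero_le (c * n), Nat.zero_le (d * n),
      Nat.zero_le (e * n), Nat.zero_le (g * n)]

lemma isBigO_sortTime_add (C : ℕ) :
    (fun n : ℕ => ((sortTime n + C * (n + 1) : ℕ) : ℝ)) =O[atTop]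
      fun n : ℕ => (n : ℝ) * Real.log (n : ℝ) ^ 2 := by
  have h1 : (fun n : ℕ => ((sortTime n + C * (n + 1) : ℕ) : ℝ)) =O[atTop]
      fun n : ℕ => (((n + 1) * (Nat.size n + 1) ^ 2 : ℕ) : ℝ) := by
    refine IsBigO.of_bound ((initProgram.time + placeLoop.iterTime + mergeTime + C : ℕ) : ℝ)
      (Eventually.of_forall fun n => ?_)
    rw [Real.norm_natCast, Real.norm_natCast]
    norm_cast
    unfold sortTime
    generalize initProgram.time = a
    generalize placeLoop.iterTime = b
    generalize mergeTime = d
    generalize Nat.size n = S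
    have e1 : n + 1 ≤ (n + 1) * (S + 1) ^ 2 := Nat.le_mul_of_pos_right _ (by positivity)
    calc a + (b * (n + 1) + d * ((n + 1) * (S + 1)) * (S + 1)) + C * (n + 1)
        ≤ a * (n + 1) + (b * (n + 1) + d * ((n + 1) * (S + 1)) * (S + 1)) + C * (n + 1) := by
          gcongr
          exact Nat.le_mul_of_pos_right _ n.succ_pos
      _ = (a + b + C) * (n + 1) + d * ((n + 1) * (S + 1) ^ 2) := by ring
      _ ≤ (a + b + C) * ((n + 1) * (S + 1) ^ 2) + d * ((n + 1) * (S + 1) ^ 2) := by gcongr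
      _ = (a + b + d + C) * ((n + 1) * (S + 1) ^ 2) := by ring
  have h2 : (fun n : ℕ => ((n + 1 : ℕ) : ℝ)) =O[atTop] fun n : ℕ => (n : ℝ) := by
    refine IsBigO.of_bound 2 ((eventually_ge_atTop 1).mono fun n hn => ?_)
    rw [Real.norm_natCast, Real.norm_natCast]
    norm_cast
    omega
  have h3 : (fun n : ℕ => ((Nat.size n + 1 : ℕ) : ℝ)) =O[atTop] fun n : ℕ => Real.log n := by
    -- If `Nat.size n = m + 1`, then `m * log 2 ≤ log n`, and the remaining `2 * log 2` is at most
    -- `2 * log n` for `n ≥ 2`.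
    refine IsBigO.of_bound (3 / Real.log 2) ((eventually_ge_atTop 2).mono fun n hn => ?_)
    have hn0 : (0 : ℝ) < n := by positivity
    have hn2 : Real.log 2 ≤ Real.log n := Real.log_le_log two_pos (by exact_mod_cast hn)
    have hl2 := Real.log_pos one_lt_two
    rw [Real.norm_natCast, Real.norm_of_nonneg (hl2.le.trans hn2), div_mul_eq_mul_div,
      le_div_iff₀ hl2]
    obtain ⟨m, hm⟩ : ∃ m, Nat.size n = m + 1 :=
      Nat.exists_eq_succ_of_ne_zero (Nat.size_pos.2 (by omega)).ne'
    have hpow : 2 ^ m ≤ n := Nat.lt_size.1 (by omega)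
    have hlog : (m : ℝ) * Real.log 2 ≤ Real.log n := by
      rw [← Real.log_pow]
      exact Real.log_le_log (by positivity) (by exact_mod_cast hpow)
    rw [hm]
    push_cast
    linarith
  refine h1.trans ?_
  push_cast
  have := h2.mul (h3.pow 2)
  push_cast at this
  exact this

end RealRAM


theorem mainTheorem1 :
    ∃ (prog : RealRAM.Program) (d : ℕ) (T : ℕ → ℕ),
      ((fun n : ℕ => (T n : ℝ)) =O[atTop] fun n : ℕ => (n : ℝ) * Real.log (n : ℝ) ^ 2) ∧
      ∀ (P : Finset Plane), P.Nonempty → InConvexPosition P →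
      ∀ (x : Fin P.card ≃ P) (ε : ℝ), 0 < ε →
      ∀ w : ℕ, d * (Nat.log 2 P.card + 1) ≤ w →
        ∃ (τ : RealRAM.State) (t : ℕ),
          RealRAM.Exec w prog (RealRAM.input (fun i => (x i : Plane)) ε) τ t ∧
          t ≤ T P.card ∧
          IsLeast {k : ℕ | ∃ Q : Finset Plane, Q ⊆ P ∧ Q.card ≤ k ∧ cost Q P ≤ ENNReal.ofReal ε}
            (τ.wordVar 0) ∧
          ∃ idx : Fin (τ.wordVar 0) → Fin P.card,
            (∀ j : Fin (τ.wordVar 0), τ.wordArr 0 (j : ℕ) = (idx j : ℕ)) ∧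
            cost (Finset.univ.image fun j => (x (idx j) : Plane)) P ≤ ENNReal.ofReal ε := by
  open RealRAM in
  -- With `L = Nat.log 2 n + 1`, the proof needs words of `5 + L` bits to hold `16 * n + 16` without
  -- overflow; as `L ≥ 1`, `6 * L` bits are enough.
  refine ⟨sortProgram ;; prepareProgram ;; selectProgram, 6,
    fun n => sortTime n + (prepareTime + selectTime) * (n + 1), isBigO_sortTime_add _, ?_⟩
  intro P hP hcv x ε hε w hw
  have hn := hP.card_pos
  have hx := hcv.noConvComb x
  have hM : 16 * P.card + 16 ≤ 2 ^ w := by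
    have h1 : P.card < 2 ^ (Nat.log 2 P.card + 1) := Nat.lt_pow_succ_log_self one_lt_two _
    calc 16 * P.card + 16 = 16 * (P.card + 1) := by ring
      _ ≤ 2 ^ 5 * 2 ^ (Nat.log 2 P.card + 1) := by omega
      _ = 2 ^ (5 + (Nat.log 2 P.card + 1)) := (pow_add _ _ _).symm
      _ ≤ 2 ^ w := Nat.pow_le_pow_right two_pos (by omega)
  set σ := input (fun i => (x i : Plane)) ε with hσ
  have hc : HasCoords P.card (coords x) σ := by
    intro k hk
    simp [hσ, input, coords, hk, toPair_apply]
  have h0 : σ.wordVar 0 = P.card := by simp [hσ, input]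
  have hrun : Run w (sortProgram ;; prepareProgram ;; selectProgram)
      (sortTime P.card + (prepareTime * (P.card + 1) + selectTime * (P.card + 1))) σ fun τ =>
      IsLeast {k : ℕ | ∃ Q : Finset Plane, Q ⊆ P ∧ Q.card ≤ k ∧ cost Q P ≤ ENNReal.ofReal ε}
        (τ.wordVar 0) ∧
      ∃ idx : Fin (τ.wordVar 0) → Fin P.card,
        (∀ j : Fin (τ.wordVar 0), τ.wordArr 0 (j : ℕ) = (idx j : ℕ)) ∧
        cost (Finset.univ.image fun j => (x (idx j) : Plane)) P ≤ ENNReal.ofReal ε := by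
    refine Run.seq (sortProgram_run hM hx hn hc h0 (by simp [hσ, input])).frame ?_
    rintro τ₁ ⟨hs, fr₁⟩
    have f0 := fr₁.wordVar 0 (by simp [sortProgram, initProgram, placeLoop, mergeLoop, rankLoop,
      siblingProgram, searchLoop, addRankProgram, doubleProgram, Program.SetsWord])
    have fr : ∀ a, τ₁.realArr a = σ.realArr a := fun a => fr₁.realArr a (by
      simp [sortProgram, initProgram, placeLoop, mergeLoop, rankLoop,
        siblingProgram, searchLoop, addRankProgram, doubleProgram, Program.StoresReal])
    have fε := fr₁.realVar 0 (by simp [sortProgram, initProgram, placeLoop, mergeLoop, rankLoop,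
      siblingProgram, searchLoop, addRankProgram, doubleProgram, Program.SetsReal])
    replace f0 := f0.trans h0
    replace fε : τ₁.realVar 0 = ε := fε.trans (by simp [hσ, input])
    refine Run.seq (prepareProgram_run hM hn hx (fun k hk => by rw [fr, fr]; exact hc k hk) f0 fε
      hs).frame ?_
    rintro τ₂ ⟨hJ, fr₂⟩
    have g0 := fr₂.wordVar 0 (by simp [prepareProgram, resetProgram, fillLoop, stopLoop, jumpLoop,
      Program.SetsWord])
    have g2 := fr₂.wordArr 2 (by simp [prepareProgram, resetProgram, fillLoop, stopLoop, jumpLoop,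
      Program.StoresWord])
    rw [← g2] at hJ hs
    refine (selectProgram_run hM hJ (g0.trans f0) rfl).mono le_rfl ?_
    rintro τ ⟨s, hsn, c, hcl, hmin, hout⟩
    have hlt : ∀ j : Fin (τ.wordVar 0), τ.wordArr 0 j < P.card := fun j => by
      rw [hout j j.2]
      exact hs.lt _ (Nat.mod_lt _ hn)
    obtain ⟨r1, r2⟩ := isLeast_of_greedy x hP hcv hs hε hJ hsn hcl.1 hcl.2 hmin
      (fun j => ⟨_, hlt j⟩) fun j => hout j j.2
    exact ⟨r1, _, fun _ => rfl, r2⟩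
  obtain ⟨τ, t, he, ht, h1, h2⟩ := hrun
  refine ⟨τ, t, he, ht.trans (le_of_eq ?_), h1, h2⟩
  simp only [add_mul]
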